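/- **Setting.** Let $R$ be an associative ring with $1$ and with an involution $a\mapsto\bar a$, and suppose that $R$ is almost commutative, i.e. finitely generated as a module over its center $C(R)$. Let $\lambda\in C(R)$ with $\lambda\bar\lambda=1$ and let $\Lambda$ be a form parameter: an additive subgroup with $\{a-\lambda\bar a : a\in R\}\subseteq\Lambda\subseteq\{a : a=-\lambda\bar a\}$ and $\bar x\Lambda x\subseteq\Lambda$ for all $x\in R$. Let $J\subseteq R$ be a two-sided ideal with $\bar J=J$. Let $P$ be a finitely generated projective right $R$-module with a sesquilinear form $f$ (biadditive, $f(pa,qb)=\bar a f(p,q)b$), with Hermitian form $h(p,q)=f(p,q)+\lambda\overline{f(q,p)}$, assumed non-singular ($p\mapsto h(p,\cdot)$ is a bijection $P\to \mathrm{Hom}_R(P,R)$), and quadratic form $q(p)=f(p,p)+\Lambda\in R/\Lambda$. Let $Q=P\perp\mathbb H(R)=P\oplus R\oplus R$ with the sesquilinear form $f(p,p')+\bar a b'$ at $((p,a,b),(p',a',b'))$; its Hermitian and quadratic forms are again denoted by $h$ and $q$. Extend the involution to $R[X]$ by $\bar X=X$, write $\Lambda[X]$, $J[X]$ for the polynomials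 with coefficients in $\Lambda$, $J$, and extend the forms to $P[X]$ and $Q[X]=P[X]\perp\mathbb H(R[X])$. * $\mathrm{GQ}(Q[X],\Lambda[X],J[X])$ is the group of $R[X]$-automorphisms $\sigma$ of $Q[X]$ that preserve $h$ and $q$ and satisfy $\sigma\equiv \mathrm{Id}$ modulo $Q[X]J[X]$. * An elementary transvection of $Q$ is a map $\sigma_{u,v,a}(x)=x+u\,h(v,x)-v\bar\lambda h(u,x)-u\bar\lambda a\,h(u,x)$ with $u\in\{(0,1,0),(0,0,1)\}$, $v\in P$ and $a\in R$, $a\equiv f(v,v)\pmod\Lambda$; it is relative to $J$ if $v\in PJ$ and $a\in J$. $\mathrm{ET}(Q,\Lambda)$ is the group they generate, and $\mathrm{ET}(Q,\Lambda,J)$ is the normal closure in $\mathrm{ET}(Q,\Lambda)$ of the subgroup generated by those relative to $J$. $\mathrm{ET}(Q[X],\Lambda[X],J[X])$ is the same group for $P[X]$ over $(R[X],\Lambda[X])$ and $J[X]$. * For $\mathfrak m\in\mathrm{Max}(C(R))$, $R_{\mathfrak m}$ is the localization of $R$ at $S=C(R)\setminus(\mathfrak m\cup\bar{\mathfrak m})$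 (which is $C(R)\setminus\mathfrak m$ when $\bar{\mathfrak m}=\mathfrak m$), with the involution $\overline{r/s}=\bar r/\bar s$; $\Lambda_{\mathfrak m}=\{a/(\bar s s): a\in\Lambda, s\in S\}$ and $J_{\mathfrak m}=\{a/s: a\in J,s\in S\}$; $Q_{\mathfrak m}$ is the localization of $Q$ at $S$. * For a form ring $(A,\Lambda)$ (with $\lambda$) and an ideal $J$ of $A$, $\mathrm{EQ}(2N,A,\Lambda,J)$ is the group generated by the matrices $\eta(x)\,\eta'(a)\,\eta(x)^{-1}$ with $x\in A$, $a\in J$, where $(\eta,\eta')$ is one of the pairs $(q\varepsilon_{ij},q\varepsilon_{ji})$ for $i\ne j$, $(qr_{ij},ql_{ji})$, $(ql_{ij},qr_{ji})$ for $1\le i,j\le N$. Here, with $\rho(i)=N+i$: $q\varepsilon_{ij}(a)=\mathrm I+ae_{ij}-\bar a e_{\rho(j)\rho(i)}$; for $i\neq j$, $qr_{ij}(a)=\mathrm I+ae_{i\rho(j)}-\bar\lambda\bar a e_{j\rho(i)}$ and $ql_{ij}(a)=\mathrm I+ae_{\rho(i)j}-\lambda\bar a e_{\rho(j)i}$; and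 $qr_{ii}(a)=\mathrm I+ae_{i\rho(i)}$ with $\bar a\in\Lambda$, $ql_{ii}(a)=\mathrm I+ae_{\rho(i)i}$ with $a\in\Lambda$. These matrices act on the columns $A^{2N}=\mathbb H(A^N)$ with sesquilinear form $(v,w)\mapsto\sum_{i\le N}\bar v_i w_{\rho(i)}$, whose Hermitian form has the matrix $\begin{pmatrix}0&\mathrm I_N\\ \lambda \mathrm I_N&0\end{pmatrix}$. **Theorem (relative local-global principle for transvection subgroups).** Let $n\ge 3$, and suppose that for every $\mathfrak m\in\mathrm{Max}(C(R))$ an isometry (an isomorphism that preserves the Hermitian forms and the quadratic forms) of $Q_{\mathfrak m}$ with the hyperbolic module $\mathbb H(R_{\mathfrak m}^{n+1})=R_{\mathfrak m}^{2n+2}$ over $(R_{\mathfrak m},\Lambda_{\mathfrak m})$ is given. Let $\sigma(X)\in\mathrm{GQ}(Q[X],\Lambda[X],J[X])$ with $\sigma(0)=\mathrm{Id}$. If for every $\mathfrak m\in\mathrm{Max}(C(R))$ the matrix of the localization $\sigma_{\mathfrak m}(X)$ under the given isometry lies in $\mathrm{EQ}(2n+2,R_{\mathfrak m}[X],\Lambda_{\mathfrak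 m}[X],J_{\mathfrak m}[X])$, then $\sigma(X)\in\mathrm{ET}(Q[X],\Lambda[X],J[X])$. -/

import Mathlib

open MulOpposite Polynomial

noncomputable section

namespace QuadLG

/-! ### Form rings -/

section FormRing

variable {R : Type*} [Ring R] [StarRing R]

/-- `(R, Λ)` is a form ring with respect to `lam`: `lam` is central with `lam * star lam = 1`, and
`Λ` is an additive subgroup with `Λ_min ⊆ Λ ⊆ Λ_max` that is closed under `a ↦ star x * a * x`. -/
structure IsFormRing (lam : R) (Λ : AddSubgroup R) : Prop where
  lam_central : lam ∈ Subring.center R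
  lam_mul_star : lam * star lam = 1
  min_le : ∀ a : R, a - lam * star a ∈ Λ
  le_max : ∀ a ∈ Λ, a = -(lam * star a)
  conj_mem : ∀ x : R, ∀ a ∈ Λ, star x * a * x ∈ Λ

end FormRing

/-! ### Sesquilinear forms and quadratic modules.

Right `R`-modules are modules over `Rᵐᵒᵖ`: the element `p a` is `op a • p`. -/

/-- A sesquilinear form on a right `R`-module: biadditive with `f (p a) (q b) = ā f(p, q) b`. -/
structure SesqForm (R P : Type*) [Ring R] [StarRing R] [AddCommGroup P] [Module Rᵐᵒᵖ P] where
  toFun : P → P → R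
  add_left : ∀ p p' q, toFun (p + p') q = toFun p q + toFun p' q
  add_right : ∀ p q q', toFun p (q + q') = toFun p q + toFun p q'
  smul_smul : ∀ (p q : P) (a b : R), toFun (op a • p) (op b • q) = star a * toFun p q * b

section QuadraticModule

variable {R P : Type*} [Ring R] [StarRing R] [AddCommGroup P] [Module Rᵐᵒᵖ P]

instance : CoeFun (SesqForm R P) (fun _ => P → P → R) := ⟨SesqForm.toFun⟩

/-- The `lam`-Hermitian form `h(p, q) = f(p, q) + lam * conj f(q, p)` associated with `f`. -/
def SesqForm.herm (f : SesqForm R P) (lam : R) (p q : P) : R := f p q + lam * star (f q p)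

/-- The Hermitian form is non-singular: `p ↦ h(p, ·)` is a bijection of `P` onto its dual. -/
def SesqForm.Nonsingular (f : SesqForm R P) (lam : R) : Prop :=
  ∀ φ : P →ₗ[Rᵐᵒᵖ] R, ∃! p : P, ∀ x : P, f.herm lam p x = φ x

/-- The general quadratic group of the quadratic module `(P, h, q)`, where `h` is the Hermitian
form of `f` and `q(p) = f(p, p) + Λ`: the automorphisms that preserve `h` and `q`. -/
def GQ (f : SesqForm R P) (lam : R) (Λ : AddSubgroup R) : Subgroup (P ≃ₗ[Rᵐᵒᵖ] P) where
  carrier := {α | (∀ u v, f.herm lam (α u) (α v) = f.herm lam u v) ∧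
    ∀ u, f (α u) (α u) - f u u ∈ Λ}
  one_mem' := ⟨fun _ _ => rfl, fun u => by simp⟩
  mul_mem' := by
    rintro α β ⟨h1, h2⟩ ⟨h3, h4⟩
    refine ⟨fun u v => by simp [h1, h3], fun u => ?_⟩
    have := Λ.add_mem (h2 (β u)) (h4 u)
    simpa using this
  inv_mem' := by
    rintro α ⟨h1, h2⟩
    have key : ∀ u, α (α⁻¹ u) = u := fun u => α.apply_symm_apply u
    refine ⟨fun u v => by rw [← h1, key, key], fun u => ?_⟩
    have := Λ.neg_mem (h2 (α⁻¹ u))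
    rw [key] at this
    simpa using this

/-- The submodule `P J` (written `JP` for a two-sided ideal `J`) spanned by all `p j`, `j ∈ J`. -/
def idealMul (P : Type*) [AddCommGroup P] [Module Rᵐᵒᵖ P] (J : AddSubgroup R) :
    Submodule Rᵐᵒᵖ P :=
  Submodule.span Rᵐᵒᵖ {x | ∃ j ∈ J, ∃ p : P, x = op j • p}

/-- The relative general quadratic group: the elements of `GQ` that are the identity modulo `JP`. -/
def relGQ (f : SesqForm R P) (lam : R) (Λ J : AddSubgroup R) : Subgroup (P ≃ₗ[Rᵐᵒᵖ] P) where
  carrier := {α | α ∈ GQ f lam Λ ∧ ∀ x, α x - x ∈ idealMul P J}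
  one_mem' := ⟨one_mem _, fun x => by simp⟩
  mul_mem' := by
    rintro α β ⟨h1, h2⟩ ⟨h3, h4⟩
    refine ⟨mul_mem h1 h3, fun x => ?_⟩
    have := (idealMul P J).add_mem (h2 (β x)) (h4 x)
    simpa using this
  inv_mem' := by
    rintro α ⟨h1, h2⟩
    refine ⟨inv_mem h1, fun x => ?_⟩
    have := (idealMul P J).neg_mem (h2 (α⁻¹ x))
    rw [show α (α⁻¹ x) = x from α.apply_symm_apply x] at this
    simpa using this

/-- The transvection formula
`σ_{u,v,a}(x) = x + u h(v,x) - v lam̄ h(u,x) - u lam̄ a h(u,x)`. -/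
def transvection (f : SesqForm R P) (lam : R) (u v : P) (a : R) (x : P) : P :=
  x + op (f.herm lam v x) • u - op (star lam * f.herm lam u x) • v
    - op (star lam * a * f.herm lam u x) • u

/-! ### The module `Q = P ⊥ H(R)` and its elementary transvections -/

/-- The sesquilinear form on `Q = P ⊥ H(R) = P × R × R`:
`((p,a,b), (p',a',b')) ↦ f(p,p') + ā b'`. -/
def SesqForm.hyp (f : SesqForm R P) : SesqForm R (P × R × R) where
  toFun x y := f x.1 y.1 + star x.2.1 * y.2.2
  add_left p p' q := by simp [f.add_left, add_mul]; abel
  add_right p q q' := by simp [f.add_right, mul_add]; abel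
  smul_smul p q a b := by simp [f.smul_smul, mul_add, add_mul, mul_assoc]

/-- `τ` is an elementary transvection of `Q = P ⊥ H(R)`: a transvection `σ_{u,v,a}` where `u` is one
of the two standard basis vectors of `H(R)`, `v ∈ P`, and `a ≡ f(v, v)` modulo `Λ`. For `u = (0,0,1)`
it sends `(p, x, y)` to `(p - v x, x, y + h(v, p) - a x)`, and for `u = (0,1,0)` it sends `(p, x, y)`
to `(p - v lam̄ y, x + h(v, p) - lam̄ a y, y)`. It is relative to `J` if `v ∈ JP` and `a ∈ J`. -/
def IsElemTransvection (f : SesqForm R P) (lam : R) (Λ J : AddSubgroup R)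
    (τ : (P × R × R) ≃ₗ[Rᵐᵒᵖ] (P × R × R)) : Prop :=
  ∃ u : P × R × R, (u = (0, 1, 0) ∨ u = (0, 0, 1)) ∧
    ∃ v ∈ idealMul P J, ∃ a ∈ J, f v v - a ∈ Λ ∧
      ∀ x, τ x = transvection f.hyp lam u (v, 0, 0) a x

/-- `ET(Q, Λ)`, the group generated by all elementary transvections of `Q = P ⊥ H(R)`. -/
def ET (f : SesqForm R P) (lam : R) (Λ : AddSubgroup R) :
    Subgroup ((P × R × R) ≃ₗ[Rᵐᵒᵖ] (P × R × R)) :=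
  Subgroup.closure {τ | IsElemTransvection f lam Λ ⊤ τ}

/-- `ET(Q, Λ, J)`, the normal closure in `ET(Q, Λ)` of the group generated by the elementary
transvections relative to `J`. -/
def relET (f : SesqForm R P) (lam : R) (Λ J : AddSubgroup R) :
    Subgroup ((P × R × R) ≃ₗ[Rᵐᵒᵖ] (P × R × R)) :=
  Subgroup.closure {τ | ∃ g ∈ ET f lam Λ, ∃ t, IsElemTransvection f lam Λ J t ∧ τ = g * t * g⁻¹}

end QuadraticModule

/-! ### The hyperbolic module and the elementary quadratic matrices -/

section Matrices

variable {A : Type*} [Ring A] [StarRing A] {ι : Type*} [Fintype ι] [DecidableEq ι]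

/-- The sesquilinear form `(v, w) ↦ ∑ i, conj (v i) * w (ρ i)` on the module of columns `A^{2n}`;
its Hermitian form has the matrix `ψ = (0 1; lam 0)`. -/
def stdForm (A ι : Type*) [Ring A] [StarRing A] [Fintype ι] : SesqForm A (ι ⊕ ι → A) where
  toFun v w := ∑ i, star (v (Sum.inl i)) * w (Sum.inr i)
  add_left p p' q := by simp [add_mul, Finset.sum_add_distrib]
  add_right p q q' := by simp [mul_add, Finset.sum_add_distrib]
  smul_smul p q a b := by simp [Finset.mul_sum, Finset.sum_mul, mul_assoc]

/-- The index of an elementary quadratic matrix: `qε i j` (with `i ≠ j`), `qr i j`, `ql i j`. -/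
inductive ElemIndex (ι : Type*) where
  | qε (i j : ι) (h : i ≠ j)
  | qr (i j : ι)
  | ql (i j : ι)

/-- The opposite index (the passage from `η_ij` to `η_ji`, with row and column indices running
through all of `1, …, 2n`). -/
def ElemIndex.opp : ElemIndex ι → ElemIndex ι
  | .qε i j h => .qε j i h.symm
  | .qr i j => .ql j i
  | .ql i j => .qr j i

/-- The admissible parameters of an elementary quadratic matrix: all of `A`, except that `ql_ii`
takes its parameter in `Λ` and `qr_ii` in `Λ̄`. -/
def ElemIndex.Admissible (Λ : AddSubgroup A) : ElemIndex ι → A → Prop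
  | .qε _ _ _, _ => True
  | .qr i j, a => i = j → star a ∈ Λ
  | .ql i j, a => i = j → a ∈ Λ

/-- The elementary quadratic matrices for the form `ψ = (0 1; lam 0)`. -/
def elemMatrix (lam : A) : ElemIndex ι → A → Matrix (ι ⊕ ι) (ι ⊕ ι) A
  | .qε i j _, a => 1 + Matrix.single (Sum.inl i) (Sum.inl j) a
      - Matrix.single (Sum.inr j) (Sum.inr i) (star a)
  | .qr i j, a => if i = j then 1 + Matrix.single (Sum.inl i) (Sum.inr j) a
      else 1 + Matrix.single (Sum.inl i) (Sum.inr j) a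
        - Matrix.single (Sum.inl j) (Sum.inr i) (star lam * star a)
  | .ql i j, a => if i = j then 1 + Matrix.single (Sum.inr i) (Sum.inl j) a
      else 1 + Matrix.single (Sum.inr i) (Sum.inl j) a
        - Matrix.single (Sum.inr j) (Sum.inl i) (lam * star a)

/-- The relative elementary quadratic group `EQ(2n, A, Λ, J)`, generated by the matrices
`η_ij(x) η_ji(a) η_ij(x)⁻¹` with `x ∈ A` and `a ∈ J` admissible. -/
def relEQ (ι : Type*) [Fintype ι] [DecidableEq ι] (lam : A) (Λ J : AddSubgroup A) :
    Subgroup (Matrix (ι ⊕ ι) (ι ⊕ ι) A)ˣ :=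
  Subgroup.closure {g | ∃ (r : ElemIndex ι) (x a : A), r.Admissible Λ x ∧ r.opp.Admissible Λ a ∧
    a ∈ J ∧ ∃ y z : (Matrix (ι ⊕ ι) (ι ⊕ ι) A)ˣ,
      (y : Matrix (ι ⊕ ι) (ι ⊕ ι) A) = elemMatrix lam r x ∧
      (z : Matrix (ι ⊕ ι) (ι ⊕ ι) A) = elemMatrix lam r.opp a ∧ g = y * z * y⁻¹}

end Matrices

/-! ### Polynomial extensions -/

section Poly

variable {R : Type*} [Ring R]

/-- `H[X]`: the polynomials with all coefficients in the additive subgroup `H`. -/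
def polySubgroup (H : AddSubgroup R) : AddSubgroup R[X] where
  carrier := {p | ∀ i, p.coeff i ∈ H}
  zero_mem' i := by simp
  add_mem' hp hq i := by rw [coeff_add]; exact H.add_mem (hp i) (hq i)
  neg_mem' hp i := by rw [coeff_neg]; exact H.neg_mem (hp i)

/-- The coefficientwise involution of `R[X]`, as an additive map. -/
def polyBar (R : Type*) [Ring R] [StarRing R] : R[X] →+ R[X] where
  toFun p := p.sum fun i a => monomial i (star a)
  map_zero' := by simp
  map_add' p q := Polynomial.sum_add_index _ _ _ (by simp) (by simp)

theorem polyBar_monomial [StarRing R] (i : ℕ) (a : R) :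
    polyBar R (monomial i a) = monomial i (star a) := by
  change (monomial i a).sum (fun i a => monomial i (star a)) = _
  rw [Polynomial.sum_monomial_index]; simp

/-- The involution of `R[X]` that extends the one of `R` and fixes `X`. -/
instance polyStarRing [StarRing R] : StarRing R[X] where
  star := polyBar R
  star_involutive p := by
    induction p using Polynomial.induction_on' with
    | add p q hp hq => simp only [map_add]; rw [hp, hq]
    | monomial n a => simp only [polyBar_monomial, star_star]
  star_mul p q := by
    change polyBar R (p * q) = polyBar R q * polyBar R p
    induction p using Polynomial.induction_on' with
    | add p p' hp hp' => rw [add_mul, map_add, hp, hp', map_add, mul_add]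
    | monomial n a =>
      induction q using Polynomial.induction_on' with
      | add q q' hq hq' => rw [mul_add, map_add, hq, hq', map_add, add_mul]
      | monomial m b =>
        simp only [monomial_mul_monomial, polyBar_monomial, star_mul, add_comm n m]
  star_add := map_add (polyBar R)

theorem star_monomial [StarRing R] (i : ℕ) (a : R) :
    star (monomial i a : R[X]) = monomial i (star a) := polyBar_monomial i a

/-- `P[X]`: finitely supported sequences `∑ pᵢ Xⁱ` with coefficients in `P`. -/
def PolyMod (P : Type*) [AddCommGroup P] : Type _ := ℕ →₀ P

instance (P : Type*) [AddCommGroup P] : AddCommGroup (PolyMod P) :=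
  inferInstanceAs (AddCommGroup (ℕ →₀ P))

variable {P : Type*} [AddCommGroup P]

/-- The sequence of coefficients of an element of `P[X]`. -/
def PolyMod.coeffs : PolyMod P ≃+ (ℕ →₀ P) := AddEquiv.refl (ℕ →₀ P)

/-- The element `p Xⁱ` of `P[X]`. -/
def PolyMod.mono (i : ℕ) : P →+ PolyMod P :=
  PolyMod.coeffs.symm.toAddMonoidHom.comp (Finsupp.singleAddHom i)

/-- The `i`-th coefficient of an element of `P[X]`. -/
def PolyMod.coeff (i : ℕ) (x : PolyMod P) : P := PolyMod.coeffs x i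

theorem PolyMod.coeffs_mono (i : ℕ) (p : P) :
    PolyMod.coeffs (PolyMod.mono i p) = Finsupp.single i p := rfl

/-- Multiplication by `X` on `P[X]`. -/
def PolyMod.shift : AddMonoid.End (PolyMod P) :=
  Finsupp.liftAddHom fun i => PolyMod.mono (i + 1)

variable [Module Rᵐᵒᵖ P]

/-- Multiplication by a scalar of `R` on `P[X]`, coefficientwise. -/
def PolyMod.scalar : Rᵐᵒᵖ →+* AddMonoid.End (PolyMod P) :=
  Module.toAddMonoidEnd Rᵐᵒᵖ (ℕ →₀ P)

theorem PolyMod.scalar_mono (a : Rᵐᵒᵖ) (i : ℕ) (p : P) :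
    PolyMod.scalar a (PolyMod.mono i p) = PolyMod.mono i (a • p) :=
  Finsupp.smul_single a i p

theorem PolyMod.shift_mono (i : ℕ) (p : P) :
    PolyMod.shift (PolyMod.mono i p) = PolyMod.mono (i + 1) p :=
  Finsupp.liftAddHom_apply_single (fun i => PolyMod.mono (i + 1)) i p

theorem PolyMod.induction {C : PolyMod P → Prop} (x : PolyMod P) (h0 : C 0)
    (hadd : ∀ x y, C x → C y → C (x + y)) (hmono : ∀ i p, C (PolyMod.mono i p)) : C x :=
  Finsupp.induction_linear x h0 hadd hmono

theorem PolyMod.scalar_comm (a : Rᵐᵒᵖ) :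
    Commute (PolyMod.scalar a) (PolyMod.shift (P := P)) := by
  refine AddMonoidHom.ext fun x => ?_
  change PolyMod.scalar a (PolyMod.shift x) = PolyMod.shift (PolyMod.scalar a x)
  induction x using PolyMod.induction with
  | h0 => simp only [map_zero]
  | hadd x y hx hy => simp only [map_add, hx, hy]
  | hmono i p => simp only [PolyMod.shift_mono, PolyMod.scalar_mono]

/-- The ring homomorphism that defines the right action of `R[X]` on `P[X]`. -/
def PolyMod.action : R[X]ᵐᵒᵖ →+* AddMonoid.End (PolyMod P) :=
  RingHom.comp (Polynomial.eval₂RingHom' (PolyMod.scalar (R := R) (P := P)) PolyMod.shift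
    PolyMod.scalar_comm) (Polynomial.opRingEquiv R : R[X]ᵐᵒᵖ →+* Rᵐᵒᵖ[X])

/-- `P[X]` as a right module over `R[X]`, with `(p Xⁱ)(a Xʲ) = (p a) Xⁱ⁺ʲ`. -/
instance : Module R[X]ᵐᵒᵖ (PolyMod P) :=
  Module.compHom (PolyMod P) (PolyMod.action (R := R) (P := P))

theorem PolyMod.smul_mono (i j : ℕ) (p : P) (a : R) :
    op (monomial j a) • PolyMod.mono i p = PolyMod.mono (i + j) (op a • p) := by
  change PolyMod.action (op (monomial j a)) (PolyMod.mono i p) = _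
  have h : PolyMod.action (P := P) (op (monomial j a)) =
      PolyMod.scalar (op a) * PolyMod.shift ^ j := by
    simp [PolyMod.action, Polynomial.eval₂RingHom', Polynomial.eval₂_monomial]
  have h2 : ∀ k : ℕ, (PolyMod.shift (P := P) ^ k) (PolyMod.mono i p) = PolyMod.mono (i + k) p := by
    intro k
    induction k with
    | zero => rfl
    | succ k ih =>
      rw [pow_succ']
      change PolyMod.shift ((PolyMod.shift ^ k) (PolyMod.mono i p)) = _
      rw [ih, PolyMod.shift_mono]; rfl
  rw [h]
  change PolyMod.scalar (op a) ((PolyMod.shift ^ j) (PolyMod.mono i p)) = _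
  rw [h2, PolyMod.scalar_mono]

variable [StarRing R]

/-- The sesquilinear form on `P[X]`, as a plain function:
`(∑ pᵢ Xⁱ, ∑ qⱼ Xʲ) ↦ ∑ f(pᵢ, qⱼ) Xⁱ⁺ʲ`. -/
def polyFormFun (f : SesqForm R P) (x y : PolyMod P) : R[X] :=
  (PolyMod.coeffs x).sum fun i p => (PolyMod.coeffs y).sum fun j q => monomial (i + j) (f p q)

theorem SesqForm.zero_left (f : SesqForm R P) (q : P) : f 0 q = 0 := by
  have := f.add_left 0 0 q
  simpa using this

theorem SesqForm.zero_right (f : SesqForm R P) (q : P) : f q 0 = 0 := by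
  have := f.add_right q 0 0
  simpa using this

theorem polyFormFun_add_left (f : SesqForm R P) (x x' y : PolyMod P) :
    polyFormFun f (x + x') y = polyFormFun f x y + polyFormFun f x' y := by
  simp only [polyFormFun, map_add]
  refine Finsupp.sum_add_index' (fun i => ?_) (fun i p p' => ?_)
  · simp [f.zero_left]
  · simp [f.add_left, Finsupp.sum_add]

theorem polyFormFun_add_right (f : SesqForm R P) (x y y' : PolyMod P) :
    polyFormFun f x (y + y') = polyFormFun f x y + polyFormFun f x y' := by
  simp only [polyFormFun, map_add]
  rw [← Finsupp.sum_add]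
  congr 1
  funext i p
  refine Finsupp.sum_add_index' (fun j => ?_) (fun j q q' => ?_)
  · simp [f.zero_right]
  · simp [f.add_right]

theorem polyFormFun_mono (f : SesqForm R P) (i j : ℕ) (p q : P) :
    polyFormFun f (PolyMod.mono i p) (PolyMod.mono j q) = monomial (i + j) (f p q) := by
  simp only [polyFormFun, PolyMod.coeffs_mono]
  rw [Finsupp.sum_single_index, Finsupp.sum_single_index]
  · simp [f.zero_right]
  · simp [f.zero_left]

/-- The sesquilinear form on `P[X]` over `R[X]` that extends `f`. -/
def SesqForm.poly (f : SesqForm R P) : SesqForm R[X] (PolyMod P) where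
  toFun := polyFormFun f
  add_left := polyFormFun_add_left f
  add_right := polyFormFun_add_right f
  smul_smul x y a b := by
    have zl : ∀ y, polyFormFun f 0 y = 0 := fun y => by
      have := polyFormFun_add_left f 0 0 y
      simpa using this
    have zr : ∀ x, polyFormFun f x 0 = 0 := fun x => by
      have := polyFormFun_add_right f x 0 0
      simpa using this
    induction x using PolyMod.induction with
    | h0 => simp [zl]
    | hadd x x' hx hx' =>
      rw [smul_add, polyFormFun_add_left, hx, hx', polyFormFun_add_left, mul_add, add_mul]
    | hmono i p =>
    induction y using PolyMod.induction with
    | h0 => simp [zr]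
    | hadd y y' hy hy' =>
      rw [smul_add, polyFormFun_add_right, hy, hy', polyFormFun_add_right, mul_add, add_mul]
    | hmono j q =>
    induction a using Polynomial.induction_on' with
    | add a a' ha ha' =>
      rw [op_add, add_smul, polyFormFun_add_left, ha, ha', star_add, add_mul, add_mul]
    | monomial k a =>
    induction b using Polynomial.induction_on' with
    | add b b' hb hb' => rw [op_add, add_smul, polyFormFun_add_right, hb, hb', mul_add]
    | monomial l b =>
      rw [PolyMod.smul_mono, PolyMod.smul_mono, polyFormFun_mono, polyFormFun_mono,
        star_monomial, monomial_mul_monomial, monomial_mul_monomial, f.smul_smul]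
      exact congrArg (fun e => monomial e (star a * f p q * b)) (by omega)

/-- `Q[X]` for `Q = P ⊥ H(R)`, written as `P[X] ⊥ H(R[X])`. -/
abbrev PolyQ (R P : Type*) [Ring R] [AddCommGroup P] : Type _ := PolyMod P × R[X] × R[X]

/-- The constant element of `Q[X]` given by an element of `Q`. -/
def PolyQ.const (x : P × R × R) : PolyQ R P := (PolyMod.mono 0 x.1, C x.2.1, C x.2.2)

/-- The coefficient of `Xⁱ` of an element of `Q[X]`, an element of `Q`. -/
def PolyQ.coeff (i : ℕ) (x : PolyQ R P) : P × R × R :=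
  (PolyMod.coeff i x.1, x.2.1.coeff i, x.2.2.coeff i)

end Poly

/-! ### Localization at a maximal ideal of the center -/

section Loc

variable {R : Type*} [Ring R] [StarRing R]

/-- The involution of the center. -/
def centerBar (c : Subring.center R) : Subring.center R :=
  ⟨star (c : R), Set.star_mem_center c.2⟩

/-- The multiplicative set `C(R) \ (𝔪 ∪ 𝔪̄)`. If `𝔪̄ = 𝔪`, this is `C(R) \ 𝔪`; in general it
is the part of the complement of `𝔪` that is stable under the involution, so that the involution
of `R` extends to the localization. -/
def locSet (m : MaximalSpectrum (Subring.center R)) : Submonoid (Subring.center R) where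
  carrier := {c | c ∉ m.asIdeal ∧ centerBar c ∉ m.asIdeal}
  one_mem' := by
    have h1 : (1 : Subring.center R) ∉ m.asIdeal :=
      (Ideal.ne_top_iff_one _).1 m.isMaximal.ne_top
    refine ⟨h1, ?_⟩
    rwa [show centerBar (1 : Subring.center R) = 1 from Subtype.ext (star_one R)]
  mul_mem' := by
    rintro a b ⟨h1, h2⟩ ⟨h3, h4⟩
    have hp := m.isMaximal.isPrime
    refine ⟨fun h => (hp.mem_or_mem h).elim h1 h3, fun h => ?_⟩
    rw [show centerBar (a * b) = centerBar b * centerBar a from Subtype.ext (star_mul _ _)] at h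
    exact (hp.mem_or_mem h).elim h4 h2

/-- The involution on the multiplicative set `C(R) \ (𝔪 ∪ 𝔪̄)`. -/
def locBar (m : MaximalSpectrum (Subring.center R)) (s : locSet m) : locSet m :=
  ⟨centerBar s.1, s.2.2, by
    rw [show centerBar (centerBar s.1) = s.1 from Subtype.ext (star_star _)]; exact s.2.1⟩

/-- The localization `R_𝔪` of `R` at the maximal ideal `𝔪` of its center. -/
abbrev Loc (m : MaximalSpectrum (Subring.center R)) : Type _ := LocalizedModule (locSet m) R

theorem star_smul_loc (m : MaximalSpectrum (Subring.center R)) (s : locSet m) (r : R) :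
    star (s • r) = locBar m s • star r := by
  change star ((s.1 : R) * r) = star (s.1 : R) * star r
  rw [star_mul]
  exact (Subring.mem_center_iff.1 (centerBar s.1).2 (star r))

theorem locBar_mul (m : MaximalSpectrum (Subring.center R)) (s t : locSet m) :
    locBar m (s * t) = locBar m s * locBar m t := by
  refine Subtype.ext (Subtype.ext ?_)
  change star ((s.1 : R) * (t.1 : R)) = star (s.1 : R) * star (t.1 : R)
  rw [star_mul]
  exact (Subring.mem_center_iff.1 (centerBar s.1).2 (star (t.1 : R)))

theorem locBar_locBar (m : MaximalSpectrum (Subring.center R)) (s : locSet m) :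
    locBar m (locBar m s) = s :=
  Subtype.ext (Subtype.ext (star_star _))

/-- The involution `r / s ↦ r̄ / s̄` of `R_𝔪`, as a function. -/
def locStar (m : MaximalSpectrum (Subring.center R)) (x : Loc m) : Loc m :=
  LocalizedModule.liftOn x (fun p => LocalizedModule.mk (star p.1) (locBar m p.2)) (by
    rintro ⟨r, s⟩ ⟨r', s'⟩ ⟨u, hu⟩
    refine LocalizedModule.mk_eq.2 ⟨locBar m u, ?_⟩
    have := congrArg star hu
    simpa only [star_smul_loc] using this)

theorem locStar_mk (m : MaximalSpectrum (Subring.center R)) (r : R) (s : locSet m) :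
    locStar m (LocalizedModule.mk r s) = LocalizedModule.mk (star r) (locBar m s) :=
  LocalizedModule.liftOn_mk _ _ _

/-- The involution `r / s ↦ r̄ / s̄` of `R_𝔪`. -/
instance locStarRing (m : MaximalSpectrum (Subring.center R)) : StarRing (Loc m) where
  star := locStar m
  star_involutive x := by
    induction x using LocalizedModule.induction_on with
    | h r s => rw [locStar_mk, locStar_mk, star_star, locBar_locBar]
  star_mul x y := by
    induction x using LocalizedModule.induction_on with
    | h r s =>
    induction y using LocalizedModule.induction_on with
    | h r' s' =>
      change locStar m _ = locStar m _ * locStar m _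
      rw [LocalizedModule.mk_mul_mk, locStar_mk, locStar_mk, locStar_mk,
        LocalizedModule.mk_mul_mk, star_mul, mul_comm s s', locBar_mul]
  star_add x y := by
    induction x using LocalizedModule.induction_on with
    | h r s =>
    induction y using LocalizedModule.induction_on with
    | h r' s' =>
      change locStar m _ = locStar m _ + locStar m _
      rw [LocalizedModule.mk_add_mk, locStar_mk, locStar_mk, locStar_mk,
        LocalizedModule.mk_add_mk, star_add, star_smul_loc, star_smul_loc, locBar_mul]

/-- The canonical map `R → R_𝔪`. -/
def toLoc (m : MaximalSpectrum (Subring.center R)) : R →+* Loc m := LocalizedModule.numeratorRingHom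

/-- The extension `J_𝔪` of `J`, consisting of the fractions `a / s` with `a ∈ J`. -/
def locIdeal (m : MaximalSpectrum (Subring.center R)) (J : Ideal R) : AddSubgroup (Loc m) where
  carrier := {x | ∃ a ∈ J, ∃ s : locSet m, x = LocalizedModule.mk a s}
  zero_mem' := ⟨0, J.zero_mem, 1, (LocalizedModule.zero_mk 1).symm⟩
  add_mem' := by
    rintro _ _ ⟨a, ha, s, rfl⟩ ⟨b, hb, t, rfl⟩
    exact ⟨t • a + s • b, J.add_mem (J.mul_mem_left (t.1 : R) ha) (J.mul_mem_left (s.1 : R) hb),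
      s * t, LocalizedModule.mk_add_mk⟩
  neg_mem' := by
    rintro _ ⟨a, ha, s, rfl⟩
    exact ⟨-a, J.neg_mem ha, s, LocalizedModule.mk_neg.symm⟩

/-- The form parameter `Λ_𝔪` of `R_𝔪`, consisting of the fractions `a / (s̄ s)` with `a ∈ Λ`. It is
the smallest form parameter of `R_𝔪` that contains the image of `Λ`. -/
def locForm (m : MaximalSpectrum (Subring.center R)) {lam : R} {Λ : AddSubgroup R}
    (hΛ : IsFormRing lam Λ) : AddSubgroup (Loc m) where
  carrier := {x | ∃ a ∈ Λ, ∃ s : locSet m, x = LocalizedModule.mk a (locBar m s * s)}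
  zero_mem' := ⟨0, Λ.zero_mem, 1, (LocalizedModule.zero_mk _).symm⟩
  add_mem' := by
    rintro _ _ ⟨a, ha, s, rfl⟩ ⟨b, hb, t, rfl⟩
    have key : ∀ (u : locSet m) (c : R), (locBar m u * u) • c = star (u.1 : R) * c * (u.1 : R) := by
      intro u c
      change star (u.1 : R) * (u.1 : R) * c = _
      rw [mul_assoc, mul_assoc, Subring.mem_center_iff.1 u.1.2 c]
    refine ⟨(locBar m t * t) • a + (locBar m s * s) • b, ?_, s * t, ?_⟩
    · rw [key, key]
      exact Λ.add_mem (hΛ.conj_mem _ _ ha) (hΛ.conj_mem _ _ hb)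
    · rw [LocalizedModule.mk_add_mk, locBar_mul, mul_mul_mul_comm]
  neg_mem' := by
    rintro _ ⟨a, ha, s, rfl⟩
    exact ⟨-a, Λ.neg_mem ha, s, LocalizedModule.mk_neg.symm⟩

variable {P : Type*} [AddCommGroup P] [Module Rᵐᵒᵖ P]

/-- An isometry of the localization `Q_𝔪` of `Q = P ⊥ H(R)` with the hyperbolic module
`H(R_𝔪)^{|ι|} = R_𝔪^{2|ι|}` over `(R_𝔪, Λ_𝔪)`. It is given by its restriction `toFun` to `Q`: a
semilinear map that exhibits `R_𝔪^{2|ι|}` as the localization of `Q` (every column is a fraction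
`toFun x / s`, and `toFun x = 0` only if `x` is killed by some denominator) and that preserves the
Hermitian form and the quadratic form modulo `Λ_𝔪`. -/
structure LocalIsometry (f : SesqForm R P) {lam : R} {Λ : AddSubgroup R} (hΛ : IsFormRing lam Λ)
    (ι : Type*) [Fintype ι] (m : MaximalSpectrum (Subring.center R)) where
  toFun : P × R × R →+ (ι ⊕ ι → Loc m)
  map_smul : ∀ (x : P × R × R) (r : R), toFun (op r • x) = op (toLoc m r) • toFun x
  surj : ∀ y : ι ⊕ ι → Loc m, ∃ (x : P × R × R) (s : locSet m),
    op (toLoc m (s.1 : R)) • y = toFun x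
  exists_of_eq_zero : ∀ x : P × R × R, toFun x = 0 → ∃ s : locSet m, op (s.1 : R) • x = 0
  map_herm : ∀ x y : P × R × R, (stdForm (Loc m) ι).herm (toLoc m lam) (toFun x) (toFun y) =
    toLoc m (f.hyp.herm lam x y)
  map_quad : ∀ x : P × R × R,
    stdForm (Loc m) ι (toFun x) (toFun x) - toLoc m (f.hyp x x) ∈ locForm m hΛ

/-- `M` is the matrix of the localization `σ_𝔪(X)` of `σ(X)`, an endomorphism of `Q_𝔪[X]`, under
the isometry `φ` of `Q_𝔪` with `R_𝔪^{2|ι|}`: on (the constant polynomials given by) the elements of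
`Q`, which generate `Q_𝔪[X]`, it acts as `σ` does. -/
def IsLocalMatrix {f : SesqForm R P} {lam : R} {Λ : AddSubgroup R} {hΛ : IsFormRing lam Λ}
    {ι : Type*} [Fintype ι] {m : MaximalSpectrum (Subring.center R)}
    (φ : LocalIsometry f hΛ ι m) (σ : PolyQ R P ≃ₗ[R[X]ᵐᵒᵖ] PolyQ R P)
    (M : Matrix (ι ⊕ ι) (ι ⊕ ι) (Loc m)[X]) : Prop :=
  ∀ (x : P × R × R) (i : ℕ) (k : ι ⊕ ι),
    (M.mulVec (fun j => C (φ.toFun x j)) k).coeff i = φ.toFun (PolyQ.coeff i (σ (PolyQ.const x))) k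

end Loc

end QuadLG

end

open QuadLG

set_option linter.unusedSectionVars false
set_option linter.unusedSimpArgs false

namespace QuadLG

/-! ### Coefficientwise extension of additive maps -/

section PolyMap

variable {A B : Type*} [Ring A] [Ring B]

/-- The coefficientwise extension of an additive map to polynomials. -/
noncomputable def polyMap (g : A →+ B) : A[X] →+ B[X] where
  toFun p := p.sum fun i a => monomial i (g a)
  map_zero' := by simp
  map_add' p q := Polynomial.sum_add_index _ _ _ (by simp) (by simp)

theorem polyMap_monomial (g : A →+ B) (i : ℕ) (a : A) :
    polyMap g (monomial i a) = monomial i (g a) := by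
  change (monomial i a).sum (fun i a => monomial i (g a)) = _
  rw [Polynomial.sum_monomial_index]; simp

theorem coeff_polyMap (g : A →+ B) (p : A[X]) (n : ℕ) :
    (polyMap g p).coeff n = g (p.coeff n) := by
  induction p using Polynomial.induction_on' with
  | add p q hp hq => simp [hp, hq]
  | monomial i a =>
    rw [polyMap_monomial, coeff_monomial, coeff_monomial]
    split_ifs <;> simp

theorem polyMap_C (g : A →+ B) (a : A) : polyMap g (C a) = C (g a) := by
  simpa using polyMap_monomial g 0 a

theorem coeff_star_poly [StarRing A] (p : A[X]) (n : ℕ) : (star p).coeff n = star (p.coeff n) := by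
  induction p using Polynomial.induction_on' with
  | add p q hp hq => simp [hp, hq]
  | monomial i a =>
    rw [star_monomial, coeff_monomial, coeff_monomial]
    split_ifs <;> simp

theorem star_C_poly [StarRing A] (a : A) : star (C a : A[X]) = C (star a) := by
  simpa using star_monomial 0 a

/-- A pairing that is multiplicative up to a middle factor stays so on polynomials. -/
theorem polyMap_mul_polyMap {A B : Type*} [Ring A] [Ring B] (g₁ g₂ g₃ : A →+ B) (w : A)
    (h : ∀ c d, g₁ c * g₂ d = g₃ (c * w * d)) (c d : A[X]) :
    polyMap g₁ c * polyMap g₂ d = polyMap g₃ (c * C w * d) := by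
  induction c using Polynomial.induction_on' with
  | add p q hp hq => simp [add_mul, hp, hq]
  | monomial n a =>
    induction d using Polynomial.induction_on' with
    | add p q hp hq => simp [mul_add, hp, hq]
    | monomial m b =>
      simp [polyMap_monomial, monomial_mul_monomial, h, monomial_mul_C]

theorem polyMap_mul_polyMap_eq_zero (g₁ g₂ : A →+ B)
    (h : ∀ c d, g₁ c * g₂ d = 0) (c d : A[X]) :
    polyMap g₁ c * polyMap g₂ d = 0 := by
  have := polyMap_mul_polyMap g₁ g₂ 0 0 (by simpa using h) c d
  simpa using this

theorem map_eval₂_polyMap {A B C₁ C₂ : Type*} [Ring A] [Ring B] [Ring C₁] [Ring C₂]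
    (i : A →+* C₁) (j : B →+* C₂) (g : A →+ B) (G : C₁ →+ C₂) (w : C₁) (w' : C₂)
    (h₁ : ∀ a, G (i a) = j (g a)) (h₂ : ∀ c, G (c * w) = G c * w') (p : A[X]) :
    G (p.eval₂ i w) = (polyMap g p).eval₂ j w' := by
  induction p using Polynomial.induction_on' with
  | add p q hp hq => simp [eval₂_add, hp, hq]
  | monomial n a =>
    rw [polyMap_monomial, eval₂_monomial, eval₂_monomial]
    induction n with
    | zero => simp [h₁]
    | succ n ih => rw [pow_succ, ← mul_assoc, h₂, ih, pow_succ, mul_assoc]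

theorem monomial_mem_polySubgroup {H : AddSubgroup A} {a : A} (ha : a ∈ H) (n : ℕ) :
    monomial n a ∈ polySubgroup H := fun i => by
  rw [coeff_monomial]; split_ifs
  · exact ha
  · exact H.zero_mem

theorem C_mem_polySubgroup {H : AddSubgroup A} {a : A} (ha : a ∈ H) :
    C a ∈ polySubgroup H := monomial_mem_polySubgroup ha 0

/-- Induction on polynomials with coefficients in a subgroup. -/
theorem polySubgroup_induction {H : AddSubgroup A} {p : A[X] → Prop} (h0 : p 0)
    (hadd : ∀ x y, p x → p y → p (x + y)) (hm : ∀ n, ∀ a ∈ H, p (monomial n a))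
    {x : A[X]} (hx : x ∈ polySubgroup H) : p x := by
  rw [x.as_sum_support]
  exact Finset.sum_induction _ p hadd h0 fun n _ => hm n _ (hx n)

end PolyMap

/-! ### Substitutions -/

section Subst

variable {k : Type*} [CommRing k] {A B : Type*} [Ring A] [Ring B] [Algebra k A] [Algebra k B]

/-- The substitution `X ↦ s X` on polynomials over a `k`-algebra. -/
noncomputable def scaleX (A : Type*) [Ring A] [Algebra k A] (s : k) : A[X] →+* A[X] :=
  eval₂RingHom' C (algebraMap k A[X] s * X)
    fun _ => (Algebra.commute_algebraMap_right s _).mul_right (commute_X _).symm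

/-- The substitution `X ↦ X + T`. -/
noncomputable def shiftX (A : Type*) [Ring A] : A[X] →+* A[X][X] :=
  eval₂RingHom' (C.comp C) (C X + X)
    fun a => (((commute_X (C a)).symm.map C).add_right (commute_X _).symm)

/-- The substitution `X ↦ y X`, `T ↦ z X`. -/
noncomputable def specX (A : Type*) [Ring A] [Algebra k A] (y z : k) : A[X][X] →+* A[X] :=
  eval₂RingHom' (scaleX A y) (algebraMap k A[X] z * X)
    fun _ => (Algebra.commute_algebraMap_right z _).mul_right (commute_X _).symm

theorem scaleX_monomial (s : k) (n : ℕ) (a : A) :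
    scaleX A s (monomial n a) = monomial n (s ^ n • a) := by
  change eval₂ C (algebraMap k A[X] s * X) (monomial n a) = _
  rw [eval₂_monomial, (Algebra.commute_algebraMap_left s (X : A[X])).mul_pow, ← map_pow, ← mul_assoc,
    ← Algebra.commutes, mul_assoc, C_mul_X_pow_eq_monomial, ← Algebra.smul_def, smul_monomial]

theorem coeff_scaleX (s : k) (p : A[X]) (n : ℕ) :
    (scaleX A s p).coeff n = s ^ n • p.coeff n := by
  induction p using Polynomial.induction_on' with
  | add p q hp hq => simp [hp, hq]
  | monomial i a =>
    rw [scaleX_monomial, coeff_monomial, coeff_monomial]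
    split_ifs with h <;> simp [h]

theorem scaleX_C (s : k) (a : A) : scaleX A s (C a) = C a := by
  simpa using scaleX_monomial s 0 a

theorem scaleX_X (s : k) : scaleX A s X = algebraMap k A[X] s * X := by
  simp [scaleX, eval₂RingHom']

theorem scaleX_algebraMap (s t : k) : scaleX A s (algebraMap k A[X] t) = algebraMap k A[X] t :=
  scaleX_C s (algebraMap k A t)

theorem scaleX_scaleX (s t : k) (p : A[X]) : scaleX A s (scaleX A t p) = scaleX A (s * t) p := by
  ext n; simp [coeff_scaleX, mul_pow, smul_smul]

theorem scaleX_one (p : A[X]) : scaleX A (1 : k) p = p := by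
  ext n; simp [coeff_scaleX]

theorem shiftX_C (a : A) : shiftX A (C a) = C (C a) := by simp [shiftX, eval₂RingHom']

theorem shiftX_X : shiftX A X = C X + X := by simp [shiftX, eval₂RingHom']

theorem specX_C (y z : k) (p : A[X]) : specX A y z (C p) = scaleX A y p := by
  simp [specX, eval₂RingHom']

theorem specX_X (y z : k) : specX A y z X = algebraMap k A[X] z * X := by
  simp [specX, eval₂RingHom']

theorem specX_scaleX_shiftX (s y z : k) (p : A[X]) :
    specX A y z (scaleX A[X] s (shiftX A p)) = scaleX A (y + s * z) p := by
  have : ((specX A y z).comp (scaleX A[X] s)).comp (shiftX A) = scaleX A (y + s * z) := by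
    refine ringHom_ext (fun a => ?_) ?_
    · simp [shiftX_C, scaleX_C, specX_C]
    · have h : specX A y z (algebraMap k A[X][X] s) = algebraMap k A[X] s :=
        (specX_C y z (algebraMap k A[X] s)).trans (scaleX_algebraMap y s)
      simp only [RingHom.comp_apply, shiftX_X, map_add, scaleX_C, scaleX_X, specX_C, map_mul,
        specX_X, add_mul, h, mul_assoc]
  exact RingHom.congr_fun this p

theorem coeff_zero_shiftX (p : A[X]) : (shiftX A p).coeff 0 = p := by
  have : constantCoeff.comp (shiftX A) = RingHom.id A[X] := by
    refine ringHom_ext (fun a => ?_) ?_ <;> simp [shiftX_C, shiftX_X]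
  exact RingHom.congr_fun this p

theorem polyMap_scaleX (g : A →+ B) {s : k} (hg : ∀ a, g (s • a) = s • g a) (p : A[X]) :
    polyMap g (scaleX A s p) = scaleX B s (polyMap g p) := by
  have hpow : ∀ (n : ℕ) a, g (s ^ n • a) = s ^ n • g a := fun n => by
    induction n with
    | zero => simp
    | succ n ih => intro a; rw [pow_succ, mul_smul, ih, hg, mul_smul]
  ext n; simp [coeff_scaleX, coeff_polyMap, hpow]

theorem polyMap_smul (g : A →+ B) {s : k} (hg : ∀ a, g (s • a) = s • g a) (p : A[X]) :
    polyMap g (s • p) = s • polyMap g p := by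
  ext n; simp [coeff_polyMap, hg]

theorem polyMap_shiftX (g : A →+ B) (p : A[X]) :
    polyMap (polyMap g) (shiftX A p) = shiftX B (polyMap g p) := by
  refine map_eval₂_polyMap (C.comp C) (C.comp C) g (polyMap (polyMap g)) _ _ (fun a => ?_)
    (fun c => ?_) p
  · simp [polyMap_C]
  · ext n m
    simp only [mul_add, map_add, coeff_add, coeff_polyMap, coeff_mul_C]
    rcases n with _ | n <;> rcases m with _ | m <;>
      simp [coeff_polyMap, coeff_mul_X]

theorem polyMap_specX (g : A →+ B) {y z : k} (hy : ∀ a, g (y • a) = y • g a)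
    (hz : ∀ a, g (z • a) = z • g a) (p : A[X][X]) :
    polyMap g (specX A y z p) = specX B y z (polyMap (polyMap g) p) := by
  refine map_eval₂_polyMap (scaleX A y) (scaleX B y) (polyMap g) (polyMap g) _ _ (fun a => ?_)
    (fun c => ?_) p
  · exact polyMap_scaleX g hy a
  · rw [← mul_assoc, ← Algebra.commutes, ← Algebra.smul_def, smul_mul_assoc, polyMap_smul g hz,
      ← mul_assoc, ← Algebra.commutes, ← Algebra.smul_def, smul_mul_assoc]
    congr 1
    ext n
    rcases n with _ | n <;> simp [coeff_polyMap, coeff_mul_X]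

theorem map_eq_polyMap (g : A →+* B) (p : A[X]) : p.map g = polyMap g.toAddMonoidHom p := by
  ext n; simp [coeff_polyMap]

theorem star_eq_polyMap [StarRing A] (p : A[X]) : star p = polyMap (starAddEquiv : A ≃+ A) p := by
  ext n; simp [coeff_polyMap, coeff_star_poly]

theorem scaleX_mem_polySubgroup {H : AddSubgroup A} (s : k) (h : ∀ a ∈ H, s • a ∈ H) {p : A[X]}
    (hp : p ∈ polySubgroup H) : scaleX A s p ∈ polySubgroup H := by
  intro n
  rw [coeff_scaleX]
  have h' : ∀ m : ℕ, ∀ a ∈ H, s ^ m • a ∈ H := by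
    intro m
    induction m with
    | zero => simp
    | succ m ih => intro a ha; rw [pow_succ, mul_smul]; exact ih _ (h _ ha)
  exact h' n _ (hp n)

theorem shiftX_mem_polySubgroup {H : AddSubgroup A} {p : A[X]} (hp : p ∈ polySubgroup H) :
    shiftX A p ∈ polySubgroup (polySubgroup H) := by
  refine polySubgroup_induction (p := fun p => shiftX A p ∈ polySubgroup (polySubgroup H))
    ?_ ?_ ?_ hp
  · simp
  · intro x y hx hy; simpa using add_mem hx hy
  · intro n a ha
    rw [← C_mul_X_pow_eq_monomial, map_mul, map_pow, shiftX_C, shiftX_X]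
    induction n with
    | zero => simpa using C_mem_polySubgroup (C_mem_polySubgroup ha)
    | succ n ih =>
      rw [pow_succ, ← mul_assoc, mul_add]
      generalize (C (C a) * (C X + X) ^ n : A[X][X]) = q at ih
      refine add_mem (fun i j => ?_) (fun i j => ?_)
      · rw [coeff_mul_C]
        rcases j with _ | j
        · simp
        · simpa using ih i j
      · rcases i with _ | i
        · simp
        · simpa using ih i j

theorem specX_mem_polySubgroup {H : AddSubgroup A} (y z : k) (hy : ∀ a ∈ H, y • a ∈ H)
    (hz : ∀ a ∈ H, z • a ∈ H) {p : A[X][X]}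
    (hp : p ∈ polySubgroup (polySubgroup H)) : specX A y z p ∈ polySubgroup H := by
  refine polySubgroup_induction (p := fun p => specX A y z p ∈ polySubgroup H) ?_ ?_ ?_ hp
  · simp
  · intro x y hx hy; simpa using add_mem hx hy
  · intro n a ha
    rw [← C_mul_X_pow_eq_monomial, map_mul, map_pow, specX_C, specX_X]
    induction n with
    | zero => simpa using scaleX_mem_polySubgroup y hy ha
    | succ n ih =>
      rw [pow_succ, ← mul_assoc]
      generalize (scaleX A y a * (algebraMap k A[X] z * X) ^ n : A[X]) = q at ih
      rw [← mul_assoc, ← Algebra.commutes, ← Algebra.smul_def]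
      intro i
      rcases i with _ | i
      · simp
      · simpa using hz _ (ih i)

end Subst

/-! ### Subrings with a form parameter -/

section FormPair

variable {A : Type*} [Ring A] [StarRing A]

/-- `V` is a subring of `A` that is stable under the involution and contains `lam`, and `Λ ⊆ V` is a
form parameter for `V`. -/
structure FormPair (lam : A) (V Λ : AddSubgroup A) : Prop where
  comm : ∀ a : A, lam * a = a * lam
  mul_star : lam * star lam = 1
  one_mem : (1 : A) ∈ V
  mul_mem : ∀ {a b : A}, a ∈ V → b ∈ V → a * b ∈ V
  star_mem : ∀ {a : A}, a ∈ V → star a ∈ V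
  lam_mem : lam ∈ V
  le : Λ ≤ V
  min_mem : ∀ {a : A}, a ∈ V → a - lam * star a ∈ Λ
  eq_neg : ∀ {a : A}, a ∈ Λ → a = -(lam * star a)
  conj_mem : ∀ {x a : A}, x ∈ V → a ∈ Λ → star x * a * x ∈ Λ

theorem FormPair.of_isFormRing {lam : A} {Λ : AddSubgroup A} (h : IsFormRing lam Λ) :
    FormPair lam ⊤ Λ where
  comm a := (Subring.mem_center_iff.1 h.lam_central a).symm
  mul_star := h.lam_mul_star
  one_mem := trivial
  mul_mem _ _ := trivial
  star_mem _ := trivial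
  lam_mem := trivial
  le := le_top
  min_mem _ := h.min_le _
  eq_neg ha := h.le_max _ ha
  conj_mem _ ha := h.conj_mem _ _ ha

namespace FormPair

variable {lam : A} {V Λ : AddSubgroup A} (h : FormPair lam V Λ)

include h

theorem star_comm (a : A) : star lam * a = a * star lam := by
  have := congrArg star (h.comm (star a))
  simpa using this.symm

theorem star_mul_lam : star lam * lam = 1 := by rw [← h.comm, h.mul_star]

theorem star_mul_eq_neg {l : A} (hl : l = -(lam * star l)) : star lam * l = -star l := by
  rw [hl, mul_neg, ← mul_assoc, h.star_mul_lam, one_mul, ← hl]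

theorem poly : FormPair (C lam) (polySubgroup V) (polySubgroup Λ) where
  comm a := by ext n; simp [h.comm]
  mul_star := by rw [star_C_poly, ← C_mul, h.mul_star, C_1]
  one_mem := by rw [← C_1]; exact C_mem_polySubgroup h.one_mem
  mul_mem ha hb n := by
    rw [coeff_mul]; exact sum_mem fun x _ => h.mul_mem (ha _) (hb _)
  star_mem ha n := by rw [coeff_star_poly]; exact h.star_mem (ha n)
  lam_mem := C_mem_polySubgroup h.lam_mem
  le a ha n := h.le (ha n)
  min_mem ha n := by
    rw [coeff_sub, coeff_C_mul, coeff_star_poly]; exact h.min_mem (ha n)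
  eq_neg ha := by
    ext n
    rw [coeff_neg, coeff_C_mul, coeff_star_poly]; exact h.eq_neg (ha n)
  conj_mem := by
    intro x a hx ha
    have mul_mem : ∀ {a b : A[X]}, a ∈ polySubgroup V → b ∈ polySubgroup V →
        a * b ∈ polySubgroup V := fun ha hb n => by
      rw [coeff_mul]; exact sum_mem fun x _ => h.mul_mem (ha _) (hb _)
    have star_mem : ∀ {a : A[X]}, a ∈ polySubgroup V → star a ∈ polySubgroup V := fun ha n => by
      rw [coeff_star_poly]; exact h.star_mem (ha n)
    have ha' : a ∈ polySubgroup V := fun n => h.le (ha n)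
    have hstar : C lam * star a = -a := by
      ext n
      rw [coeff_C_mul, coeff_star_poly, coeff_neg, h.eq_neg (ha n), neg_neg, ← h.eq_neg (ha n)]
    have hcomm : ∀ b : A[X], C lam * b = b * C lam := fun b => by ext n; simp [h.comm]
    suffices x ∈ polySubgroup V ∧ star x * a * x ∈ polySubgroup Λ from this.2
    refine polySubgroup_induction
      (p := fun x => x ∈ polySubgroup V ∧ star x * a * x ∈ polySubgroup Λ) ?_ ?_ ?_ hx
    · simp
    · rintro x y ⟨hx, hx'⟩ ⟨hy, hy'⟩
      refine ⟨add_mem hx hy, ?_⟩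
      have hm : star x * a * y - C lam * star (star x * a * y) ∈ polySubgroup Λ := fun n => by
        rw [coeff_sub, coeff_C_mul, coeff_star_poly]
        exact h.min_mem (mul_mem (mul_mem (star_mem hx) ha') hy n)
      have he : star (x + y) * a * (x + y) = star x * a * x + star y * a * y +
          (star x * a * y - C lam * star (star x * a * y)) := by
        have : C lam * star (star x * a * y) = -(star y * a * x) := by
          rw [star_mul, star_mul, star_star, ← mul_assoc, hcomm, mul_assoc (star y),
            ← mul_assoc (C lam), hstar]
          simp [mul_assoc]
        rw [this, star_add]; noncomm_ring
      rw [he]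
      exact add_mem (add_mem hx' hy') hm
    · intro n v hv
      refine ⟨monomial_mem_polySubgroup hv n, ?_⟩
      rw [star_monomial]
      refine polySubgroup_induction
        (p := fun a => monomial n (star v) * a * monomial n v ∈ polySubgroup Λ) ?_ ?_ ?_ ha
      · simp
      · intro b c hb hc
        rw [mul_add, add_mul]; exact add_mem hb hc
      · intro m b hb
        rw [monomial_mul_monomial, monomial_mul_monomial]
        exact monomial_mem_polySubgroup (h.conj_mem hv hb) _

end FormPair

end FormPair

/-! ### Elementary operators built from rank-one operators -/

section RankOne

variable {A 𝓜 : Type*} [Ring A] [StarRing A] [Ring 𝓜] {ι : Type*} [DecidableEq ι]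

/-- The value of the Hermitian form at a standard basis vector and its dual. -/
def mu (lam : A) : ι ⊕ ι → A
  | .inl _ => 1
  | .inr _ => lam

/-- `D p q c` multiplies like the operator `x ↦ e_p c h(e_q, x)`, where `(e_p)` is a hyperbolic
basis. -/
structure RankOne (lam : A) (D : ι ⊕ ι → ι ⊕ ι → A →+ 𝓜) : Prop where
  mul_swap : ∀ p q s c d, D p q c * D q.swap s d = D p s (c * mu lam q * d)
  mul_ne : ∀ p q r s c d, r ≠ q.swap → D p q c * D r s d = 0

/-- The operator `x ↦ e_p c̄ h(e_q, x) - e_q c lam̄ h(e_p, x)`. -/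
def xi (lam : A) (D : ι ⊕ ι → ι ⊕ ι → A →+ 𝓜) (p q : ι ⊕ ι) : A →+ 𝓜 :=
  (D p q).comp (starAddEquiv : A ≃+ A).toAddMonoidHom -
    (D q p).comp (AddMonoidHom.mulRight (star lam))

/-- The operator `x ↦ - e_p lam̄ c h(e_p, x)`. -/
def zeta (lam : A) (D : ι ⊕ ι → ι ⊕ ι → A →+ 𝓜) (p : ι ⊕ ι) : A →+ 𝓜 :=
  -(D p p).comp (AddMonoidHom.mulLeft (star lam))

variable {lam : A} {D : ι ⊕ ι → ι ⊕ ι → A →+ 𝓜}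

theorem xi_apply (p q : ι ⊕ ι) (c : A) :
    xi lam D p q c = D p q (star c) - D q p (c * star lam) := rfl

theorem zeta_apply (p : ι ⊕ ι) (c : A) : zeta lam D p c = -D p p (star lam * c) := rfl

theorem RankOne.mul (hD : RankOne lam D) (p q r s : ι ⊕ ι) (c d : A) :
    D p q c * D r s d = if r = q.swap then D p s (c * mu lam q * d) else 0 := by
  split_ifs with h
  · rw [h, hD.mul_swap]
  · exact hD.mul_ne _ _ _ _ _ _ h

theorem swap_ne (p : ι ⊕ ι) : p.swap ≠ p := by cases p <;> simp

theorem swap_eq_iff {p q : ι ⊕ ι} : p.swap = q ↔ p = q.swap := by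
  constructor <;> (rintro rfl; simp)

variable {V Λ : AddSubgroup A} (h : FormPair lam V Λ) (hD : RankOne lam D)

include h

theorem FormPair.star_mul_mu_swap (q : ι ⊕ ι) : star lam * mu lam q.swap = star (mu lam q) := by
  cases q
  · simpa [mu] using h.star_mul_lam
  · simp [mu]

theorem FormPair.mu_comm (q : ι ⊕ ι) (a : A) : mu lam q * a = a * mu lam q := by
  cases q
  · simp [mu]
  · simpa [mu] using h.comm a

theorem FormPair.mu_star (q : ι ⊕ ι) : mu lam q * star (mu lam q) = 1 := by
  cases q
  · simp [mu]
  · simpa [mu] using h.mul_star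

theorem FormPair.star_mu (q : ι ⊕ ι) : star (mu lam q) * mu lam q = 1 := by
  rw [← h.mu_comm, h.mu_star]

theorem FormPair.mu_mem (q : ι ⊕ ι) : mu lam q ∈ V := by
  cases q
  · exact h.one_mem
  · exact h.lam_mem

theorem FormPair.xi_symm (p q : ι ⊕ ι) (c : A) :
    xi lam D p q c = xi lam D q p (-(lam * star c)) := by
  simp only [xi_apply, star_neg, star_mul, star_star, map_neg, neg_mul, sub_neg_eq_add]
  rw [h.comm, mul_assoc, h.mul_star, mul_one]
  abel

omit h
include hD

theorem RankOne.xi_mul_xi {p q r s : ι ⊕ ι} (h₁ : r ≠ q.swap) (h₂ : s ≠ q.swap) (h₃ : r ≠ p.swap)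
    (h₄ : s ≠ p.swap) (c d : A) : xi lam D p q c * xi lam D r s d = 0 := by
  simp [xi_apply, mul_sub, sub_mul, hD.mul, h₁, h₂, h₃, h₄]

theorem RankOne.xi_mul_zeta {p q r : ι ⊕ ι} (h₁ : r ≠ q.swap) (h₃ : r ≠ p.swap)
    (c d : A) : xi lam D p q c * zeta lam D r d = 0 := by
  simp [xi_apply, zeta_apply, sub_mul, hD.mul, h₁, h₃]

theorem RankOne.zeta_mul_xi {p q r : ι ⊕ ι} (h₁ : p ≠ r.swap) (h₃ : q ≠ r.swap)
    (c d : A) : zeta lam D r d * xi lam D p q c = 0 := by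
  simp [xi_apply, zeta_apply, mul_sub, hD.mul, h₁, h₃]

theorem RankOne.zeta_mul_zeta {p q : ι ⊕ ι} (h₁ : q ≠ p.swap)
    (c d : A) : zeta lam D p c * zeta lam D q d = 0 := by
  simp [zeta_apply, hD.mul, h₁]

include h

theorem RankOne.conj_xi_xi {p q s : ι ⊕ ι} (hqp : q ≠ p) (hqp' : q ≠ p.swap)
    (hsp' : s ≠ p.swap) (hsq : s ≠ q) (hsq' : s ≠ q.swap) (x c : A) :
    (1 + xi lam D p q x) * (1 + xi lam D q.swap s c) * (1 - xi lam D p q x) =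
      (1 + xi lam D q.swap s c) * (1 + xi lam D p s (c * star (mu lam q) * x)) := by
  have hpq' : p ≠ q.swap := fun e => hqp' (by simp [e])
  have hps' : p ≠ s.swap := fun e => hsp' (by simp [e])
  have hqs' : q ≠ s.swap := fun e => hsq' (by simp [e])
  have e₁ : xi lam D p q x * xi lam D q.swap s c = D p s (star x * mu lam q * star c) := by
    simp [xi_apply, mul_sub, sub_mul, hD.mul, hsq', hsp', hqp, swap_eq_iff]
  have e₂ : xi lam D q.swap s c * xi lam D p q x =
      D s p (c * star (mu lam q) * x * star lam) := by
    simp only [xi_apply, mul_sub, sub_mul, hD.mul, Sum.swap_swap, hps', hqs', hqp.symm, if_false,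
      if_true]
    rw [mul_assoc c, h.star_mul_mu_swap]
    simp [mul_assoc]
  have e₃ : xi lam D p q x * xi lam D q.swap s c * xi lam D p q x = 0 := by
    rw [e₁]
    simp [xi_apply, mul_sub, hD.mul, hps', hqs']
  have e₄ : xi lam D q.swap s c * xi lam D p s (c * star (mu lam q) * x) = 0 :=
    hD.xi_mul_xi hps' (swap_ne s).symm (by simpa using hqp.symm) (by simpa using hsq) _ _
  have e₅ : xi lam D p s (c * star (mu lam q) * x) =
      xi lam D p q x * xi lam D q.swap s c - xi lam D q.swap s c * xi lam D p q x := by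
    rw [e₁, e₂, xi_apply]; simp [mul_assoc]
  have e₆ : xi lam D p q x * xi lam D p q x = 0 :=
    hD.xi_mul_xi hpq' (swap_ne q).symm (swap_ne p).symm hqp' _ _
  rw [mul_add (1 + xi lam D q.swap s c), add_mul 1 _ (xi lam D p s _), e₄, e₅]
  generalize xi lam D p q x = a at *
  generalize xi lam D q.swap s c = b at *
  calc _ = 1 + b + a * b - b * a - a * b * a - a * a := by noncomm_ring
    _ = _ := by rw [e₃, e₆]; noncomm_ring

theorem RankOne.conj_xi_xi_self {p q : ι ⊕ ι} (hqp : q ≠ p) (hqp' : q ≠ p.swap) (x c : A) :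
    (1 + xi lam D p q x) * (1 + xi lam D q.swap p c) * (1 - xi lam D p q x) =
      (1 + xi lam D q.swap p c) * (1 + zeta lam D p (c * star (mu lam q) * x -
        lam * star (c * star (mu lam q) * x))) := by
  have hpq' : p ≠ q.swap := fun e => hqp' (by simp [e])
  have e₁ : xi lam D p q x * xi lam D q.swap p c = D p p (star x * mu lam q * star c) := by
    simp [xi_apply, mul_sub, sub_mul, hD.mul, hpq', (swap_ne p).symm, hqp, swap_eq_iff]
  have e₂ : xi lam D q.swap p c * xi lam D p q x =
      D p p (c * star (mu lam q) * x * star lam) := by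
    simp only [xi_apply, mul_sub, sub_mul, hD.mul, Sum.swap_swap, (swap_ne p).symm, hqp', hqp.symm,
      if_false, if_true]
    rw [mul_assoc c, h.star_mul_mu_swap]
    simp [mul_assoc]
  have e₃ : xi lam D p q x * xi lam D q.swap p c * xi lam D p q x = 0 := by
    rw [e₁]
    simp [xi_apply, mul_sub, hD.mul, (swap_ne p).symm, hqp']
  have e₄ : ∀ d, xi lam D q.swap p c * zeta lam D p d = 0 :=
    hD.xi_mul_zeta (swap_ne p).symm (by simpa using hqp.symm) _
  have e₅ : zeta lam D p (c * star (mu lam q) * x - lam * star (c * star (mu lam q) * x)) =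
      xi lam D p q x * xi lam D q.swap p c - xi lam D q.swap p c * xi lam D p q x := by
    rw [e₁, e₂, zeta_apply, mul_sub, ← mul_assoc (star lam) lam, h.star_mul_lam, one_mul, h.star_comm]
    simp [mul_assoc]
  have e₆ : xi lam D p q x * xi lam D p q x = 0 :=
    hD.xi_mul_xi hpq' (swap_ne q).symm (swap_ne p).symm hqp' _ _
  rw [mul_add (1 + xi lam D q.swap p c), add_mul 1 _ (zeta lam D p _), e₄, e₅]
  generalize xi lam D p q x = a at *
  generalize xi lam D q.swap p c = b at *
  calc _ = 1 + b + a * b - b * a - a * b * a - a * a := by noncomm_ring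
    _ = _ := by rw [e₃, e₆]; noncomm_ring

theorem RankOne.conj_xi_zeta {p q : ι ⊕ ι} (hqp : q ≠ p) (hqp' : q ≠ p.swap) (x c : A)
    (hc : c = -(lam * star c)) :
    (1 + xi lam D p q x) * (1 + zeta lam D q.swap c) * (1 - xi lam D p q x) =
      (1 + zeta lam D q.swap c) * (1 + xi lam D p q.swap (c * star (mu lam q) * x)) *
        (1 + zeta lam D p (star x * mu lam q * c * star (mu lam q) * x)) := by
  have hpq' : p ≠ q.swap := fun e => hqp' (by simp [e])
  have e₁ : xi lam D p q x * zeta lam D q.swap c = D p q.swap (star x * mu lam q * star c) := by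
    have : star x * mu lam q * (star lam * c) = -(star x * mu lam q * star c) := by
      rw [h.star_mul_eq_neg hc, mul_neg]
    simp [xi_apply, zeta_apply, sub_mul, hD.mul, hqp, swap_eq_iff, this]
  have e₂ : zeta lam D q.swap c * xi lam D p q x =
      D q.swap p (c * star (mu lam q) * x * star lam) := by
    have : star lam * c * mu lam q.swap * (x * star lam) =
        c * star (mu lam q) * x * star lam := by
      rw [h.star_comm c, mul_assoc c, h.star_mul_mu_swap]
      simp [mul_assoc]
    simp [xi_apply, zeta_apply, mul_sub, hD.mul, hqp.symm, this]
  have e₃ : xi lam D p q x * zeta lam D q.swap c * xi lam D p q x =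
      -zeta lam D p (star x * mu lam q * c * star (mu lam q) * x) := by
    rw [mul_assoc, e₂, zeta_apply, neg_neg, h.star_comm]
    simp [xi_apply, sub_mul, hD.mul, hqp, swap_eq_iff, mul_assoc]
  have e₄ : ∀ d, zeta lam D q.swap c * xi lam D p q.swap d = 0 := fun d =>
    hD.zeta_mul_xi (by simpa using hqp.symm) (by simpa using swap_ne q) _ _
  have e₅ : xi lam D p q.swap (c * star (mu lam q) * x) =
      xi lam D p q x * zeta lam D q.swap c - zeta lam D q.swap c * xi lam D p q x := by
    rw [e₁, e₂, xi_apply]; simp [mul_assoc]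
  have e₆ : xi lam D p q x * xi lam D p q x = 0 :=
    hD.xi_mul_xi hpq' (swap_ne q).symm (swap_ne p).symm hqp' _ _
  have e₇ : ∀ d e, xi lam D p q.swap d * zeta lam D p e = 0 := fun d e =>
    hD.xi_mul_zeta (by simpa using hqp.symm) (swap_ne p).symm _ _
  have e₈ : ∀ e, zeta lam D q.swap c * zeta lam D p e = 0 := fun e =>
    hD.zeta_mul_zeta (by simpa using hqp.symm) _ _
  have e₉ : (1 + zeta lam D q.swap c) * (1 + xi lam D p q.swap (c * star (mu lam q) * x)) *
        (1 + zeta lam D p (star x * mu lam q * c * star (mu lam q) * x)) =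
      1 + zeta lam D q.swap c + xi lam D p q.swap (c * star (mu lam q) * x) +
        zeta lam D p (star x * mu lam q * c * star (mu lam q) * x) := by
    have e₁₀ := e₄ (c * star (mu lam q) * x)
    have e₁₁ := e₇ (c * star (mu lam q) * x) (star x * mu lam q * c * star (mu lam q) * x)
    have e₁₂ := e₈ (star x * mu lam q * c * star (mu lam q) * x)
    generalize zeta lam D q.swap c = b at *
    generalize xi lam D p q.swap (c * star (mu lam q) * x) = a at *
    generalize zeta lam D p (star x * mu lam q * c * star (mu lam q) * x) = d at *
    calc _ = 1 + b + a + d + b * a + a * d + b * d + b * a * d := by noncomm_ring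
      _ = _ := by rw [e₁₀, e₁₁, e₁₂]; noncomm_ring
  rw [e₉, e₅, ← neg_eq_iff_eq_neg.2 e₃]
  generalize xi lam D p q x = a at *
  generalize zeta lam D q.swap c = b at *
  calc _ = 1 + b + a * b - b * a - a * b * a - a * a := by noncomm_ring
    _ = _ := by rw [e₆]; noncomm_ring

theorem RankOne.conj_zeta_xi {p s : ι ⊕ ι} (hsp : s ≠ p) (hsp' : s ≠ p.swap) (x c : A)
    (hx : x = -(lam * star x)) :
    (1 + zeta lam D p x) * (1 + xi lam D p.swap s c) * (1 - zeta lam D p x) =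
      (1 + xi lam D p.swap s c) * (1 + xi lam D p s (c * star (mu lam p) * x)) *
        (1 + zeta lam D s (c * x * star c)) := by
  have hps' : p ≠ s.swap := fun e => hsp' (by simp [e])
  have hx' := h.star_mul_eq_neg hx
  have e₁ : zeta lam D p x * xi lam D p.swap s c = D p s (star x * mu lam p * star c) := by
    simp [xi_apply, zeta_apply, mul_sub, hD.mul, hsp', hx']
  have e₂ : xi lam D p.swap s c * zeta lam D p x =
      D s p (c * star (mu lam p) * x * star lam) := by
    have : c * star lam * mu lam p.swap * (star lam * x) =
        c * star (mu lam p) * x * star lam := by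
      rw [mul_assoc c, h.star_mul_mu_swap, h.star_comm]
      simp [mul_assoc]
    simp [xi_apply, zeta_apply, sub_mul, hD.mul, hps', this]
  have e₃ : zeta lam D p x * xi lam D p.swap s c * zeta lam D p x = 0 := by
    rw [e₁]
    simp [zeta_apply, hD.mul, hps']
  have e₄ : xi lam D p.swap s c * xi lam D p s (c * star (mu lam p) * x) =
      -zeta lam D s (c * x * star c) := by
    have : c * star lam * mu lam p.swap * star (c * star (mu lam p) * x) =
        -(star lam * (c * x * star c)) := by
      rw [mul_assoc c, h.star_mul_mu_swap, mul_assoc c x, ← mul_assoc (star lam) c, h.star_comm c,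
        mul_assoc c (star lam), ← mul_assoc (star lam) x, hx']
      simp only [star_mul, star_star]
      rw [mul_assoc c, ← mul_assoc (star x), ← h.mu_comm, mul_assoc (mu lam p),
        ← mul_assoc (star (mu lam p)), h.star_mu]
      simp
    rw [xi_apply, xi_apply, zeta_apply]
    simp only [mul_sub, sub_mul, hD.mul, this]
    simp [hsp, hps', (swap_ne s).symm]
  have e₅ : xi lam D p s (c * star (mu lam p) * x) =
      zeta lam D p x * xi lam D p.swap s c - xi lam D p.swap s c * zeta lam D p x := by
    rw [e₁, e₂, xi_apply]; simp [mul_assoc]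
  have e₆ : zeta lam D p x * zeta lam D p x = 0 := hD.zeta_mul_zeta (swap_ne p).symm _ _
  have e₇ : ∀ d, xi lam D p.swap s c * zeta lam D s d = 0 := fun d =>
    hD.xi_mul_zeta (swap_ne s).symm (by simpa using hsp) _ _
  have e₈ : ∀ d e, xi lam D p s d * zeta lam D s e = 0 := fun d e =>
    hD.xi_mul_zeta (swap_ne s).symm hsp' _ _
  have e₉ : zeta lam D s (c * x * star c) * zeta lam D s (c * x * star c) = 0 :=
    hD.zeta_mul_zeta (swap_ne s).symm _ _
  have e₁₀ : (1 + xi lam D p.swap s c) * (1 + xi lam D p s (c * star (mu lam p) * x)) *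
        (1 + zeta lam D s (c * x * star c)) =
      1 + xi lam D p.swap s c + xi lam D p s (c * star (mu lam p) * x) := by
    have : (1 + xi lam D p.swap s c) * (1 + xi lam D p s (c * star (mu lam p) * x)) =
      1 + xi lam D p.swap s c + xi lam D p s (c * star (mu lam p) * x) -
        zeta lam D s (c * x * star c) := by
      rw [mul_add (1 + _) 1 (xi lam D p s _), add_mul 1 _ (xi lam D p s _), e₄]
      noncomm_ring
    rw [this, mul_add _ 1 (zeta lam D s _), sub_mul _ _ (zeta lam D s _),
      add_mul _ _ (zeta lam D s _), add_mul _ _ (zeta lam D s _), e₇, e₈, e₉]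
    noncomm_ring
  rw [e₁₀, e₅]
  generalize xi lam D p.swap s c = b at *
  generalize zeta lam D p x = a at *
  calc _ = 1 + b + a * b - b * a - a * b * a - a * a := by noncomm_ring
    _ = _ := by rw [e₃, e₆]; noncomm_ring

end RankOne

/-! ### Elementary groups with denominators -/

section Level

variable {k : Type*} [CommRing k] {A 𝓜 : Type*} [Ring A] [StarRing A] [Algebra k A] [Ring 𝓜]
  {ι : Type*} [DecidableEq ι]

/-- A subring with form parameter that is stable under a monoid `S` of self-adjoint scalars. -/
structure ScalarPair (lam : A) (V Λ : AddSubgroup A) (S : Submonoid k) : Prop extends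
    FormPair lam V Λ where
  star_smul : ∀ {s : k}, s ∈ S → ∀ a : A, star (s • a) = s • star a
  smul_mem : ∀ {s : k}, s ∈ S → ∀ {a : A}, a ∈ V → s • a ∈ V

theorem ScalarPair.sq_smul_mem {lam : A} {V Λ : AddSubgroup A} {S : Submonoid k}
    (h : ScalarPair lam V Λ S) {s : k} (hs : s ∈ S) {a : A} (ha : a ∈ Λ) : s ^ 2 • a ∈ Λ := by
  have := h.conj_mem (h.smul_mem hs h.one_mem) ha
  rw [h.star_smul hs, star_one] at this
  simpa [smul_smul, pow_two] using this

theorem ScalarPair.poly {lam : A} {V Λ : AddSubgroup A} {S : Submonoid k}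
    (h : ScalarPair lam V Λ S) : ScalarPair (C lam) (polySubgroup V) (polySubgroup Λ) S where
  toFormPair := h.toFormPair.poly
  star_smul hs a := by ext n; simp [coeff_star_poly, h.star_smul hs]
  smul_mem hs a ha n := by rw [coeff_smul]; exact h.smul_mem hs (ha n)

/-- The elementary units with parameters in `V` (short roots) and `Λ` (long roots). -/
def elemSet (lam : A) (D : ι ⊕ ι → ι ⊕ ι → A →+ 𝓜) (V Λ : Set A) : Set 𝓜ˣ :=
  {g | (∃ p q c, q ≠ p ∧ q ≠ p.swap ∧ c ∈ V ∧ (g : 𝓜) = 1 + xi lam D p q c) ∨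
    ∃ p c, c ∈ Λ ∧ (g : 𝓜) = 1 + zeta lam D p c}

/-- The group generated by the elementary units with parameters in `V` and `Λ`. -/
def elemGrp (lam : A) (D : ι ⊕ ι → ι ⊕ ι → A →+ 𝓜) (V Λ : Set A) : Subgroup 𝓜ˣ :=
  Subgroup.closure (elemSet lam D V Λ)

/-- The elementary group of level `s`: the parameters are divisible by `s`. -/
def elemLevel (lam : A) (D : ι ⊕ ι → ι ⊕ ι → A →+ 𝓜) (V Λ : AddSubgroup A) (s : k) :
    Subgroup 𝓜ˣ :=
  elemGrp lam D {c | ∃ v ∈ V, c = s • v} {c | ∃ l ∈ Λ, c = s ^ 2 • l}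

/-- The short-root parameters with denominators in `S`. -/
def fracSet (V : AddSubgroup A) (S : Submonoid k) : Set A := {c | ∃ z ∈ S, z • c ∈ V}

/-- The long-root parameters with denominators in `S`. -/
def fracForm (lam : A) (Λ : AddSubgroup A) (S : Submonoid k) : Set A :=
  {c | c = -(lam * star c) ∧ ∃ z ∈ S, z ^ 2 • c ∈ Λ}

/-- The unit `1 + xi p q c`. -/
def RankOne.xiUnit {lam : A} {D : ι ⊕ ι → ι ⊕ ι → A →+ 𝓜} (hD : RankOne lam D) {p q : ι ⊕ ι}
    (_h₁ : q ≠ p) (h₂ : q ≠ p.swap) (c : A) : 𝓜ˣ where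
  val := 1 + xi lam D p q c
  inv := 1 - xi lam D p q c
  val_inv := by
    have := hD.xi_mul_xi (fun e => h₂ (by simp [e])) (swap_ne q).symm (swap_ne p).symm h₂ c c
    rw [add_mul, mul_sub, mul_sub, this]; simp
  inv_val := by
    have := hD.xi_mul_xi (fun e => h₂ (by simp [e])) (swap_ne q).symm (swap_ne p).symm h₂ c c
    rw [sub_mul, mul_add, mul_add, this]; simp

/-- The unit `1 + zeta p c`. -/
def RankOne.zetaUnit {lam : A} {D : ι ⊕ ι → ι ⊕ ι → A →+ 𝓜} (hD : RankOne lam D) (p : ι ⊕ ι)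
    (c : A) : 𝓜ˣ where
  val := 1 + zeta lam D p c
  inv := 1 - zeta lam D p c
  val_inv := by
    have := hD.zeta_mul_zeta (swap_ne p).symm c c
    rw [add_mul, mul_sub, mul_sub, this]; simp
  inv_val := by
    have := hD.zeta_mul_zeta (swap_ne p).symm c c
    rw [sub_mul, mul_add, mul_add, this]; simp

/-- `a` is (the underlying element of) a member of the group `G`. -/
def InGrp (G : Subgroup 𝓜ˣ) (a : 𝓜) : Prop := ∃ u ∈ G, (u : 𝓜) = a

theorem InGrp.mul {G : Subgroup 𝓜ˣ} {a b : 𝓜} (ha : InGrp G a) (hb : InGrp G b) :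
    InGrp G (a * b) := by
  obtain ⟨u, hu, rfl⟩ := ha
  obtain ⟨v, hv, rfl⟩ := hb
  exact ⟨u * v, mul_mem hu hv, rfl⟩

theorem inGrp_coe_iff {G : Subgroup 𝓜ˣ} {u : 𝓜ˣ} : InGrp G (u : 𝓜) ↔ u ∈ G :=
  ⟨fun ⟨_, hv, e⟩ => Units.ext e ▸ hv, fun hu => ⟨u, hu, rfl⟩⟩

variable {lam : A} {D : ι ⊕ ι → ι ⊕ ι → A →+ 𝓜}

theorem RankOne.inGrp_xi (hD : RankOne lam D) {V Λ : Set A} {p q : ι ⊕ ι}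
    (h₁ : q ≠ p) (h₂ : q ≠ p.swap) {c : A} (hc : c ∈ V) :
    InGrp (elemGrp lam D V Λ) (1 + xi lam D p q c) :=
  ⟨hD.xiUnit h₁ h₂ c, Subgroup.subset_closure (Or.inl ⟨p, q, c, h₁, h₂, hc, rfl⟩), rfl⟩

theorem RankOne.inGrp_zeta (hD : RankOne lam D) {V Λ : Set A} (p : ι ⊕ ι) {c : A} (hc : c ∈ Λ) :
    InGrp (elemGrp lam D V Λ) (1 + zeta lam D p c) :=
  ⟨hD.zetaUnit p c, Subgroup.subset_closure (Or.inr ⟨p, c, hc, rfl⟩), rfl⟩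

theorem RankOne.inLevel_xi (hD : RankOne lam D) {V Λ : AddSubgroup A} {s : k} {p q : ι ⊕ ι}
    (h₁ : q ≠ p) (h₂ : q ≠ p.swap) {c v : A} (hv : v ∈ V) (hc : c = s • v) :
    InGrp (elemLevel lam D V Λ s) (1 + xi lam D p q c) :=
  hD.inGrp_xi h₁ h₂ ⟨v, hv, hc⟩

theorem RankOne.inLevel_zeta (hD : RankOne lam D) {V Λ : AddSubgroup A} {s : k} (p : ι ⊕ ι)
    {c l : A} (hl : l ∈ Λ) (hc : c = s ^ 2 • l) :
    InGrp (elemLevel lam D V Λ s) (1 + zeta lam D p c) :=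
  hD.inGrp_zeta p ⟨l, hl, hc⟩

variable {V Λ : AddSubgroup A} {S : Submonoid k} (h : ScalarPair lam V Λ S) (hD : RankOne lam D)

include h hD

theorem ScalarPair.conj_xi_xi_mem {p q r : ι ⊕ ι} (hqp : q ≠ p) (hqp' : q ≠ p.swap)
    (hrp' : r ≠ p.swap) (hrq : r ≠ q) (hrq' : r ≠ q.swap) {s z : k} (hs : s ∈ S) (hz : z ∈ S)
    {x v : A} (hx : z • x ∈ V) (hv : v ∈ V) :
    InGrp (elemLevel lam D V Λ s) ((1 + xi lam D p q x) *
      (1 + xi lam D q.swap r ((s ^ 2 * z ^ 2) • v)) * (1 - xi lam D p q x)) := by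
  have hw : z • (v * star (mu lam q) * (z • x)) ∈ V :=
    h.smul_mem hz (h.mul_mem (h.mul_mem hv (h.star_mem (h.mu_mem q))) hx)
  have he : ((s ^ 2 * z ^ 2) • v) * star (mu lam q) * x =
      s ^ 2 • (z • (v * star (mu lam q) * (z • x))) := by
    simp only [smul_mul_assoc, mul_smul_comm, smul_smul]
    congr 1; ring
  have h1 : InGrp (elemLevel lam D V Λ s) (1 + xi lam D q.swap r ((s ^ 2 * z ^ 2) • v)) := by
    refine hD.inGrp_xi hrq' (by simpa using hrq) ⟨(s * z ^ 2) • v, ?_, ?_⟩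
    · exact h.smul_mem (mul_mem hs (pow_mem hz 2)) hv
    · rw [smul_smul]; congr 1; ring
  by_cases hrp : r = p
  · subst hrp
    rw [hD.conj_xi_xi_self h.toFormPair hqp hqp', he]
    generalize z • (v * star (mu lam q) * (z • x)) = w at *
    refine h1.mul (hD.inLevel_zeta _ (h.min_mem hw) ?_)
    rw [h.star_smul (pow_mem hs 2), mul_smul_comm, ← smul_sub]
  · rw [hD.conj_xi_xi h.toFormPair hqp hqp' hrp' hrq hrq', he]
    generalize z • (v * star (mu lam q) * (z • x)) = w at *
    refine h1.mul (hD.inLevel_xi hrp hrp' (h.smul_mem hs hw) ?_)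
    rw [smul_smul, pow_two]

theorem ScalarPair.conj_xi_zeta_mem {p q : ι ⊕ ι} (hqp : q ≠ p) (hqp' : q ≠ p.swap)
    {s z : k} (hs : s ∈ S) (hz : z ∈ S) {x l : A} (hx : z • x ∈ V) (hl : l ∈ Λ) :
    InGrp (elemLevel lam D V Λ s) ((1 + xi lam D p q x) *
      (1 + zeta lam D q.swap ((s ^ 2 * z ^ 2) ^ 2 • l)) * (1 - xi lam D p q x)) := by
  have ht : s ^ 2 * z ^ 2 ∈ S := mul_mem (pow_mem hs 2) (pow_mem hz 2)
  have hpq' : q.swap ≠ p := fun e => hqp' (by simp [← e])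
  rw [hD.conj_xi_zeta h.toFormPair hqp hqp' _ _ (h.eq_neg (h.sq_smul_mem ht hl))]
  refine ((hD.inLevel_zeta _ (l := (s * z ^ 2) ^ 2 • l) ?_ ?_).mul
    (hD.inLevel_xi hpq' (fun e => hqp (Sum.swap_rightInverse.injective e))
      (v := (s ^ 3 * z ^ 3) • (l * star (mu lam q) * (z • x))) ?_ ?_)).mul
      (hD.inLevel_zeta _ (l := (s * z) ^ 2 • (star (star (mu lam q) * (z • x)) * l *
        (star (mu lam q) * (z • x)))) ?_ ?_)
  · exact h.sq_smul_mem (mul_mem hs (pow_mem hz 2)) hl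
  · rw [smul_smul]; congr 1; ring
  · exact h.smul_mem (mul_mem (pow_mem hs 3) (pow_mem hz 3))
      (h.mul_mem (h.mul_mem (h.le hl) (h.star_mem (h.mu_mem q))) hx)
  · simp only [smul_mul_assoc, mul_smul_comm, smul_smul]; congr 1; ring
  · exact h.sq_smul_mem (mul_mem hs hz) (h.conj_mem (h.mul_mem (h.star_mem (h.mu_mem q)) hx) hl)
  · simp only [smul_mul_assoc, mul_smul_comm, smul_smul, star_mul, star_star, h.star_smul hz,
      mul_assoc]
    congr 1; ring

theorem ScalarPair.conj_zeta_xi_mem {p r : ι ⊕ ι} (hrp : r ≠ p) (hrp' : r ≠ p.swap)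
    {s z : k} (hs : s ∈ S) (hz : z ∈ S) {x v : A} (hx' : x = -(lam * star x))
    (hx : z ^ 2 • x ∈ Λ) (hv : v ∈ V) :
    InGrp (elemLevel lam D V Λ s) ((1 + zeta lam D p x) *
      (1 + xi lam D p.swap r ((s ^ 2 * z ^ 2) • v)) * (1 - zeta lam D p x)) := by
  rw [hD.conj_zeta_xi h.toFormPair hrp hrp' _ _ hx']
  refine ((hD.inLevel_xi hrp' (by simpa using hrp) (v := (s * z ^ 2) • v) ?_ ?_).mul
    (hD.inLevel_xi hrp hrp' (v := s • (v * star (mu lam p) * (z ^ 2 • x))) ?_ ?_)).mul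
      (hD.inLevel_zeta _ (l := (s * z) ^ 2 • (star (star v) * (z ^ 2 • x) * star v)) ?_ ?_)
  · exact h.smul_mem (mul_mem hs (pow_mem hz 2)) hv
  · rw [smul_smul]; congr 1; ring
  · exact h.smul_mem hs (h.mul_mem (h.mul_mem hv (h.star_mem (h.mu_mem p))) (h.le hx))
  · simp only [smul_mul_assoc, mul_smul_comm, smul_smul]; congr 1; ring
  · exact h.sq_smul_mem (mul_mem hs hz) (h.conj_mem (h.star_mem hv) hx)
  · rw [h.star_smul (mul_mem (pow_mem hs 2) (pow_mem hz 2)), star_star]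
    simp only [smul_mul_assoc, mul_smul_comm, smul_smul]
    congr 1; ring

omit h hD in
theorem conj_of_mul_eq_zero {a b : 𝓜} (ha : a * a = 0) (h₁ : a * b = 0) (h₂ : b * a = 0) :
    (1 + a) * (1 + b) * (1 - a) = 1 + b := by
  calc _ = 1 + b + a * b - b * a - a * b * a - a * a := by noncomm_ring
    _ = _ := by rw [ha, h₁, h₂]; noncomm_ring

omit hD in
theorem ScalarPair.smul_neg_lam_star {t : k} (ht : t ∈ S) (v : A) :
    -(lam * star (t • v)) = t • -(lam * star v) := by
  rw [h.star_smul ht, mul_smul_comm, smul_neg]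

omit hD in
theorem ScalarPair.neg_lam_star_mem {v : A} (hv : v ∈ V) : -(lam * star v) ∈ V :=
  neg_mem (h.mul_mem h.lam_mem (h.star_mem hv))

/-- Conjugation of a root element by a short root element whose root is not the opposite one. -/
theorem ScalarPair.conj_xi_mem {p q : ι ⊕ ι} (hqp : q ≠ p) (hqp' : q ≠ p.swap)
    {s z : k} (hs : s ∈ S) (hz : z ∈ S) {x : A} (hx : z • x ∈ V) {a b : ι ⊕ ι}
    (hba : b ≠ a) (hba' : b ≠ a.swap) (ho : ¬ (a = p.swap ∧ b = q.swap))
    (ho' : ¬ (a = q.swap ∧ b = p.swap)) {v : A} (hv : v ∈ V) :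
    InGrp (elemLevel lam D V Λ s) ((1 + xi lam D p q x) *
      (1 + xi lam D a b ((s ^ 2 * z ^ 2) • v)) * (1 - xi lam D p q x)) := by
  have ht : s ^ 2 * z ^ 2 ∈ S := mul_mem (pow_mem hs 2) (pow_mem hz 2)
  have hpq' : p ≠ q.swap := fun e => hqp' (by simp [e])
  have hab' : a ≠ b.swap := fun e => hba' (by simp [e])
  have hx' : z • -(lam * star x) ∈ V := by
    rw [← h.smul_neg_lam_star hz]; exact h.neg_lam_star_mem hx
  have hv' := h.neg_lam_star_mem hv
  by_cases h1 : a = q.swap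
  · subst h1
    exact h.conj_xi_xi_mem hD hqp hqp' (fun e => ho' ⟨rfl, e⟩) (by simpa using hba') hba hs hz hx hv
  by_cases h2 : a = p.swap
  · subst h2
    rw [h.xi_symm p q]
    exact h.conj_xi_xi_mem hD hqp.symm hpq' (fun e => ho ⟨rfl, e⟩) (by simpa using hba') hba hs hz
      hx' hv
  by_cases h3 : b = q.swap
  · subst h3
    rw [h.xi_symm a, h.smul_neg_lam_star ht]
    exact h.conj_xi_xi_mem hD hqp hqp' h2 (by simpa using hab') hba.symm hs hz hx hv'
  by_cases h4 : b = p.swap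
  · subst h4
    rw [h.xi_symm p q, h.xi_symm a, h.smul_neg_lam_star ht]
    exact h.conj_xi_xi_mem hD hqp.symm hpq' h1 (by simpa using hab') hba.symm hs hz hx' hv'
  rw [conj_of_mul_eq_zero (hD.xi_mul_xi hpq' (swap_ne q).symm (swap_ne p).symm hqp' _ _)
    (hD.xi_mul_xi h1 h3 h2 h4 _ _) (hD.xi_mul_xi (fun e => h4 (by simp [e]))
      (fun e => h3 (by simp [e])) (fun e => h2 (by simp [e])) (fun e => h1 (by simp [e])) _ _)]
  refine hD.inGrp_xi hba hba' ⟨(s * z ^ 2) • v, h.smul_mem (mul_mem hs (pow_mem hz 2)) hv, ?_⟩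
  rw [smul_smul]; congr 1; ring

theorem ScalarPair.conj_xi_zeta_mem' {p q : ι ⊕ ι} (hqp : q ≠ p) (hqp' : q ≠ p.swap)
    {s z : k} (hs : s ∈ S) (hz : z ∈ S) {x : A} (hx : z • x ∈ V) (a : ι ⊕ ι)
    {l : A} (hl : l ∈ Λ) :
    InGrp (elemLevel lam D V Λ s) ((1 + xi lam D p q x) *
      (1 + zeta lam D a ((s ^ 2 * z ^ 2) ^ 2 • l)) * (1 - xi lam D p q x)) := by
  have hpq' : p ≠ q.swap := fun e => hqp' (by simp [e])
  have hx' : z • -(lam * star x) ∈ V := by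
    rw [← h.smul_neg_lam_star hz]; exact h.neg_lam_star_mem hx
  by_cases h1 : a = q.swap
  · subst h1
    exact h.conj_xi_zeta_mem hD hqp hqp' hs hz hx hl
  by_cases h2 : a = p.swap
  · subst h2
    rw [h.xi_symm p q]
    exact h.conj_xi_zeta_mem hD hqp.symm hpq' hs hz hx' hl
  rw [conj_of_mul_eq_zero (hD.xi_mul_xi hpq' (swap_ne q).symm (swap_ne p).symm hqp' _ _)
    (hD.xi_mul_zeta h1 h2 _ _) (hD.zeta_mul_xi (fun e => h2 (by simp [e]))
      (fun e => h1 (by simp [e])) _ _)]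
  refine hD.inGrp_zeta a ⟨(s * z ^ 2) ^ 2 • l, h.sq_smul_mem (mul_mem hs (pow_mem hz 2)) hl, ?_⟩
  rw [smul_smul]; congr 1; ring

theorem ScalarPair.conj_zeta_xi_mem' {p : ι ⊕ ι} {s z : k} (hs : s ∈ S) (hz : z ∈ S) {x : A}
    (hx' : x = -(lam * star x)) (hx : z ^ 2 • x ∈ Λ) {a b : ι ⊕ ι}
    (hba : b ≠ a) (hba' : b ≠ a.swap) {v : A} (hv : v ∈ V) :
    InGrp (elemLevel lam D V Λ s) ((1 + zeta lam D p x) *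
      (1 + xi lam D a b ((s ^ 2 * z ^ 2) • v)) * (1 - zeta lam D p x)) := by
  have ht : s ^ 2 * z ^ 2 ∈ S := mul_mem (pow_mem hs 2) (pow_mem hz 2)
  have hab' : a ≠ b.swap := fun e => hba' (by simp [e])
  by_cases h1 : a = p.swap
  · subst h1
    exact h.conj_zeta_xi_mem hD (by simpa using hba') hba hs hz hx' hx hv
  by_cases h2 : b = p.swap
  · subst h2
    rw [h.xi_symm a, h.smul_neg_lam_star ht]
    exact h.conj_zeta_xi_mem hD (by simpa using hab') hba.symm hs hz hx' hx (h.neg_lam_star_mem hv)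
  rw [conj_of_mul_eq_zero (hD.zeta_mul_zeta (swap_ne p).symm _ _)
    (hD.zeta_mul_xi h1 h2 _ _) (hD.xi_mul_zeta (fun e => h2 (by simp [e]))
      (fun e => h1 (by simp [e])) _ _)]
  refine hD.inGrp_xi hba hba' ⟨(s * z ^ 2) • v, h.smul_mem (mul_mem hs (pow_mem hz 2)) hv, ?_⟩
  rw [smul_smul]; congr 1; ring

theorem ScalarPair.conj_zeta_zeta_mem {p a : ι ⊕ ι} (ha : a ≠ p.swap) {s z : k} (hs : s ∈ S)
    (hz : z ∈ S) {x l : A} (hl : l ∈ Λ) :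
    InGrp (elemLevel lam D V Λ s) ((1 + zeta lam D p x) *
      (1 + zeta lam D a ((s ^ 2 * z ^ 2) ^ 2 • l)) * (1 - zeta lam D p x)) := by
  rw [conj_of_mul_eq_zero (hD.zeta_mul_zeta (swap_ne p).symm _ _)
    (hD.zeta_mul_zeta ha _ _) (hD.zeta_mul_zeta (fun e => ha (by simp [e])) _ _)]
  refine hD.inGrp_zeta a ⟨(s * z ^ 2) ^ 2 • l, h.sq_smul_mem (mul_mem hs (pow_mem hz 2)) hl, ?_⟩
  rw [smul_smul]; congr 1; ring

/-- A short root element of level `t ^ 2` is a product of three root elements of level `t` for the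
roots that involve a third index `w`. -/
theorem ScalarPair.xi_eq_mul {p q w : ι ⊕ ι} (hwp : w ≠ p) (hwp' : w ≠ p.swap)
    (hwq : w ≠ q) (hwq' : w ≠ q.swap) (hqp' : q ≠ p.swap) {t : k} (v : A) :
    1 + xi lam D p q (t ^ 2 • v) =
      (1 + xi lam D w.swap q (t • -(v * mu lam w))) *
      ((1 + xi lam D p w (t • 1)) * (1 + xi lam D w.swap q (t • (v * mu lam w))) *
        (1 + xi lam D p w (t • (-1)))) := by
  have e : t • (v * mu lam w) * star (mu lam w) * t • (1 : A) = t ^ 2 • v := by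
    rw [smul_mul_assoc, mul_assoc, h.mu_star, mul_one, mul_smul_comm, mul_one, smul_smul, pow_two]
  have hz := hD.xi_mul_xi (p := w.swap) (q := q) (r := w.swap) (s := q) (lam := lam)
    (fun e => hwq (Sum.swap_rightInverse.injective e)) (swap_ne q).symm (by simpa using swap_ne w)
    (by simpa using hwq.symm) (t • (v * mu lam w)) (t • (v * mu lam w))
  rw [smul_neg, smul_neg, map_neg, map_neg, ← sub_eq_add_neg, ← sub_eq_add_neg,
    hD.conj_xi_xi h.toFormPair hwp hwp' hqp' hwq.symm (fun e => hwq' (by simp [e])), e, ← mul_assoc]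
  generalize xi lam D w.swap q (t • (v * mu lam w)) = b at *
  have : (1 - b) * (1 + b) = 1 := by rw [sub_mul, mul_add, mul_add, hz]; simp
  rw [this, one_mul]

/-- A long root element of level `t ^ 2` is a product of root elements of level `t` for the
roots that involve a second index `w`. -/
theorem ScalarPair.zeta_eq_mul {p w : ι ⊕ ι} (hwp : w ≠ p) (hwp' : w ≠ p.swap) {t : k}
    (ht : t ∈ S) {l : A} (hl : l = -(lam * star l)) :
    1 + zeta lam D p (t ^ 2 • l) =
      (1 + xi lam D p w.swap (t • -l)) * ((1 + zeta lam D w.swap (-l)) *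
      ((1 + xi lam D p w (t • mu lam w)) * (1 + zeta lam D w.swap l) *
        (1 + xi lam D p w (t • -mu lam w)))) := by
  have e₁ : l * star (mu lam w) * t • mu lam w = t • l := by
    rw [mul_smul_comm, mul_assoc, h.star_mu, mul_one]
  have e₂ : star (t • mu lam w) * mu lam w * l * star (mu lam w) * t • mu lam w = t ^ 2 • l := by
    rw [mul_assoc _ (star (mu lam w)), mul_smul_comm, h.star_mu, h.star_smul ht]
    rw [smul_mul_assoc, h.star_mu, smul_mul_assoc, smul_mul_assoc, one_mul, mul_smul_comm, mul_one,
      smul_smul, pow_two]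
  have hz := hD.zeta_mul_zeta (p := w.swap) (q := w.swap) (lam := lam)
    (by simpa using swap_ne w) l l
  have hz' := hD.xi_mul_xi (p := p) (q := w.swap) (r := p) (s := w.swap) (lam := lam)
    (by simpa using hwp.symm) (by simpa using swap_ne w) (swap_ne p).symm
    (fun e => hwp (Sum.swap_rightInverse.injective e)) (t • l) (t • l)
  rw [smul_neg, smul_neg, map_neg, map_neg, map_neg, ← sub_eq_add_neg, ← sub_eq_add_neg,
    ← sub_eq_add_neg, hD.conj_xi_zeta h.toFormPair hwp hwp' _ _ hl, e₁, e₂]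
  generalize zeta lam D w.swap l = b at *
  generalize xi lam D p w.swap (t • l) = a at *
  have hb : (1 - b) * (1 + b) = 1 := by rw [sub_mul, mul_add, mul_add, hz]; simp
  have ha : (1 - a) * (1 + a) = 1 := by rw [sub_mul, mul_add, mul_add, hz']; simp
  rw [mul_assoc (1 + b), ← mul_assoc (1 - b), hb, one_mul, ← mul_assoc, ha, one_mul]

end Level

section Conj

variable {k : Type*} [CommRing k] {A 𝓜 : Type*} [Ring A] [StarRing A] [Algebra k A] [Ring 𝓜]
  {ι : Type*} [DecidableEq ι] {lam : A} {D : ι ⊕ ι → ι ⊕ ι → A →+ 𝓜}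
  {V Λ : AddSubgroup A} {S : Submonoid k}

theorem RankOne.inv_mem_elemSet (hD : RankOne lam D) {V Λ : Set A} (hV : ∀ c ∈ V, -c ∈ V)
    (hΛ : ∀ c ∈ Λ, -c ∈ Λ) {u : 𝓜ˣ} (hu : u ∈ elemSet lam D V Λ) : u⁻¹ ∈ elemSet lam D V Λ := by
  obtain ⟨p, q, c, h₁, h₂, hc, e⟩ | ⟨p, c, hc, e⟩ := hu
  · refine Or.inl ⟨p, q, -c, h₁, h₂, hV c hc, ?_⟩
    rw [show u = hD.xiUnit h₁ h₂ c from Units.ext e, map_neg, ← sub_eq_add_neg]; rfl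
  · refine Or.inr ⟨p, -c, hΛ c hc, ?_⟩
    rw [show u = hD.zetaUnit p c from Units.ext e, map_neg, ← sub_eq_add_neg]; rfl

theorem conj_inGrp_mul {G : Subgroup 𝓜ˣ} {α : 𝓜ˣ} {a b : 𝓜} (ha : InGrp G (α * a * ↑α⁻¹))
    (hb : InGrp G (α * b * ↑α⁻¹)) : InGrp G (α * (a * b) * ↑α⁻¹) := by
  have := ha.mul hb
  rwa [show (α * a * ↑α⁻¹ : 𝓜) * (α * b * ↑α⁻¹) = α * (a * b) * ↑α⁻¹ by
    simp only [mul_assoc, Units.inv_mul_cancel_left]] at this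

variable (h : ScalarPair lam V Λ S) (hD : RankOne lam D)
  (hι : ∀ p q : ι ⊕ ι, ∃ w, w ≠ p ∧ w ≠ p.swap ∧ w ≠ q ∧ w ≠ q.swap)

theorem elemLevel_conj_le {t : k} {α : 𝓜ˣ} {G : Subgroup 𝓜ˣ}
    (h₁ : ∀ a b : ι ⊕ ι, b ≠ a → b ≠ a.swap → ∀ v ∈ V,
      InGrp G (α * (1 + xi lam D a b (t • v)) * ↑α⁻¹))
    (h₂ : ∀ a : ι ⊕ ι, ∀ l ∈ Λ, InGrp G (α * (1 + zeta lam D a (t ^ 2 • l)) * ↑α⁻¹)) :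
    ∀ g ∈ elemLevel lam D V Λ t, α * g * α⁻¹ ∈ G := by
  suffices elemLevel lam D V Λ t ≤ G.comap (MulAut.conj α).toMonoidHom from
    fun g hg => this hg
  refine (Subgroup.closure_le _).2 ?_
  rintro u (⟨a, b, c, hba, hba', ⟨v, hv, rfl⟩, e⟩ | ⟨a, c, ⟨l, hl, rfl⟩, e⟩)
  · have := h₁ a b hba hba' v hv
    rw [← e] at this
    exact (inGrp_coe_iff (u := α * u * α⁻¹)).1 this
  · have := h₂ a l hl
    rw [← e] at this
    exact (inGrp_coe_iff (u := α * u * α⁻¹)).1 this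

include h hD hι

theorem ScalarPair.exists_level_conj_of_elemSet {α : 𝓜ˣ}
    (hα : α ∈ elemSet lam D (fracSet V S) (fracForm lam Λ S)) {s : k} (hs : s ∈ S) :
    ∃ t ∈ S, ∀ g ∈ elemLevel lam D V Λ t, α * g * α⁻¹ ∈ elemLevel lam D V Λ s := by
  obtain ⟨p, q, x, hqp, hqp', ⟨z, hz, hx⟩, e⟩ | ⟨p, x, ⟨hx', z, hz, hx⟩, e⟩ := hα
  · obtain rfl : α = hD.xiUnit hqp hqp' x := Units.ext e
    have ht : s ^ 2 * z ^ 2 ∈ S := mul_mem (pow_mem hs 2) (pow_mem hz 2)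
    refine ⟨(s ^ 2 * z ^ 2) ^ 2, pow_mem ht 2, elemLevel_conj_le ?_ ?_⟩
    · intro a b hba hba' v hv
      by_cases ho : (a = p.swap ∧ b = q.swap) ∨ (a = q.swap ∧ b = p.swap)
      · obtain ⟨w, hwa, hwa', hwb, hwb'⟩ := hι a b
        rw [h.xi_eq_mul hD hwa hwa' hwb hwb' hba']
        have key : ∀ a' b', b' ≠ a' → b' ≠ a'.swap → (b' = w ∨ a' = w.swap) → ∀ v' ∈ V,
            InGrp (elemLevel lam D V Λ s) ((hD.xiUnit hqp hqp' x : 𝓜ˣ) *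
              (1 + xi lam D a' b' ((s ^ 2 * z ^ 2) • v')) * ↑(hD.xiUnit hqp hqp' x)⁻¹) := by
          intro a' b' h1 h2 h3 v' hv'
          refine h.conj_xi_mem hD hqp hqp' hs hz hx h1 h2 ?_ ?_ hv'
          · rintro ⟨rfl, rfl⟩
            rcases h3 with h3 | h3
            · rcases ho with ⟨rfl, rfl⟩ | ⟨rfl, rfl⟩
              · exact hwb h3.symm
              · exact hwa h3.symm
            · rcases ho with ⟨rfl, rfl⟩ | ⟨rfl, rfl⟩
              · exact hwa' (by simpa using congrArg Sum.swap h3.symm)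
              · exact hwb' (by simpa using congrArg Sum.swap h3.symm)
          · rintro ⟨rfl, rfl⟩
            rcases h3 with h3 | h3
            · rcases ho with ⟨rfl, rfl⟩ | ⟨rfl, rfl⟩
              · exact hwa h3.symm
              · exact hwb h3.symm
            · rcases ho with ⟨rfl, rfl⟩ | ⟨rfl, rfl⟩
              · exact hwb' (by simpa using congrArg Sum.swap h3.symm)
              · exact hwa' (by simpa using congrArg Sum.swap h3.symm)
        have hm := h.mul_mem hv (h.mu_mem w)
        have n1 : b ≠ w.swap := fun e => hwb' (by simp [e])
        have n2 : b ≠ w.swap.swap := by simpa using hwb.symm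
        exact conj_inGrp_mul (key _ _ n1 n2 (Or.inr rfl) _ (neg_mem hm))
          (conj_inGrp_mul (conj_inGrp_mul (key _ _ hwa hwa' (Or.inl rfl) _ h.one_mem)
            (key _ _ n1 n2 (Or.inr rfl) _ hm)) (key _ _ hwa hwa' (Or.inl rfl) _
              (neg_mem h.one_mem)))
      · rw [not_or] at ho
        have := h.conj_xi_mem hD hqp hqp' hs hz hx hba hba' ho.1 ho.2 (h.smul_mem ht hv)
        rwa [smul_smul, ← pow_two] at this
    · intro a l hl
      have := h.conj_xi_zeta_mem' hD hqp hqp' hs hz hx a (h.sq_smul_mem ht hl)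
      rwa [smul_smul, ← pow_two, ← pow_mul, pow_mul _ 2 2] at this
  · obtain rfl : α = hD.zetaUnit p x := Units.ext e
    have ht : s ^ 2 * z ^ 2 ∈ S := mul_mem (pow_mem hs 2) (pow_mem hz 2)
    refine ⟨(s ^ 2 * z ^ 2) ^ 2, pow_mem ht 2, elemLevel_conj_le ?_ ?_⟩
    · intro a b hba hba' v hv
      have := h.conj_zeta_xi_mem' hD (p := p) hs hz hx' hx hba hba' (h.smul_mem ht hv)
      rwa [smul_smul, ← pow_two] at this
    · intro a l hl
      by_cases ho : a = p.swap
      · subst ho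
        obtain ⟨w, hwa, hwa', -, -⟩ := hι p.swap p.swap
        have hl' := h.sq_smul_mem ht hl
        rw [pow_two ((s ^ 2 * z ^ 2) ^ 2), ← smul_smul,
          h.zeta_eq_mul hD hwa hwa' ht (h.eq_neg hl')]
        have key : ∀ a' b', b' ≠ a' → b' ≠ a'.swap → ∀ v' ∈ V,
            InGrp (elemLevel lam D V Λ s) ((hD.zetaUnit p x : 𝓜ˣ) *
              (1 + xi lam D a' b' ((s ^ 2 * z ^ 2) • v')) * ↑(hD.zetaUnit p x)⁻¹) :=
          fun a' b' h1 h2 v' hv' => h.conj_zeta_xi_mem' hD hs hz hx' hx h1 h2 hv'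
        have key2 : ∀ l' ∈ Λ, InGrp (elemLevel lam D V Λ s) ((hD.zetaUnit p x : 𝓜ˣ) *
              (1 + zeta lam D w.swap ((s ^ 2 * z ^ 2) ^ 2 • l')) * ↑(hD.zetaUnit p x)⁻¹) :=
          fun l' hl' => h.conj_zeta_zeta_mem hD
            (fun e => hwa' (by simpa using congrArg Sum.swap e)) hs hz hl'
        have n1 : w.swap ≠ p.swap := fun e => hwa' (by simpa using congrArg Sum.swap e)
        have n2 : w.swap ≠ p.swap.swap := fun e => hwa (Sum.swap_rightInverse.injective e)
        refine conj_inGrp_mul (key _ _ n1 n2 _ (neg_mem (h.le hl'))) (conj_inGrp_mul ?_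
          (conj_inGrp_mul (conj_inGrp_mul (key _ _ hwa hwa' _ (h.mu_mem w)) (key2 _ hl))
            (key _ _ hwa hwa' _ (neg_mem (h.mu_mem w)))))
        rw [← smul_neg]
        exact key2 _ (neg_mem hl)
      · have := h.conj_zeta_zeta_mem hD (x := x) ho hs hz (h.sq_smul_mem ht hl)
        rwa [smul_smul, ← pow_two, ← pow_mul, pow_mul _ 2 2] at this

omit hD hι in
theorem ScalarPair.neg_mem_fracSet {c : A} (hc : c ∈ fracSet V S) : -c ∈ fracSet V S := by
  obtain ⟨z, hz, hc⟩ := hc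
  exact ⟨z, hz, by rw [smul_neg]; exact neg_mem hc⟩

omit hD hι in
theorem ScalarPair.neg_mem_fracForm {c : A} (hc : c ∈ fracForm lam Λ S) :
    -c ∈ fracForm lam Λ S := by
  obtain ⟨hc', z, hz, hc⟩ := hc
  refine ⟨?_, z, hz, by rw [smul_neg]; exact neg_mem hc⟩
  conv_lhs => rw [hc']
  simp

/-- An elementary element with denominators conjugates the elementary elements of some deep level
into those of a given level. -/
theorem ScalarPair.exists_level_conj {γ : 𝓜ˣ}
    (hγ : γ ∈ elemGrp lam D (fracSet V S) (fracForm lam Λ S)) {s : k} (hs : s ∈ S) :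
    ∃ t ∈ S, ∀ g ∈ elemLevel lam D V Λ t, γ * g * γ⁻¹ ∈ elemLevel lam D V Λ s := by
  have step : ∀ x y : 𝓜ˣ, x ∈ elemSet lam D (fracSet V S) (fracForm lam Λ S) →
      (∀ s ∈ S, ∃ t ∈ S, ∀ g ∈ elemLevel lam D V Λ t, y * g * y⁻¹ ∈ elemLevel lam D V Λ s) →
      ∀ s ∈ S, ∃ t ∈ S, ∀ g ∈ elemLevel lam D V Λ t,
        x * y * g * (x * y)⁻¹ ∈ elemLevel lam D V Λ s := by
    intro x y hx hy s hs
    obtain ⟨t, ht, h1⟩ := h.exists_level_conj_of_elemSet hD hι hx hs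
    obtain ⟨t', ht', h2⟩ := hy t ht
    refine ⟨t', ht', fun g hg => ?_⟩
    have := h1 _ (h2 g hg)
    simpa [mul_assoc] using this
  suffices ∀ s ∈ S, ∃ t ∈ S, ∀ g ∈ elemLevel lam D V Λ t, γ * g * γ⁻¹ ∈ elemLevel lam D V Λ s from
    this s hs
  clear hs s
  induction hγ using Subgroup.closure_induction_left with
  | one => exact fun s hs => ⟨s, hs, fun g hg => by simpa using hg⟩
  | mul_left x hx y _ ih => exact step x y hx ih
  | inv_mul_cancel x hx y _ ih =>
    exact step x⁻¹ y (hD.inv_mem_elemSet (fun c hc => h.neg_mem_fracSet hc)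
      (fun c hc => h.neg_mem_fracForm hc) hx) ih

omit hι in
/-- A group that contains the root elements attached to one hyperbolic plane contains all root
elements of some level. -/
theorem ScalarPair.elemLevel_le (i₀ : ι) {s : k} (hs : s ∈ S) {G : Subgroup 𝓜ˣ}
    (hx : ∀ u q : ι ⊕ ι, (u = .inl i₀ ∨ u = .inr i₀) → q ≠ .inl i₀ → q ≠ .inr i₀ → ∀ v ∈ V,
      InGrp G (1 + xi lam D u q (s • v)))
    (hz : ∀ u : ι ⊕ ι, (u = .inl i₀ ∨ u = .inr i₀) → ∀ l ∈ Λ, InGrp G (1 + zeta lam D u l)) :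
    elemLevel lam D V Λ (s ^ 2) ≤ G := by
  have hx' : ∀ u q : ι ⊕ ι, (u = .inl i₀ ∨ u = .inr i₀) → q ≠ .inl i₀ → q ≠ .inr i₀ → ∀ v ∈ V,
      InGrp G (1 + xi lam D q u (s • v)) := fun u q hu h₁ h₂ v hv => by
    rw [h.xi_symm, h.smul_neg_lam_star hs]
    exact hx u q hu h₁ h₂ _ (h.neg_lam_star_mem hv)
  refine (Subgroup.closure_le _).2 ?_
  rintro u (⟨p, q, c, hqp, hqp', ⟨v, hv, rfl⟩, e⟩ | ⟨p, c, ⟨l, hl, rfl⟩, e⟩) <;>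
    refine inGrp_coe_iff.1 ?_ <;> rw [e]
  · have hv' : (s ^ 2) • v = s • (s • v) := by rw [smul_smul, pow_two]
    by_cases hp : p = .inl i₀ ∨ p = .inr i₀
    · rw [hv']
      refine hx p q hp ?_ ?_ _ (h.smul_mem hs hv)
      · rintro rfl
        rcases hp with rfl | rfl <;> simp at hqp hqp'
      · rintro rfl
        rcases hp with rfl | rfl <;> simp at hqp hqp'
    by_cases hq : q = .inl i₀ ∨ q = .inr i₀
    · rw [not_or] at hp
      rw [hv']
      exact hx' q p hq hp.1 hp.2 _ (h.smul_mem hs hv)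
    rw [not_or] at hp hq
    have e₁ : ∀ r : ι ⊕ ι, r ≠ .inr i₀ → .inl i₀ ≠ r.swap := by
      rintro (r | r) <;> simp_all [eq_comm]
    rw [h.xi_eq_mul hD (w := .inl i₀) (Ne.symm hp.1) (e₁ p hp.2) (Ne.symm hq.1) (e₁ q hq.2) hqp']
    have hm := h.mul_mem hv (h.mu_mem (.inl i₀ : ι ⊕ ι))
    exact (hx _ q (Or.inr rfl) hq.1 hq.2 _ (neg_mem hm)).mul
      (((hx' _ p (Or.inl rfl) hp.1 hp.2 _ h.one_mem).mul
        (hx _ q (Or.inr rfl) hq.1 hq.2 _ hm)).mul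
        (hx' _ p (Or.inl rfl) hp.1 hp.2 _ (neg_mem h.one_mem)))
  · by_cases hp : p = .inl i₀ ∨ p = .inr i₀
    · exact hz p hp _ (h.sq_smul_mem (pow_mem hs 2) hl)
    rw [not_or] at hp
    have e₁ : ∀ r : ι ⊕ ι, r ≠ .inr i₀ → .inl i₀ ≠ r.swap := by
      rintro (r | r) <;> simp_all [eq_comm]
    rw [h.zeta_eq_mul hD (w := .inl i₀) (Ne.symm hp.1) (e₁ p hp.2) (pow_mem hs 2) (h.eq_neg hl)]
    have key : ∀ u, (u = .inl i₀ ∨ u = .inr i₀) → ∀ v ∈ V,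
        InGrp G (1 + xi lam D p u (s ^ 2 • v)) := fun u hu v hv => by
      rw [pow_two, ← smul_smul]
      exact hx' u p hu hp.1 hp.2 _ (h.smul_mem hs hv)
    exact (key _ (Or.inr rfl) _ (neg_mem (h.le hl))).mul
      ((hz _ (Or.inr rfl) _ (neg_mem hl)).mul
      (((key _ (Or.inl rfl) _ (h.mu_mem _)).mul (hz _ (Or.inr rfl) _ hl)).mul
        (key _ (Or.inl rfl) _ (neg_mem (h.mu_mem _)))))

end Conj

/-! ### Functoriality -/

section Functor

variable {A A' 𝓜 𝓜' : Type*} [Ring A] [StarRing A] [Ring A'] [StarRing A'] [Ring 𝓜] [Ring 𝓜']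
  {ι : Type*} [DecidableEq ι] {lam : A} {lam' : A'} {D : ι ⊕ ι → ι ⊕ ι → A →+ 𝓜}
  {D' : ι ⊕ ι → ι ⊕ ι → A' →+ 𝓜'}

theorem map_xi (F : 𝓜 →+* 𝓜') (g : A →+* A') (hF : ∀ p q c, F (D p q c) = D' p q (g c))
    (hstar : ∀ c, g (star c) = star (g c)) (hlam : g lam = lam') (p q : ι ⊕ ι) (c : A) :
    F (xi lam D p q c) = xi lam' D' p q (g c) := by
  simp [xi_apply, hF, hstar, hlam]

theorem map_zeta (F : 𝓜 →+* 𝓜') (g : A →+* A') (hF : ∀ p q c, F (D p q c) = D' p q (g c))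
    (hstar : ∀ c, g (star c) = star (g c)) (hlam : g lam = lam') (p : ι ⊕ ι) (c : A) :
    F (zeta lam D p c) = zeta lam' D' p (g c) := by
  simp [zeta_apply, hF, hstar, hlam]

theorem map_mem_elemGrp (F : 𝓜 →+* 𝓜') (g : A →+* A') (hF : ∀ p q c, F (D p q c) = D' p q (g c))
    (hstar : ∀ c, g (star c) = star (g c)) (hlam : g lam = lam') {V Λ : Set A} {V' Λ' : Set A'}
    (hV : ∀ c ∈ V, g c ∈ V') (hΛ : ∀ c ∈ Λ, g c ∈ Λ') {u : 𝓜ˣ} (hu : u ∈ elemGrp lam D V Λ) :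
    Units.map (F : 𝓜 →* 𝓜') u ∈ elemGrp lam' D' V' Λ' := by
  suffices elemGrp lam D V Λ ≤ (elemGrp lam' D' V' Λ').comap (Units.map (F : 𝓜 →* 𝓜')) from this hu
  refine (Subgroup.closure_le _).2 ?_
  rintro u (⟨p, q, c, h₁, h₂, hc, e⟩ | ⟨p, c, hc, e⟩)
  · refine Subgroup.subset_closure (Or.inl ⟨p, q, g c, h₁, h₂, hV c hc, ?_⟩)
    simp [e, map_xi F g hF hstar hlam]
  · refine Subgroup.subset_closure (Or.inr ⟨p, g c, hΛ c hc, ?_⟩)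
    simp [e, map_zeta F g hF hstar hlam]

/-- The rank-one operators over a polynomial ring. -/
noncomputable def polyOp (D : ι ⊕ ι → ι ⊕ ι → A →+ 𝓜) (p q : ι ⊕ ι) : A[X] →+ 𝓜[X] :=
  polyMap (D p q)

theorem RankOne.poly (hD : RankOne lam D) : RankOne (C lam) (polyOp D) where
  mul_swap p q s c d := by
    have := polyMap_mul_polyMap (D p q) (D q.swap s) (D p s) (mu lam q)
      (fun c d => hD.mul_swap p q s c d) c d
    rw [polyOp, polyOp, this]
    cases q <;> simp [mu, polyOp]
  mul_ne p q r s c d hr :=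
    polyMap_mul_polyMap_eq_zero _ _ (fun c d => hD.mul_ne p q r s c d hr) c d

end Functor

/-! ### Dilation -/

section Dilation

variable {k : Type*} [CommRing k] {A 𝓜 : Type*} [Ring A] [StarRing A] [Algebra k A] [Ring 𝓜]
  [Algebra k 𝓜] {ι : Type*} [DecidableEq ι] {lam : A} {D : ι ⊕ ι → ι ⊕ ι → A →+ 𝓜}
  {V Λ : AddSubgroup A} {S : Submonoid k}

/-- The substitution `X ↦ 0`, with values in the constant polynomials. -/
noncomputable def constX (A : Type*) [Ring A] : A[X] →+* A[X] := C.comp constantCoeff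

theorem constX_apply {A : Type*} [Ring A] (p : A[X]) : constX A p = C (p.coeff 0) := rfl

theorem constX_mem_fracSet {c : A[X]}
    (hc : c ∈ fracSet (polySubgroup V) S) : constX A c ∈ fracSet (polySubgroup V) S := by
  obtain ⟨z, hz, hc⟩ := hc
  refine ⟨z, hz, ?_⟩
  rw [constX_apply, smul_C]
  exact C_mem_polySubgroup (by simpa using hc 0)

theorem constX_mem_fracForm {c : A[X]}
    (hc : c ∈ fracForm (C lam) (polySubgroup Λ) S) :
    constX A c ∈ fracForm (C lam) (polySubgroup Λ) S := by
  obtain ⟨hc', z, hz, hc⟩ := hc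
  refine ⟨?_, z, hz, ?_⟩
  · have := congrArg (fun p => C (coeff p 0)) hc'
    simpa [constX_apply, coeff_star_poly, star_C_poly] using this
  · rw [constX_apply, smul_C]
    exact C_mem_polySubgroup (by simpa using hc 0)

theorem ScalarPair.scaleX_sub_constX_mem (h : ScalarPair lam V Λ S) {c : A[X]} {s z t : k}
    (hs : s ∈ S) (hz : z ∈ S) (ht : t ∈ S) (hc : z • c ∈ polySubgroup V) :
    ∃ v ∈ polySubgroup V, scaleX A ((s * z * t) ^ 2) c - constX A c = s • v := by
  refine ⟨((s * z ^ 2 * t ^ 2)) • (scaleX A ((s * z * t) ^ 2) c.divX * X), ?_, ?_⟩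
  · intro n
    rcases n with _ | n
    · simp
    · have := h.smul_mem (mul_mem (mul_mem hs hz) (mul_mem (pow_mem ht 2)
        (pow_mem (pow_mem (mul_mem (mul_mem hs hz) ht) 2) n))) (hc (n + 1))
      rw [coeff_smul, smul_smul] at this
      rw [coeff_smul, coeff_mul_X, coeff_scaleX, coeff_divX, smul_smul]
      convert this using 2; ring
  · ext n
    rcases n with _ | n
    · simp [constX_apply, coeff_scaleX]
    · simp only [constX_apply, coeff_sub, coeff_scaleX, coeff_C_succ, sub_zero, coeff_smul,
        coeff_mul_X, coeff_divX, smul_smul]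
      congr 1; ring

theorem ScalarPair.scaleX_sub_constX_mem_form (h : ScalarPair lam V Λ S) {c : A[X]} {s z t : k}
    (hs : s ∈ S) (hz : z ∈ S) (ht : t ∈ S) (hc : z ^ 2 • c ∈ polySubgroup Λ) :
    ∃ v ∈ polySubgroup Λ, scaleX A ((s * z * t) ^ 2) c - constX A c = s ^ 2 • v := by
  refine ⟨((z * t) ^ 2) • (scaleX A ((s * z * t) ^ 2) c.divX * X), ?_, ?_⟩
  · intro n
    rcases n with _ | n
    · simp
    · have := h.sq_smul_mem (mul_mem ht (pow_mem (mul_mem (mul_mem hs hz) ht) n)) (hc (n + 1))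
      rw [coeff_smul, smul_smul] at this
      rw [coeff_smul, coeff_mul_X, coeff_scaleX, coeff_divX, smul_smul]
      convert this using 2; ring
  · ext n
    rcases n with _ | n
    · simp [constX_apply, coeff_scaleX]
    · simp only [constX_apply, coeff_sub, coeff_scaleX, coeff_C_succ, sub_zero, coeff_smul,
        coeff_mul_X, coeff_divX, smul_smul]
      congr 1; ring

theorem constX_polyOp (p q : ι ⊕ ι) (c : A[X]) :
    constX 𝓜 (polyOp D p q c) = polyOp D p q (constX A c) := by
  simp [constX_apply, polyOp, coeff_polyMap, polyMap_C]

theorem constX_star (c : A[X]) : constX A (star c) = star (constX A c) := by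
  simp [constX_apply, coeff_star_poly, star_C_poly]

theorem scaleX_star {s : k} (hs : ∀ a : A, star (s • a) = s • star a) (c : A[X]) :
    scaleX A s (star c) = star (scaleX A s c) := by
  have : ∀ n (a : A), star (s ^ n • a) = s ^ n • star a := by
    intro n
    induction n with
    | zero => simp
    | succ n ih => intro a; rw [pow_succ, mul_smul, ih, hs, mul_smul]
  ext n; simp [coeff_scaleX, coeff_star_poly, this]

theorem scaleX_polyOp (hDk : ∀ p q (s : k) a, D p q (s • a) = s • D p q a) (s : k) (p q : ι ⊕ ι)
    (c : A[X]) : scaleX 𝓜 s (polyOp D p q c) = polyOp D p q (scaleX A s c) :=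
  (polyMap_scaleX (D p q) (hDk p q s) c).symm

variable (h : ScalarPair lam V Λ S) (hD : RankOne lam D)
  (hι : ∀ p q : ι ⊕ ι, ∃ w, w ≠ p ∧ w ≠ p.swap ∧ w ≠ q ∧ w ≠ q.swap)
  (hDk : ∀ p q (s : k) a, D p q (s • a) = s • D p q a)

include h hD hι hDk

theorem ScalarPair.exists_scaleX_mem_level {N : 𝓜[X]ˣ}
    (hN : N ∈ elemGrp (C lam) (polyOp D) (fracSet (polySubgroup V) S)
      (fracForm (C lam) (polySubgroup Λ) S)) {s : k} (hs : s ∈ S) :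
    ∃ t₀ ∈ S, ∀ t ∈ S, Units.map (scaleX 𝓜 ((t₀ * t) ^ 2) : 𝓜[X] →* 𝓜[X]) N *
      (Units.map (constX 𝓜 : 𝓜[X] →* 𝓜[X]) N)⁻¹ ∈
        elemLevel (C lam) (polyOp D) (polySubgroup V) (polySubgroup Λ) s := by
  have hconst : ∀ {N}, N ∈ elemGrp (C lam) (polyOp D) (fracSet (polySubgroup V) S)
      (fracForm (C lam) (polySubgroup Λ) S) → Units.map (constX 𝓜 : 𝓜[X] →* 𝓜[X]) N ∈
      elemGrp (C lam) (polyOp D) (fracSet (polySubgroup V) S)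
      (fracForm (C lam) (polySubgroup Λ) S) := fun hN =>
    map_mem_elemGrp (constX 𝓜) (constX A) constX_polyOp constX_star (by simp [constX_apply])
      (fun c hc => constX_mem_fracSet hc) (fun c hc => constX_mem_fracForm hc) hN
  suffices ∀ s ∈ S, ∃ t₀ ∈ S, ∀ t ∈ S, Units.map (scaleX 𝓜 ((t₀ * t) ^ 2) : 𝓜[X] →* 𝓜[X]) N *
      (Units.map (constX 𝓜 : 𝓜[X] →* 𝓜[X]) N)⁻¹ ∈
        elemLevel (C lam) (polyOp D) (polySubgroup V) (polySubgroup Λ) s from this s hs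
  clear hs s
  induction hN using Subgroup.closure_induction with
  | one => exact fun s hs => ⟨1, one_mem _, fun t ht => by simp⟩
  | mem u hu =>
    intro s hs
    obtain ⟨p, q, c, h₁, h₂, ⟨z, hz, hc⟩, e⟩ | ⟨p, c, ⟨hc', z, hz, hc⟩, e⟩ := hu
    · refine ⟨s * z, mul_mem hs hz, fun t ht => ?_⟩
      obtain ⟨v, hv, hv'⟩ := h.scaleX_sub_constX_mem hs hz ht hc
      refine inGrp_coe_iff.1 ?_
      obtain rfl : u = hD.poly.xiUnit h₁ h₂ c := Units.ext e
      have e1 : Units.map (constX 𝓜 : 𝓜[X] →* 𝓜[X]) (hD.poly.xiUnit h₁ h₂ c) =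
          hD.poly.xiUnit h₁ h₂ (constX A c) := Units.ext (by
        simpa [RankOne.xiUnit] using map_xi (constX 𝓜) (constX A) constX_polyOp constX_star
          (by simp [constX_apply]) p q c)
      have hss : ∀ a : A, star ((s * z * t) ^ 2 • a) = (s * z * t) ^ 2 • star a :=
        h.star_smul (pow_mem (mul_mem (mul_mem hs hz) ht) 2)
      have e2 : Units.map (scaleX 𝓜 ((s * z * t) ^ 2) : 𝓜[X] →* 𝓜[X]) (hD.poly.xiUnit h₁ h₂ c) =
          hD.poly.xiUnit h₁ h₂ (scaleX A ((s * z * t) ^ 2) c) := Units.ext (by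
        simpa [RankOne.xiUnit] using map_xi (scaleX 𝓜 ((s * z * t) ^ 2))
          (scaleX A ((s * z * t) ^ 2)) (scaleX_polyOp hDk _) (scaleX_star hss)
          (scaleX_C _ _) p q c)
      rw [e1, e2]
      have := hD.poly.inLevel_xi (Λ := polySubgroup Λ) h₁ h₂ hv hv'
      convert this using 1
      rw [Units.val_mul]
      change (1 + xi (C lam) (polyOp D) p q _) * (1 - xi (C lam) (polyOp D) p q _) = _
      have hz := hD.poly.xi_mul_xi (fun e => h₂ (by simp [e])) (swap_ne q).symm (swap_ne p).symm h₂
        (scaleX A ((s * z * t) ^ 2) c) (constX A c)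
      rw [add_mul, mul_sub (xi _ _ p q _), hz, map_sub]
      simp; abel
    · refine ⟨s * z, mul_mem hs hz, fun t ht => ?_⟩
      obtain ⟨v, hv, hv'⟩ := h.scaleX_sub_constX_mem_form hs hz ht hc
      refine inGrp_coe_iff.1 ?_
      obtain rfl : u = hD.poly.zetaUnit p c := Units.ext e
      have e1 : Units.map (constX 𝓜 : 𝓜[X] →* 𝓜[X]) (hD.poly.zetaUnit p c) =
          hD.poly.zetaUnit p (constX A c) := Units.ext (by
        simpa [RankOne.zetaUnit] using map_zeta (constX 𝓜) (constX A) constX_polyOp constX_star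
          (by simp [constX_apply]) p c)
      have hss : ∀ a : A, star ((s * z * t) ^ 2 • a) = (s * z * t) ^ 2 • star a :=
        h.star_smul (pow_mem (mul_mem (mul_mem hs hz) ht) 2)
      have e2 : Units.map (scaleX 𝓜 ((s * z * t) ^ 2) : 𝓜[X] →* 𝓜[X]) (hD.poly.zetaUnit p c) =
          hD.poly.zetaUnit p (scaleX A ((s * z * t) ^ 2) c) := Units.ext (by
        simpa [RankOne.zetaUnit] using map_zeta (scaleX 𝓜 ((s * z * t) ^ 2))
          (scaleX A ((s * z * t) ^ 2)) (scaleX_polyOp hDk _) (scaleX_star hss)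
          (scaleX_C _ _) p c)
      rw [e1, e2]
      have := hD.poly.inLevel_zeta (V := polySubgroup V) p hv hv'
      convert this using 1
      rw [Units.val_mul]
      change (1 + zeta (C lam) (polyOp D) p _) * (1 - zeta (C lam) (polyOp D) p _) = _
      have hz := hD.poly.zeta_mul_zeta (swap_ne p).symm
        (scaleX A ((s * z * t) ^ 2) c) (constX A c)
      rw [add_mul, mul_sub (zeta _ _ p _), hz, map_sub]
      simp; abel
  | mul x y hx hy ihx ihy =>
    intro s hs
    obtain ⟨r, hr, h1⟩ := h.poly.exists_level_conj hD.poly hι (hconst hx) hs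
    obtain ⟨t, ht, h2⟩ := ihx s hs
    obtain ⟨t', ht', h3⟩ := ihy r hr
    refine ⟨t * t', mul_mem ht ht', fun t'' ht'' => ?_⟩
    have e2 := h2 (t' * t'') (mul_mem ht' ht'')
    have e3 := h1 _ (h3 (t * t'') (mul_mem ht ht''))
    rw [show t * (t' * t'') = t * t' * t'' by ring] at e2
    rw [show t' * (t * t'') = t * t' * t'' by ring] at e3
    have := mul_mem e2 e3
    simpa [mul_assoc] using this
  | inv x hx ih =>
    intro s hs
    obtain ⟨r, hr, h1⟩ := h.poly.exists_level_conj hD.poly hι (inv_mem (hconst hx)) hs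
    obtain ⟨t, ht, h2⟩ := ih r hr
    refine ⟨t, ht, fun t' ht' => ?_⟩
    have := inv_mem (h1 _ (h2 t' ht'))
    simpa [mul_assoc] using this

end Dilation

/-! ### Semilocal rings -/

section Semisimple

variable {B : Type*} [Ring B]

theorem exists_span_singleton_lt [IsSemisimpleRing B] (b₁ b₂ : B) (hb : b₂ ∉ Ideal.span {b₁}) :
    ∃ z, Ideal.span {b₁} < Ideal.span {b₁ + z * b₂} := by
  have hle : ¬ Ideal.span {b₂} ≤ Ideal.span {b₁} := by
    rwa [Ideal.span_singleton_le_iff_mem]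
  rw [le_iff_atom_le_imp] at hle
  push Not at hle
  obtain ⟨T, hT, hT₂, hT₁⟩ := hle
  have hTs : IsSimpleModule B T := isSimpleModule_iff_isAtom.2 hT
  let f : B →ₗ[B] B := LinearMap.toSpanSingleton B B b₁
  have hker : LinearMap.ker f ⊓ isotypicComponent B B T ≠ ⊥ := by
    intro hbot
    apply hT₁
    have hinv : ∀ x ∈ isotypicComponent B B T, f x ∈ isotypicComponent B B T :=
      fun x hx => LinearMap.le_comap_isotypicComponent (S := T) f hx
    let g : isotypicComponent B B T →ₗ[B] isotypicComponent B B T := f.restrict hinv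
    have hg : Function.Injective g := by
      rw [← LinearMap.ker_eq_bot, LinearMap.ker_eq_bot']
      rintro ⟨x, hx⟩ hx0
      have : x ∈ LinearMap.ker f ⊓ isotypicComponent B B T := ⟨congrArg Subtype.val hx0, hx⟩
      rw [hbot] at this
      exact Subtype.ext this
    have hs := IsArtinian.surjective_of_injective_endomorphism g hg
    intro t ht
    have ht' : t ∈ isotypicComponent B B T := T.le_isotypicComponent ht
    obtain ⟨⟨x, hx⟩, hx'⟩ := hs ⟨t, ht'⟩
    rw [Ideal.mem_span_singleton']
    exact ⟨x, congrArg Subtype.val hx'⟩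
  obtain ⟨U, hU, hUle⟩ := (eq_bot_or_exists_atom_le _).resolve_left hker
  have hUs : IsSimpleModule B U := isSimpleModule_iff_isAtom.2 hU
  have hUT : Nonempty (U ≃ₗ[B] T) :=
    isIsotypicOfType_submodule_iff.1 (IsIsotypicOfType.isotypicComponent B B T) U
      (hUle.trans inf_le_right)
  obtain ⟨e⟩ := hUT
  obtain ⟨W, hW⟩ := exists_isCompl U
  let ψ : B →ₗ[B] B := T.subtype ∘ₗ e.toLinearMap ∘ₗ Submodule.projectionOnto U W hW
  obtain ⟨z, hz⟩ := Ideal.mem_span_singleton'.1 (hT₂ (show ψ 1 ∈ T from (e _).2))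
  have hψ : ∀ r, r * (b₁ + z * b₂) = f r + ψ r := fun r => by
    rw [hz, mul_add, ← smul_eq_mul r (ψ 1), ← map_smul]
    simp [f]
  have hTle : T ≤ Ideal.span {b₁ + z * b₂} := fun t ht => by
    rw [Ideal.mem_span_singleton']
    refine ⟨(e.symm ⟨t, ht⟩ : U), ?_⟩
    have h0 : f ((e.symm ⟨t, ht⟩ : U) : B) = 0 := (hUle (e.symm ⟨t, ht⟩ : U).2).1
    rw [hψ, h0, zero_add]
    simp [ψ]
  refine ⟨z, lt_of_le_of_ne ?_ fun heq => hT₁ (heq ▸ hTle)⟩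
  rw [Ideal.span_singleton_le_iff_mem, Ideal.mem_span_singleton']
  obtain ⟨u, hu, w, hw, huw⟩ := Submodule.mem_sup.1
    (show (1 : B) ∈ U ⊔ W from hW.sup_eq_top ▸ trivial)
  refine ⟨w, ?_⟩
  have h0 : f u = 0 := (hUle hu).1
  have h1 : f 1 = b₁ := by simp [f]
  have h2 : ψ w = 0 := by
    have : Submodule.projectionOnto U W hW w = 0 := by
      rw [← LinearMap.mem_ker, Submodule.ker_projectionOnto]; exact hw
    simp [ψ, this]
  rw [hψ, h2, add_zero, ← h1, ← huw, map_add, h0, zero_add]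

theorem exists_eq_mul_add_of_isSemisimpleRing [IsSemisimpleRing B] (b₁ b₂ : B) :
    ∃ z c, b₂ = c * (b₁ + z * b₂) := by
  obtain ⟨I, ⟨z, rfl⟩, hmax⟩ := set_has_maximal_iff_noetherian.2 (inferInstance : IsNoetherian B B)
    (Set.range fun z => Ideal.span {b₁ + z * b₂}) (Set.range_nonempty _)
  refine ⟨z, ?_⟩
  by_contra hne
  push Not at hne
  obtain ⟨z', hz'⟩ := exists_span_singleton_lt (b₁ + z * b₂) b₂ fun hmem => by
    obtain ⟨c, hc⟩ := Ideal.mem_span_singleton'.1 hmem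
    exact hne c hc.symm
  refine hmax (Ideal.span {b₁ + (z + z') * b₂}) ⟨_, rfl⟩ ?_
  rwa [add_mul, ← add_assoc]

theorem exists_sub_mul_mem_jacobson [IsSemisimpleRing (B ⧸ Ring.jacobson B)] (b₁ b₂ : B) :
    ∃ z c, b₂ - c * (b₁ + z * b₂) ∈ Ring.jacobson B := by
  obtain ⟨z, c, h⟩ := exists_eq_mul_add_of_isSemisimpleRing
    (Ideal.Quotient.mk (Ring.jacobson B) b₁) (Ideal.Quotient.mk (Ring.jacobson B) b₂)
  obtain ⟨z, rfl⟩ := Ideal.Quotient.mk_surjective z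
  obtain ⟨c, rfl⟩ := Ideal.Quotient.mk_surjective c
  refine ⟨z, c, ?_⟩
  rw [← Ideal.Quotient.mk_eq_mk_iff_sub_mem]
  simpa using h

theorem exists_mul_eq_one_of_sub_mem_jacobson {a c : B} (h : 1 - c * a ∈ Ring.jacobson B) :
    ∃ w, w * a = 1 := by
  rw [← Ideal.mem_span_singleton', ← Ideal.eq_top_iff_one]
  by_contra hne
  obtain ⟨M, hM, hle⟩ := Ideal.exists_le_maximal _ hne
  refine hM.ne_top ((Ideal.eq_top_iff_one _).2 ?_)
  have h1 := Ring.jacobson_le_of_isMaximal M h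
  have h2 : c * a ∈ M := M.mul_mem_left c (hle (Ideal.mem_span_singleton_self a))
  simpa using M.add_mem h1 h2

end Semisimple

section LocSemilocal

variable {R : Type*} [Ring R] [StarRing R]

/-- The involution of the center as a ring automorphism. -/
def centerBarEquiv (R : Type*) [Ring R] [StarRing R] : Subring.center R ≃+* Subring.center R where
  toFun := centerBar
  invFun := centerBar
  left_inv _ := Subtype.ext (star_star _)
  right_inv _ := Subtype.ext (star_star _)
  map_mul' a b := Subtype.ext (by
    change star ((a : R) * b) = star (a : R) * star (b : R)
    rw [star_mul]
    exact (Subring.mem_center_iff.1 (centerBar a).2 (star (b : R))))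
  map_add' a b := Subtype.ext (star_add _ _)

/-- The ideal `𝔪 ∩ 𝔪̄` of the center. -/
def symmIdeal (m : MaximalSpectrum (Subring.center R)) : Ideal (Subring.center R) :=
  m.asIdeal ⊓ m.asIdeal.comap (centerBarEquiv R : Subring.center R →+* Subring.center R)

variable (m : MaximalSpectrum (Subring.center R))

theorem isArtinian_quotient_symmIdeal :
    IsArtinian (Subring.center R) (Subring.center R ⧸ symmIdeal m) := by
  have hm := m.isMaximal
  let m' : Ideal (Subring.center R) :=
    m.asIdeal.comap (centerBarEquiv R : Subring.center R →+* Subring.center R)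
  have hm' : m'.IsMaximal := Ideal.comap_isMaximal_of_equiv (centerBarEquiv R)
  have h1 : IsSimpleModule (Subring.center R) (Subring.center R ⧸ m.asIdeal) :=
    isSimpleModule_iff_isCoatom.2 hm.out
  have h2 : IsSimpleModule (Subring.center R) (Subring.center R ⧸ m') :=
    isSimpleModule_iff_isCoatom.2 hm'.out
  let g : (Subring.center R ⧸ symmIdeal m) →ₗ[Subring.center R]
      (Subring.center R ⧸ m.asIdeal) × (Subring.center R ⧸ m') :=
    (Submodule.mapQ _ _ LinearMap.id inf_le_left).prod (Submodule.mapQ _ _ LinearMap.id inf_le_right)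
  refine isArtinian_of_injective g ?_
  rw [← LinearMap.ker_eq_bot, LinearMap.ker_eq_bot']
  intro x hx
  obtain ⟨x, rfl⟩ := Submodule.mkQ_surjective _ x
  have hx1 := congrArg Prod.fst hx
  have hx2 := congrArg Prod.snd hx
  refine (Submodule.Quotient.mk_eq_zero _).2 ⟨?_, ?_⟩
  · exact (Submodule.Quotient.mk_eq_zero _).1 hx1
  · exact (Submodule.Quotient.mk_eq_zero _).1 hx2

theorem exists_mul_sub_one_mem {s : Subring.center R} (hs : s ∈ locSet m) :
    ∃ t, s * t - 1 ∈ symmIdeal m := by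
  have key : ∀ s : Subring.center R, s ∉ m.asIdeal → ∃ t, s * t - 1 ∈ m.asIdeal := fun s hs => by
    obtain ⟨t, ht⟩ := m.isMaximal.exists_inv hs
    obtain ⟨i, hi, hi'⟩ := ht
    refine ⟨t, ?_⟩
    rw [← hi', mul_comm]; simpa using hi
  obtain ⟨t, ht⟩ := key s hs.1
  obtain ⟨t', ht'⟩ := key (centerBar s) hs.2
  refine ⟨t + centerBar t' - s * t * centerBar t', ?_⟩
  have e : s * (t + centerBar t' - s * t * centerBar t') - 1 =
      -((s * t - 1) * (s * centerBar t' - 1)) := by ring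
  rw [e]
  refine neg_mem ⟨Ideal.mul_mem_right _ _ ht, Ideal.mul_mem_left _ _ ?_⟩
  change centerBarEquiv R (s * centerBar t' - 1) ∈ m.asIdeal
  rw [map_sub, map_mul, map_one]
  change centerBar s * centerBar (centerBar t') - 1 ∈ _
  rwa [show centerBar (centerBar t') = t' from Subtype.ext (star_star _)]

theorem mem_locSet_of_sub_one_mem {r : Subring.center R} (hr : r - 1 ∈ symmIdeal m) :
    r ∈ locSet m := by
  have h1 : (1 : Subring.center R) ∉ m.asIdeal := (Ideal.ne_top_iff_one _).1 m.isMaximal.ne_top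
  refine ⟨fun h => h1 ?_, fun h => h1 ?_⟩
  · simpa using sub_mem h hr.1
  · have := sub_mem h (show centerBarEquiv R (r - 1) ∈ m.asIdeal from hr.2)
    rw [map_sub, map_one] at this
    change centerBar r - (centerBar r - 1) ∈ _ at this
    simpa using this

theorem loc_smul_def (c : Subring.center R) (x : Loc m) : c • x = toLoc m (c : R) * x := by
  rw [Algebra.smul_def]; rfl

theorem toLoc_smul (c : Subring.center R) (r : R) : toLoc m (c • r) = c • toLoc m r := by
  rw [loc_smul_def, ← map_mul]; rfl

theorem exists_smul_eq_toLoc (x : Loc m) : ∃ s ∈ locSet m, ∃ r : R, s • x = toLoc m r := by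
  induction x using LocalizedModule.induction_on with
  | h r s =>
    refine ⟨s.1, s.2, r, ?_⟩
    rw [LocalizedModule.smul'_mk]
    exact LocalizedModule.mk_cancel s r

theorem smul_mem_jacobson_loc [Module.Finite (Subring.center R) R] {x : Subring.center R}
    (hx : x ∈ symmIdeal m) (y : Loc m) : x • y ∈ Ring.jacobson (Loc m) := by
  rw [Ring.jacobson_eq_sInf_isMaximal, Submodule.mem_sInf]
  intro M hM
  by_contra hxy
  obtain ⟨c, μ, hμ, hc⟩ := Ideal.IsMaximal.exists_inv hM hxy
  have hsmul : ∀ (s : Subring.center R) (z : Loc m), z ∈ M → s • z ∈ M := fun s z hz => by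
    rw [loc_smul_def]; exact Ideal.mul_mem_left M _ hz
  obtain ⟨s, hs, r, hr⟩ := exists_smul_eq_toLoc m (c * y)
  let N : Submodule (Subring.center R) R :=
    { carrier := {ρ | toLoc m ρ ∈ M}
      zero_mem' := by simp
      add_mem' := fun {a b} ha hb => by
        change toLoc m (a + b) ∈ M
        rw [map_add]; exact M.add_mem ha hb
      smul_mem' := fun s a ha => by
        change toLoc m (s • a) ∈ M
        rw [toLoc_smul]; exact hsmul s _ ha }
  have hN : ∀ ρ : R, s • ρ - x • (ρ * r) ∈ N := fun ρ => by
    change toLoc m _ ∈ M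
    have e : toLoc m (s • ρ - x • (ρ * r)) = toLoc m ρ * (s • μ) := by
      rw [map_sub, toLoc_smul, toLoc_smul, map_mul, ← hr]
      have : μ = 1 - x • (c * y) := by rw [← hc, mul_smul_comm]; abel
      rw [this, smul_sub, mul_sub]
      simp only [mul_smul_comm, mul_one]
      rw [smul_comm x s]
    rw [e]
    exact Ideal.mul_mem_left M _ (hsmul _ _ hμ)
  obtain ⟨t, ht⟩ := exists_mul_sub_one_mem m hs
  have hsup : (⊤ : Submodule (Subring.center R) R) ≤ N ⊔ symmIdeal m • ⊤ := fun ρ _ => by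
    have e : ρ = t • (s • ρ - x • (ρ * r)) + ((t * x) • (ρ * r) - (s * t - 1) • ρ) := by
      rw [smul_sub, sub_smul, one_smul, mul_comm s t, mul_smul, mul_smul]; abel
    rw [e]
    refine Submodule.add_mem_sup (N.smul_mem _ (hN ρ)) (Submodule.sub_mem _ ?_ ?_)
    · exact Submodule.smul_mem_smul (Ideal.mul_mem_left _ _ hx) trivial
    · exact Submodule.smul_mem_smul ht trivial
  obtain ⟨w, hw, hwN⟩ := Submodule.exists_sub_one_mem_and_smul_le_of_fg_of_le_sup
    (Module.Finite.fg_top (R := Subring.center R) (M := R)) le_top hsup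
  have hwM : toLoc m (w : R) ∈ M := by
    have : w • (1 : R) ∈ N := hwN (Submodule.smul_mem_pointwise_smul _ _ _ trivial)
    have e : w • (1 : R) = (w : R) := mul_one _
    rw [e] at this; exact this
  have hwS := mem_locSet_of_sub_one_mem m hw
  refine hM.ne_top ((Ideal.eq_top_iff_one _).2 ?_)
  have h1 := Ideal.mul_mem_left M (LocalizedModule.mk 1 (⟨w, hwS⟩ : locSet m)) hwM
  have e : (LocalizedModule.mk 1 (⟨w, hwS⟩ : locSet m) : Loc m) * toLoc m (w : R) = 1 := by
    rw [show toLoc m (w : R) = algebraMap (Subring.center R) (Loc m) w from rfl,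
      ← Algebra.commutes, ← Algebra.smul_def, LocalizedModule.smul'_mk]
    exact (LocalizedModule.mk_cancel (⟨w, hwS⟩ : locSet m) (1 : R)).trans (map_one (toLoc m))
  rwa [e] at h1

theorem isSemisimpleRing_loc_quotient [Module.Finite (Subring.center R) R] :
    IsSemisimpleRing (Loc m ⧸ Ring.jacobson (Loc m)) := by
  have hart := isArtinian_quotient_symmIdeal m
  obtain ⟨d, b, hb⟩ := Module.Finite.exists_fin (R := Subring.center R) (M := R)
  let mk : Loc m →ₗ[Subring.center R] Loc m ⧸ Ring.jacobson (Loc m) :=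
    (Ideal.Quotient.mkₐ (Subring.center R) (Ring.jacobson (Loc m))).toLinearMap
  have hmk : ∀ z : Loc m, z ∈ Ring.jacobson (Loc m) → mk z = 0 := fun z hz =>
    Ideal.Quotient.eq_zero_iff_mem.2 hz
  let g : Fin d → (Subring.center R ⧸ symmIdeal m) →ₗ[Subring.center R]
      Loc m ⧸ Ring.jacobson (Loc m) := fun i =>
    (symmIdeal m).liftQ (LinearMap.toSpanSingleton _ _ (mk (toLoc m (b i)))) fun x hx => by
      rw [LinearMap.mem_ker, LinearMap.toSpanSingleton_apply, ← map_smul]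
      exact hmk _ (smul_mem_jacobson_loc m hx _)
  let F : (Fin d → Subring.center R ⧸ symmIdeal m) →ₗ[Subring.center R]
      Loc m ⧸ Ring.jacobson (Loc m) := LinearMap.lsum _ _ ℕ g
  have hloc : ∀ r : R, mk (toLoc m r) ∈ LinearMap.range F := fun r => by
    have hr : r ∈ Submodule.span (Subring.center R) (Set.range b) := hb ▸ trivial
    induction hr using Submodule.span_induction with
    | mem x hx =>
      obtain ⟨i, rfl⟩ := hx
      refine ⟨Pi.single i (Submodule.Quotient.mk 1), ?_⟩
      rw [LinearMap.lsum_piSingle]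
      change (1 : Subring.center R) • mk (toLoc m (b i)) = _
      rw [one_smul]
    | zero => simp
    | add x y _ _ hx hy => rw [map_add, map_add]; exact add_mem hx hy
    | smul c x _ hx => rw [toLoc_smul, map_smul]; exact Submodule.smul_mem _ _ hx
  have hF : Function.Surjective F := by
    rw [← LinearMap.range_eq_top, eq_top_iff]
    intro z _
    obtain ⟨z, rfl⟩ := Ideal.Quotient.mk_surjective z
    obtain ⟨s, hs, r, hr⟩ := exists_smul_eq_toLoc m z
    obtain ⟨t, ht⟩ := exists_mul_sub_one_mem m hs
    have e : mk z = t • mk (toLoc m r) := by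
      rw [← hr, ← map_smul, smul_smul, ← sub_eq_zero, ← map_sub]
      refine hmk _ ?_
      have : z - (t * s) • z = -((s * t - 1) • z) := by rw [sub_smul, one_smul, mul_comm]; abel
      rw [this]
      exact neg_mem (smul_mem_jacobson_loc m ht z)
    change mk z ∈ _
    rw [e]
    exact Submodule.smul_mem _ _ (hloc r)
  have h1 : IsArtinian (Subring.center R) (Loc m ⧸ Ring.jacobson (Loc m)) :=
    isArtinian_of_surjective _ F hF
  have h2 : IsArtinianRing (Loc m ⧸ Ring.jacobson (Loc m)) :=
    isArtinian_of_tower (Subring.center R) h1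
  rw [IsArtinianRing.isSemisimpleRing_iff_jacobson]
  exact Ring.jacobson_quotient_jacobson _

end LocSemilocal

/-! ### Transvections are isometries -/

section Isometry

variable {A : Type*} [Ring A] [StarRing A] {W : Type*} [AddCommGroup W] [Module Aᵐᵒᵖ W]

theorem SesqForm.smul_left (F : SesqForm A W) (a : A) (x y : W) :
    F (op a • x) y = star a * F x y := by
  have := F.smul_smul x y a 1
  simpa using this

theorem SesqForm.smul_right (F : SesqForm A W) (b : A) (x y : W) :
    F x (op b • y) = F x y * b := by
  have := F.smul_smul x y 1 b
  simpa using this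

theorem SesqForm.neg_left (F : SesqForm A W) (x y : W) : F (-x) y = -F x y := by
  have := F.smul_left (-1) x y
  simpa using this

theorem SesqForm.neg_right (F : SesqForm A W) (x y : W) : F x (-y) = -F x y := by
  have := F.smul_right (-1) x y
  simpa using this

theorem SesqForm.sub_left (F : SesqForm A W) (x x' y : W) : F (x - x') y = F x y - F x' y := by
  rw [sub_eq_add_neg, F.add_left, F.neg_left, sub_eq_add_neg]

theorem SesqForm.sub_right (F : SesqForm A W) (x y y' : W) : F x (y - y') = F x y - F x y' := by
  rw [sub_eq_add_neg, F.add_right, F.neg_right, sub_eq_add_neg]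

variable {lam : A} {V Λ : AddSubgroup A} (h : FormPair lam V Λ) (F : SesqForm A W)

theorem SesqForm.herm_add_left (x x' y : W) :
    F.herm lam (x + x') y = F.herm lam x y + F.herm lam x' y := by
  simp only [SesqForm.herm, F.add_left, F.add_right, star_add, mul_add]; abel

theorem SesqForm.herm_add_right (x y y' : W) :
    F.herm lam x (y + y') = F.herm lam x y + F.herm lam x y' := by
  simp only [SesqForm.herm, F.add_left, F.add_right, star_add, mul_add]; abel

theorem SesqForm.herm_sub_left (x x' y : W) :
    F.herm lam (x - x') y = F.herm lam x y - F.herm lam x' y := by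
  simp only [SesqForm.herm, F.sub_left, F.sub_right, star_sub, mul_sub]; abel

theorem SesqForm.herm_sub_right (x y y' : W) :
    F.herm lam x (y - y') = F.herm lam x y - F.herm lam x y' := by
  simp only [SesqForm.herm, F.sub_left, F.sub_right, star_sub, mul_sub]; abel

theorem SesqForm.herm_smul_right (b : A) (x y : W) :
    F.herm lam x (op b • y) = F.herm lam x y * b := by
  simp only [SesqForm.herm, F.smul_right, F.smul_left, star_mul, star_star, add_mul, mul_assoc]

include h

theorem FormPair.herm_smul_left (a : A) (x y : W) :
    F.herm lam (op a • x) y = star a * F.herm lam x y := by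
  simp only [SesqForm.herm, F.smul_right, F.smul_left, star_mul, mul_add]
  rw [← mul_assoc lam, h.comm, mul_assoc]

theorem FormPair.herm_symm (x y : W) : F.herm lam x y = lam * star (F.herm lam y x) := by
  simp only [SesqForm.herm, star_add, star_mul, star_star, mul_add]
  rw [← h.star_comm, ← mul_assoc, h.mul_star, one_mul, add_comm]

theorem FormPair.herm_self_of_sub_mem {v : W} {a : A} (ha : F v v - a ∈ Λ) :
    F.herm lam v v = a + lam * star a := by
  have := h.eq_neg ha
  rw [star_sub, mul_sub, neg_sub] at this
  rw [SesqForm.herm]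
  rw [sub_eq_sub_iff_add_eq_add] at this
  rw [this, add_comm]

theorem FormPair.transvection_herm {u v : W} {a : A} (hu : F.herm lam u u = 0)
    (huv : F.herm lam u v = 0) (ha : F v v - a ∈ Λ) (x y : W) :
    F.herm lam (transvection F lam u v a x) (transvection F lam u v a y) = F.herm lam x y := by
  have hvu : F.herm lam v u = 0 := by rw [h.herm_symm, huv]; simp
  have hvv := h.herm_self_of_sub_mem F ha
  have hxu := h.herm_symm F x u
  have hxv := h.herm_symm F x v
  simp only [transvection, SesqForm.herm_add_left, SesqForm.herm_add_right, SesqForm.herm_sub_left,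
    SesqForm.herm_sub_right, SesqForm.herm_smul_right, h.herm_smul_left, hu, huv, hvu, hvv, hxu, hxv]
  generalize F.herm lam u x = α
  generalize F.herm lam v x = β
  generalize F.herm lam u y = α'
  generalize F.herm lam v y = β'
  have c1 : ∀ t : A, lam * (star lam * t) = t := fun t => by
    rw [← mul_assoc, h.mul_star, one_mul]
  have c3 : ∀ s t : A, s * (lam * t) = lam * (s * t) := fun s t => by
    rw [← mul_assoc, ← h.comm, mul_assoc]
  have c4 : ∀ s t : A, s * (star lam * t) = star lam * (s * t) := fun s t => by
    rw [← mul_assoc, ← h.star_comm, mul_assoc]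
  have c5 : ∀ s : A, s * lam = lam * s := fun s => (h.comm s).symm
  simp only [star_mul, star_star, mul_add, add_mul, sub_mul, mul_zero, zero_mul, mul_assoc,
    c3 (star α), c4 (star α), c4 (star β), c4 (star a), c4 a, c5 (star α), c5 (star a), c1]
  abel

theorem FormPair.add_sub_herm_mem (hV : V = ⊤) (x w : W) :
    F x w + F w x - F.herm lam w x ∈ Λ := by
  have := h.min_mem (a := F x w) (hV ▸ trivial)
  rw [SesqForm.herm]
  convert this using 1
  abel

theorem FormPair.transvection_quad (hV : V = ⊤) {u v : W} {a : A} (hu : F u u ∈ Λ)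
    (huv : F.herm lam u v = 0) (ha : F v v - a ∈ Λ) (x : W) :
    F (transvection F lam u v a x) (transvection F lam u v a x) - F x x ∈ Λ := by
  have htop : ∀ a : A, a ∈ V := fun a => hV ▸ trivial
  have c1 : ∀ t : A, lam * (star lam * t) = t := fun t => by
    rw [← mul_assoc, h.mul_star, one_mul]
  have c3 : ∀ s t : A, s * (lam * t) = lam * (s * t) := fun s t => by
    rw [← mul_assoc, ← h.comm, mul_assoc]
  have c4 : ∀ s t : A, s * (star lam * t) = star lam * (s * t) := fun s t => by
    rw [← mul_assoc, ← h.star_comm, mul_assoc]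
  have c5 : ∀ s : A, s * lam = lam * s := fun s => (h.comm s).symm
  set α := F.herm lam u x with hα
  set β := F.herm lam v x with hβ
  set γ := β - star lam * a * α with hγ
  set w := op γ • u - op (star lam * α) • v with hw
  have e1 : transvection F lam u v a x = x + w := by
    rw [transvection, hw, hγ, op_sub, sub_smul]; abel
  have huv' : F u v = -(lam * star (F v u)) := eq_neg_of_add_eq_zero_left huv
  have h1 := h.add_sub_herm_mem F hV x w
  have e2 : F.herm lam w x = star γ * α - lam * (star α * β) := by
    rw [hw, SesqForm.herm_sub_left, h.herm_smul_left, h.herm_smul_left, ← hα, ← hβ, star_mul,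
      star_star, c5, mul_assoc]
  have h2 : F w w - star α * F v v * α ∈ Λ := by
    have m1 := h.conj_mem (htop γ) hu
    have m2 := h.min_mem (htop (star γ * star (F v u) * α))
    convert add_mem m1 m2 using 1
    simp only [hw, F.sub_left, F.sub_right, F.smul_left, F.smul_right, huv', star_mul, star_star,
      mul_sub, sub_mul, mul_neg, neg_mul, mul_assoc, c3 (star α), c3 (star γ), c4 (star α), c4 (F v u),
      c4 (star (F v u)), c4 (F v v), c4 (star γ), c1, c5 (star α)]
    abel
  have h3 : star γ * α - lam * (star α * β) + star α * F v v * α ∈ Λ := by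
    have m1 := h.min_mem (htop (star β * α))
    have m2 := h.min_mem (htop (star α * a * α))
    have m3 := h.conj_mem (htop α) ha
    convert add_mem m1 (add_mem m2 m3) using 1
    simp only [hγ, star_mul, star_star, star_sub, mul_sub, sub_mul, mul_assoc, c3 (star α),
      c3 (star a), c5 (star α), c5 (star a)]
    abel
  rw [← e2] at h3
  convert add_mem h1 (add_mem h2 h3) using 1
  rw [e1]
  simp only [F.add_left, F.add_right]
  abel

omit h in
theorem mem_iff_of_sub_mem {a b : A} (hab : a - b ∈ Λ) : a ∈ Λ ↔ b ∈ Λ := by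
  constructor
  · intro ha; simpa using sub_mem ha hab
  · intro hb; simpa using add_mem hab hb

end Isometry

/-! ### Elementary matrices -/

section StdOp

open scoped Matrix

variable {A : Type*} [Ring A] [StarRing A] {ι : Type*} [Fintype ι] [DecidableEq ι]

/-- The matrix of the operator `x ↦ e_p c h(e_q, x)` on the hyperbolic module. -/
def stdOp (lam : A) (p q : ι ⊕ ι) : A →+ Matrix (ι ⊕ ι) (ι ⊕ ι) A :=
  (Matrix.singleAddMonoidHom p q.swap).comp (AddMonoidHom.mulRight (mu lam q))

variable {lam : A}

theorem stdOp_apply (p q : ι ⊕ ι) (c : A) :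
    stdOp lam p q c = Matrix.single p q.swap (c * mu lam q) := rfl

theorem rankOne_stdOp : RankOne lam (stdOp lam : ι ⊕ ι → ι ⊕ ι → A →+ _) where
  mul_swap p q s c d := by
    rw [stdOp_apply, stdOp_apply, stdOp_apply, Matrix.single_mul_single_same, mul_assoc, mul_assoc,
      mul_assoc]
  mul_ne p q r s c d hr := by
    rw [stdOp_apply, stdOp_apply, Matrix.single_mul_single_of_ne _ _ _ _ (Ne.symm hr)]

theorem stdOp_mulVec (p q : ι ⊕ ι) (c : A) (x : ι ⊕ ι → A) :
    stdOp lam p q c *ᵥ x = Pi.single p (c * (mu lam q * x q.swap)) := by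
  rw [stdOp_apply, Matrix.single_mulVec, mul_assoc]; rfl

theorem stdForm_herm_single (p : ι ⊕ ι) (a : A) (x : ι ⊕ ι → A) (hc : ∀ b : A, lam * b = b * lam) :
    (stdForm A ι).herm lam (Pi.single p a) x = star a * mu lam p * x p.swap := by
  change ∑ i, star ((Pi.single p a : ι ⊕ ι → A) (.inl i)) * x (.inr i) +
    lam * star (∑ i, star (x (.inl i)) * (Pi.single p a : ι ⊕ ι → A) (.inr i)) = _
  cases p with
  | inl j =>
    rw [Finset.sum_eq_single j, Finset.sum_eq_zero]
    · simp [mu]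
    · simp
    · intro i _ hi; simp [Pi.single_apply, hi]
    · simp
  | inr j =>
    rw [Finset.sum_eq_zero, Finset.sum_eq_single j]
    · simp [mu, ← mul_assoc, hc (star a)]
    · intro i _ hi; simp [Pi.single_apply, hi]
    · simp
    · simp

theorem stdForm_single_single (p : ι ⊕ ι) (a b : A) :
    stdForm A ι (Pi.single p a) (Pi.single p b) = 0 :=
  Finset.sum_eq_zero fun i _ => by cases p <;> simp

theorem op_smul_single (p : ι ⊕ ι) (a b : A) :
    op b • (Pi.single p a : ι ⊕ ι → A) = Pi.single p (a * b) := by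
  rw [← Pi.single_smul]; rfl

variable {V Λ : AddSubgroup A} (h : FormPair lam V Λ)

include h

theorem FormPair.one_add_xi_mulVec (p q : ι ⊕ ι) (c : A) (x : ι ⊕ ι → A) :
    (1 + xi lam (stdOp lam) p q c) *ᵥ x =
      transvection (stdForm A ι) lam (Pi.single p 1) (Pi.single q c) 0 x := by
  rw [transvection, stdForm_herm_single _ _ _ h.comm, stdForm_herm_single _ _ _ h.comm,
    op_smul_single, op_smul_single, xi_apply, Matrix.add_mulVec, Matrix.sub_mulVec, stdOp_mulVec,
    stdOp_mulVec, Matrix.one_mulVec]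
  simp [mul_assoc, add_sub_assoc]

theorem FormPair.one_add_zeta_mulVec (p : ι ⊕ ι) (c : A) (x : ι ⊕ ι → A) :
    (1 + zeta lam (stdOp lam) p c) *ᵥ x =
      transvection (stdForm A ι) lam (Pi.single p 1) 0 c x := by
  have : (stdForm A ι).herm lam 0 x = 0 := by
    simpa using stdForm_herm_single p 0 x h.comm
  rw [transvection, this, op_zero, zero_smul, smul_zero, stdForm_herm_single _ _ _ h.comm,
    op_smul_single, zeta_apply, Matrix.add_mulVec, Matrix.neg_mulVec, stdOp_mulVec,
    Matrix.one_mulVec]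
  simp [mul_assoc, sub_eq_add_neg]

/-- Elementary matrices are isometries of the hyperbolic module. -/
theorem FormPair.isometry_of_mem_elemGrp (hV : V = ⊤) {g : (Matrix (ι ⊕ ι) (ι ⊕ ι) A)ˣ}
    (hg : g ∈ elemGrp lam (stdOp lam) V Λ) :
    (∀ x y, (stdForm A ι).herm lam (g *ᵥ x) (g *ᵥ y) = (stdForm A ι).herm lam x y) ∧
      ∀ x, stdForm A ι (g *ᵥ x) (g *ᵥ x) - stdForm A ι x x ∈ Λ := by
  have hself : ∀ p : ι ⊕ ι, (stdForm A ι).herm lam (Pi.single p 1) (Pi.single p 1) = 0 := fun p => by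
    rw [SesqForm.herm, stdForm_single_single]; simp
  induction hg using Subgroup.closure_induction with
  | one => simp
  | mem u hu =>
    obtain ⟨p, q, c, h₁, h₂, hc, e⟩ | ⟨p, c, hc, e⟩ := hu
    · have hpq : (stdForm A ι).herm lam (Pi.single p 1) (Pi.single q c) = 0 := by
        rw [stdForm_herm_single _ _ _ h.comm, Pi.single_eq_of_ne (Ne.symm h₂), mul_zero]
      have hq : stdForm A ι (Pi.single q c) (Pi.single q c) - 0 ∈ Λ := by
        rw [stdForm_single_single, sub_zero]; exact zero_mem _
      rw [e]
      simp only [h.one_add_xi_mulVec]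
      exact ⟨h.transvection_herm _ (hself p) hpq hq,
        h.transvection_quad _ hV (by rw [stdForm_single_single]; exact zero_mem _) hpq hq⟩
    · have h0 : (stdForm A ι).herm lam (Pi.single p 1) 0 = 0 := by
        rw [stdForm_herm_single _ _ _ h.comm]; simp
      have hq : stdForm A ι 0 0 - c ∈ Λ := by
        have : stdForm A ι 0 0 = 0 := by simpa using stdForm_single_single p (0 : A) 0
        rw [this, zero_sub]; exact neg_mem hc
      rw [e]
      simp only [h.one_add_zeta_mulVec]
      exact ⟨h.transvection_herm _ (hself p) h0 hq,
        h.transvection_quad _ hV (by rw [stdForm_single_single]; exact zero_mem _) h0 hq⟩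
  | mul a b _ _ ha hb =>
    simp only [Units.val_mul, ← Matrix.mulVec_mulVec]
    refine ⟨fun x y => by rw [ha.1, hb.1], fun x => ?_⟩
    have := add_mem (ha.2 (b *ᵥ x)) (hb.2 x)
    simpa using this
  | inv a _ ha =>
    have e : ∀ x, (a : Matrix (ι ⊕ ι) (ι ⊕ ι) A) *ᵥ ((a⁻¹ : (Matrix (ι ⊕ ι) (ι ⊕ ι) A)ˣ) :
        Matrix (ι ⊕ ι) (ι ⊕ ι) A) *ᵥ x = x := fun x => by
      rw [Matrix.mulVec_mulVec, Units.mul_inv, Matrix.one_mulVec]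
    refine ⟨fun x y => by rw [← ha.1, e, e], fun x => ?_⟩
    have := ha.2 ((a⁻¹ : (Matrix (ι ⊕ ι) (ι ⊕ ι) A)ˣ) *ᵥ x)
    rw [e] at this
    simpa using neg_mem this

end StdOp

/-! ### Transitivity on hyperbolic pairs over a semilocal ring -/

section Transitive

open scoped Matrix

variable {A : Type*} [Ring A] [StarRing A] {ι : Type*} [Fintype ι] [DecidableEq ι]
  {lam : A} {V Λ : AddSubgroup A} (h : FormPair lam V Λ) (hV : V = ⊤)

/-- The group generated by the elementary matrices. -/
abbrev stdGrp (ι : Type*) [Fintype ι] [DecidableEq ι] (lam : A) (V Λ : AddSubgroup A) :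
    Subgroup (Matrix (ι ⊕ ι) (ι ⊕ ι) A)ˣ :=
  elemGrp lam (stdOp lam) (V : Set A) (Λ : Set A)

/-- `y` is the image of `x` under a product of elementary matrices. -/
def Reach (lam : A) (V Λ : AddSubgroup A) (x y : ι ⊕ ι → A) : Prop :=
  ∃ g ∈ stdGrp ι lam V Λ,
    ((g : Matrix (ι ⊕ ι) (ι ⊕ ι) A)) *ᵥ x = y

theorem Reach.refl (x : ι ⊕ ι → A) : Reach lam V Λ x x := ⟨1, one_mem _, by simp⟩

theorem Reach.trans {x y z : ι ⊕ ι → A} (hxy : Reach lam V Λ x y) (hyz : Reach lam V Λ y z) :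
    Reach lam V Λ x z := by
  obtain ⟨g, hg, rfl⟩ := hxy
  obtain ⟨g', hg', rfl⟩ := hyz
  exact ⟨g' * g, Subgroup.mul_mem _ hg' hg, by rw [Units.val_mul, Matrix.mulVec_mulVec]⟩

theorem Reach.exists_sum_eq_one {x y : ι ⊕ ι → A} (hxy : Reach lam V Λ x y)
    (hx : ∃ w : ι ⊕ ι → A, w ⬝ᵥ x = 1) : ∃ w : ι ⊕ ι → A, w ⬝ᵥ y = 1 := by
  obtain ⟨g, hg, rfl⟩ := hxy
  obtain ⟨w, hw⟩ := hx
  refine ⟨w ᵥ* ((g⁻¹ : (Matrix (ι ⊕ ι) (ι ⊕ ι) A)ˣ) : Matrix (ι ⊕ ι) (ι ⊕ ι) A), ?_⟩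
  rw [Matrix.dotProduct_mulVec, Matrix.vecMul_vecMul, Units.inv_mul, Matrix.vecMul_one, hw]

include h hV

/-- The elementary matrix that adds `a` times the row `k` to the row `i`. -/
theorem FormPair.exists_row_add {i k : ι ⊕ ι} (hik : k ≠ i) (hik' : k ≠ i.swap) (a : A) :
    ∃ g ∈ stdGrp ι lam V Λ, ∃ b : A, ∀ x : ι ⊕ ι → A,
      ((g : Matrix (ι ⊕ ι) (ι ⊕ ι) A) *ᵥ x) i = x i + a * x k ∧
      ((g : Matrix (ι ⊕ ι) (ι ⊕ ι) A) *ᵥ x) k.swap = x k.swap + b * x i.swap ∧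
      ∀ j, j ≠ i → j ≠ k.swap → ((g : Matrix (ι ⊕ ι) (ι ⊕ ι) A) *ᵥ x) j = x j := by
  have h₁ : k.swap ≠ i := fun e => hik' (swap_eq_iff.1 e)
  have h₂ : k.swap ≠ i.swap := fun e => hik (by simpa using congrArg Sum.swap e)
  obtain ⟨g, hg, e⟩ := (rankOne_stdOp (lam := lam) (ι := ι)).inGrp_xi (Λ := Λ) h₁ h₂
    (c := mu lam k.swap * star a) (show _ ∈ (V : Set A) from hV ▸ trivial)
  refine ⟨g, hg, -(mu lam k.swap * star a * star lam * mu lam i), fun x => ?_⟩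
  have key : (g : Matrix (ι ⊕ ι) (ι ⊕ ι) A) *ᵥ x = x + (Pi.single i (a * x k) -
      Pi.single k.swap (mu lam k.swap * star a * star lam * mu lam i * x i.swap)) := by
    rw [e, xi_apply, Matrix.add_mulVec, Matrix.sub_mulVec, stdOp_mulVec,
      stdOp_mulVec, Matrix.one_mulVec, star_mul, star_star, Sum.swap_swap]
    congr 3
    · rw [mul_assoc, ← mul_assoc (star (mu lam k.swap)), h.star_mu, one_mul]
    · simp only [mul_assoc]
  rw [key]
  refine ⟨?_, ?_, fun j hj hj' => ?_⟩
  · simp [Pi.single_eq_of_ne (Ne.symm h₁)]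
  · simp [Pi.single_eq_of_ne h₁, sub_eq_add_neg]
  · simp [Pi.single_eq_of_ne hj, Pi.single_eq_of_ne hj']

theorem FormPair.reach_row_add {i k : ι ⊕ ι} (hik : k ≠ i) (hik' : k ≠ i.swap) (a : A)
    (x : ι ⊕ ι → A) : ∃ y, Reach lam V Λ x y ∧ y i = x i + a * x k ∧
      (∃ b : A, y k.swap = x k.swap + b * x i.swap) ∧ ∀ j, j ≠ i → j ≠ k.swap → y j = x j := by
  obtain ⟨g, hg, b, hgb⟩ := h.exists_row_add hV hik hik' a (Λ := Λ)
  exact ⟨_, ⟨g, hg, rfl⟩, (hgb x).1, ⟨b, (hgb x).2.1⟩, (hgb x).2.2⟩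

/-- A vector with an entry `1` that is isotropic can be moved to a basis vector. -/
theorem FormPair.exists_clear (p : ι ⊕ ι) (x : ι ⊕ ι → A) (hp : x p = 1)
    (hx : stdForm A ι x x ∈ Λ) : ∃ g ∈ stdGrp ι lam V Λ,
      (g : Matrix (ι ⊕ ι) (ι ⊕ ι) A) *ᵥ x = Pi.single p 1 ∧
      (g : Matrix (ι ⊕ ι) (ι ⊕ ι) A) *ᵥ Pi.single p.swap 1 = Pi.single p.swap 1 := by
  have hs : ∀ s : Finset (ι ⊕ ι), p ∉ s → p.swap ∉ s →
      ∃ g ∈ stdGrp ι lam V Λ,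
        ((g : Matrix (ι ⊕ ι) (ι ⊕ ι) A) *ᵥ x) p = 1 ∧
        (∀ i ∈ s, ((g : Matrix (ι ⊕ ι) (ι ⊕ ι) A) *ᵥ x) i = 0) ∧
        (g : Matrix (ι ⊕ ι) (ι ⊕ ι) A) *ᵥ Pi.single p.swap 1 = Pi.single p.swap 1 := by
    intro s
    induction s using Finset.induction_on with
    | empty => exact fun _ _ => ⟨1, Subgroup.one_mem _, by simpa using hp, by simp, by
      rw [Units.val_one, Matrix.one_mulVec]⟩
    | insert i s his ih =>
      intro hps hps'
      rw [Finset.mem_insert, not_or] at hps hps'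
      obtain ⟨g, hg, h1, h2, h3⟩ := ih hps.2 hps'.2
      obtain ⟨g', hg', b, hb⟩ := h.exists_row_add hV (i := i) (k := p) hps.1
        (fun e => hps'.1 (swap_eq_iff.2 e)) (-((g : Matrix (ι ⊕ ι) (ι ⊕ ι) A) *ᵥ x) i) (Λ := Λ)
      refine ⟨g' * g, Subgroup.mul_mem _ hg' hg, ?_, fun j hj => ?_, ?_⟩
      · rw [Units.val_mul, ← Matrix.mulVec_mulVec, (hb _).2.2 p hps.1 (swap_ne p).symm, h1]
      · rw [Units.val_mul, ← Matrix.mulVec_mulVec]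
        rcases Finset.mem_insert.1 hj with rfl | hjs
        · rw [(hb _).1, h1]; simp
        · rw [(hb _).2.2 j (fun e => his (e ▸ hjs)) (fun e => hps'.2 (e ▸ hjs)), h2 j hjs]
      · rw [Units.val_mul, ← Matrix.mulVec_mulVec, h3]
        funext j
        by_cases hj : j = i
        · subst hj; rw [(hb _).1, Pi.single_eq_of_ne (swap_ne p).symm]; simp
        by_cases hj' : j = p.swap
        · subst hj'
          have : i.swap ≠ p.swap := fun e => hps.1 (by simpa using congrArg Sum.swap e.symm)
          rw [(hb _).2.1, Pi.single_eq_of_ne this]; simp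
        · exact (hb _).2.2 j hj hj'
  obtain ⟨g, hg, h1, h2, h3⟩ := hs (Finset.univ.filter fun i => i ≠ p ∧ i ≠ p.swap)
    (by simp) (by simp)
  set y := (g : Matrix (ι ⊕ ι) (ι ⊕ ι) A) *ᵥ x with hy
  have hyq : stdForm A ι y y ∈ Λ := (mem_iff_of_sub_mem ((h.isometry_of_mem_elemGrp hV hg).2 x)).2 hx
  have hy0 : ∀ j, j ≠ p → j ≠ p.swap → y j = 0 := fun j hj hj' => h2 j (by simp [hj, hj'])
  obtain ⟨c, hc, hce⟩ : ∃ c ∈ Λ, c * star (mu lam p) = y p.swap := by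
    cases p with
    | inl j =>
      refine ⟨y (.inr j), ?_, by simp [mu]⟩
      have : stdForm A ι y y = y (.inr j) := by
        change ∑ i, star (y (.inl i)) * y (.inr i) = _
        rw [Finset.sum_eq_single j]
        · rw [h1]; simp
        · intro i _ hi; rw [hy0 (.inl i) (by simpa using hi) (by simp)]; simp
        · simp
      rwa [this] at hyq
    | inr j =>
      have : stdForm A ι y y = star (y (.inl j)) := by
        change ∑ i, star (y (.inl i)) * y (.inr i) = _
        rw [Finset.sum_eq_single j]
        · rw [h1]; simp
        · intro i _ hi; rw [hy0 (.inl i) (by simp) (by simpa using hi)]; simp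
        · simp
      rw [this] at hyq
      refine ⟨-star (y (.inl j)), neg_mem hyq, ?_⟩
      have e := h.eq_neg hyq
      rw [star_star] at e
      change -star (y (.inl j)) * star lam = y (.inl j)
      rw [e, neg_neg, h.comm, mul_assoc, h.mul_star, mul_one]
  obtain ⟨g', hg', e⟩ := (rankOne_stdOp (lam := lam) (ι := ι)).inGrp_zeta (V := V) p.swap
    (show c ∈ (Λ : Set A) from hc)
  have key : ∀ z : ι ⊕ ι → A, (g' : Matrix (ι ⊕ ι) (ι ⊕ ι) A) *ᵥ z =
      z - Pi.single p.swap (y p.swap * z p) := fun z => by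
    rw [e, zeta_apply, Matrix.add_mulVec, Matrix.neg_mulVec, stdOp_mulVec, Matrix.one_mulVec,
      Sum.swap_swap, ← hce, ← h.star_mul_mu_swap, sub_eq_add_neg]
    congr 3
    rw [h.star_comm]
    simp only [mul_assoc]
  refine ⟨g' * g, Subgroup.mul_mem _ hg' hg, ?_, ?_⟩
  · rw [Units.val_mul, ← Matrix.mulVec_mulVec, ← hy, key, h1, mul_one]
    funext j
    by_cases hj : j = p
    · subst hj; simp [h1, Pi.single_eq_of_ne (swap_ne j).symm]
    by_cases hj' : j = p.swap
    · subst hj'; simp [Pi.single_eq_of_ne (swap_ne p)]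
    · simp [Pi.single_eq_of_ne hj, Pi.single_eq_of_ne hj', hy0 j hj hj']
  · rw [Units.val_mul, ← Matrix.mulVec_mulVec, h3, key, Pi.single_eq_of_ne (swap_ne p).symm]
    simp

variable [IsSemisimpleRing (A ⧸ Ring.jacobson A)]

/-- Two rows can be changed such that the second is in the radical. -/
theorem FormPair.reach_jacobson {i k : ι ⊕ ι} (hik : k ≠ i) (hik' : k ≠ i.swap)
    (x : ι ⊕ ι → A) : ∃ y, Reach lam V Λ x y ∧ y k ∈ Ring.jacobson A ∧
      (∃ b : A, y k.swap = x k.swap + b * x i.swap) ∧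
      (∃ b : A, y i.swap = x i.swap + b * (y k.swap)) ∧
      ∀ j, j ≠ i → j ≠ k → j ≠ i.swap → j ≠ k.swap → y j = x j := by
  obtain ⟨z, c, hzc⟩ := exists_sub_mul_mem_jacobson (x i) (x k)
  obtain ⟨y, hxy, h1, ⟨b, h2⟩, h3⟩ := h.reach_row_add hV hik hik' z x (Λ := Λ)
  have hki' : i ≠ k.swap := fun e => hik' (by simp [e])
  obtain ⟨y', hyy', h1', ⟨b', h2'⟩, h3'⟩ := h.reach_row_add hV hik.symm hki' (-c) y (Λ := Λ)
  have e1 : y' k.swap = y k.swap := h3' _ (swap_ne k) fun e => hik (by simpa using congrArg Sum.swap e)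
  refine ⟨y', hxy.trans hyy', ?_, ⟨b, by rw [e1, h2]⟩, ⟨b', ?_⟩, fun j hj hj' hj'' hj''' => ?_⟩
  · rw [h1', h1, h3 k hik (swap_ne k).symm, neg_mul, ← sub_eq_add_neg]
    exact hzc
  · rw [h2', e1, h3 i.swap (swap_ne i) fun e => hik (by simpa using congrArg Sum.swap e.symm)]
  · rw [h3' j hj' hj'', h3 j hj hj''']

theorem FormPair.exists_reach_one {i₀ i₁ : ι} (hi : i₀ ≠ i₁) (x : ι ⊕ ι → A)
    (hx : ∃ w : ι ⊕ ι → A, w ⬝ᵥ x = 1) : ∃ y, Reach lam V Λ x y ∧ y (.inl i₀) = 1 := by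
  have hrad : ∀ {a b c : A}, a ∈ Ring.jacobson A → b ∈ Ring.jacobson A →
      a + c * b ∈ Ring.jacobson A := fun ha hb => add_mem ha (Ideal.mul_mem_left _ _ hb)
  have step1 : ∀ s : Finset ι, i₀ ∉ s → ∃ y, Reach lam V Λ x y ∧
      ∀ i ∈ s, y (.inr i) ∈ Ring.jacobson A := by
    intro s
    induction s using Finset.induction_on with
    | empty => exact fun _ => ⟨x, Reach.refl x, by simp⟩
    | insert i s his ih =>
      intro h0
      rw [Finset.mem_insert, not_or] at h0
      obtain ⟨y, hxy, hy⟩ := ih h0.2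
      obtain ⟨y', hyy', h1, -, -, h4⟩ := h.reach_jacobson hV (i := Sum.inr i₀) (k := Sum.inr i)
        (by simpa using Ne.symm h0.1) (by simp) y (Λ := Λ)
      refine ⟨y', hxy.trans hyy', fun j hj => ?_⟩
      rcases Finset.mem_insert.1 hj with rfl | hjs
      · exact h1
      · rw [h4 (.inr j) (by simp; rintro rfl; exact h0.2 hjs) (by simp; rintro rfl; exact his hjs)
          (by simp) (by simp)]
        exact hy j hjs
  obtain ⟨y, hxy, hy⟩ := step1 (Finset.univ.filter fun i => i ≠ i₀) (by simp)
  have step2 : ∀ s : Finset ι, i₀ ∉ s → i₁ ∉ s → ∃ y, Reach lam V Λ x y ∧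
      (∀ i, i ≠ i₀ → y (.inr i) ∈ Ring.jacobson A) ∧ ∀ i ∈ s, y (.inl i) ∈ Ring.jacobson A := by
    intro s
    induction s using Finset.induction_on with
    | empty => exact fun _ _ => ⟨y, hxy, fun i hi => hy i (by simpa using hi), by simp⟩
    | insert i s his ih =>
      intro h0 h1
      rw [Finset.mem_insert, not_or] at h0 h1
      obtain ⟨y, hxy, hy, hy'⟩ := ih h0.2 h1.2
      obtain ⟨y', hyy', e1, ⟨b, e2⟩, ⟨b', e3⟩, e4⟩ := h.reach_jacobson hV (i := Sum.inl i₁)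
        (k := Sum.inl i) (by simpa using Ne.symm h1.1) (by simp) y (Λ := Λ)
      have r1 : y' (.inr i) ∈ Ring.jacobson A := by
        have := hrad (c := b) (hy i (Ne.symm h0.1)) (hy i₁ (Ne.symm hi))
        exact e2 ▸ this
      have r2 : y' (.inr i₁) ∈ Ring.jacobson A := by
        have := hrad (c := b') (hy i₁ (Ne.symm hi)) r1
        exact e3 ▸ this
      refine ⟨y', hxy.trans hyy', fun j hj => ?_, fun j hj => ?_⟩
      · by_cases hji : j = i
        · exact hji ▸ r1
        by_cases hj1 : j = i₁
        · exact hj1 ▸ r2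
        rw [e4 (.inr j) (by simp) (by simp) (by simpa using hj1) (by simpa using hji)]
        exact hy j hj
      · rcases Finset.mem_insert.1 hj with rfl | hjs
        · exact e1
        · rw [e4 (.inl j) (by simp; rintro rfl; exact h1.2 hjs) (by simp; rintro rfl; exact his hjs)
            (by simp) (by simp)]
          exact hy' j hjs
  obtain ⟨y, hxy, hy, hy'⟩ := step2 (Finset.univ.filter fun i => i ≠ i₀ ∧ i ≠ i₁) (by simp) (by simp)
  obtain ⟨w, hw⟩ := hxy.exists_sum_eq_one hx
  set t := w (.inl i₀) * y (.inl i₀) + w (.inr i₀) * y (.inr i₀) with ht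
  have hone : 1 - (w (.inl i₁) * y (.inl i₁) + t) ∈ Ring.jacobson A := by
    rw [dotProduct, Fintype.sum_sum_type,
      ← Finset.add_sum_erase _ (fun i => w (.inl i) * y (.inl i)) (Finset.mem_univ i₀),
      ← Finset.add_sum_erase _ (fun i => w (.inr i) * y (.inr i)) (Finset.mem_univ i₀),
      ← Finset.add_sum_erase _ (fun i => w (.inl i) * y (.inl i))
        (Finset.mem_erase.2 ⟨hi.symm, Finset.mem_univ i₁⟩)] at hw
    have e : 1 - (w (.inl i₁) * y (.inl i₁) + t) =
        ∑ i ∈ (Finset.univ.erase i₀).erase i₁, w (.inl i) * y (.inl i) +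
        ∑ i ∈ Finset.univ.erase i₀, w (.inr i) * y (.inr i) := by
      rw [← hw, ht]; abel
    rw [e]
    refine add_mem (sum_mem fun i hi => ?_) (sum_mem fun i hi => ?_)
    · simp only [Finset.mem_erase, Finset.mem_univ, and_true] at hi
      exact Ideal.mul_mem_left _ _ (hy' i (by simp [hi.1, hi.2]))
    · exact Ideal.mul_mem_left _ _ (hy i (Finset.mem_erase.1 hi).1)
  obtain ⟨z, c, hzc⟩ := exists_sub_mul_mem_jacobson (y (.inl i₁)) t
  obtain ⟨y₁, hr₁, e1, ⟨b, e2⟩, e3⟩ := h.reach_row_add hV (i := Sum.inl i₁) (k := Sum.inr i₀)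
    (by simp) (by simpa using hi) (z * w (.inr i₀)) y (Λ := Λ)
  obtain ⟨y₂, hr₂, e4, ⟨b', e5⟩, e6⟩ := h.reach_row_add hV (i := Sum.inl i₁) (k := Sum.inl i₀)
    (by simpa using hi) (by simp) (z * w (.inl i₀)) y₁ (Λ := Λ)
  have key : y₂ (.inl i₁) - (y (.inl i₁) + z * t) ∈ Ring.jacobson A := by
    have : y₂ (.inl i₁) - (y (.inl i₁) + z * t) = z * w (.inl i₀) * (b * y (.inr i₁)) := by
      rw [e4, e1, show y₁ (.inl i₀) = y (.inl i₀) + b * y (.inr i₁) from e2, ht]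
      noncomm_ring
    rw [this]
    exact Ideal.mul_mem_left _ _ (Ideal.mul_mem_left _ _ (hy i₁ (Ne.symm hi)))
  obtain ⟨v, hv⟩ : ∃ v, v * y₂ (.inl i₁) = 1 := by
    refine exists_mul_eq_one_of_sub_mem_jacobson
      (c := w (.inl i₁) + (1 - w (.inl i₁) * z) * c) ?_
    set a := y (.inl i₁)
    set a' := y₂ (.inl i₁)
    have e : 1 - (w (.inl i₁) + (1 - w (.inl i₁) * z) * c) * a' =
        (1 - (w (.inl i₁) * a + t)) + (1 - w (.inl i₁) * z) * (t - c * (a + z * t)) -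
        (w (.inl i₁) + (1 - w (.inl i₁) * z) * c) * (a' - (a + z * t)) := by
      noncomm_ring
    rw [e]
    exact sub_mem (add_mem hone (Ideal.mul_mem_left _ _ hzc)) (Ideal.mul_mem_left _ _ key)
  obtain ⟨y₃, hr₃, e7, -⟩ := h.reach_row_add hV (i := Sum.inl i₀) (k := Sum.inl i₁)
    (by simpa using hi.symm) (by simp) ((1 - y₂ (.inl i₀)) * v) y₂ (Λ := Λ)
  refine ⟨y₃, ((hxy.trans hr₁).trans hr₂).trans hr₃, ?_⟩
  rw [e7, mul_assoc, hv]
  simp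

/-- The elementary group of a semilocal ring acts transitively on hyperbolic pairs. -/
theorem FormPair.exists_hyperbolic_pair {i₀ i₁ : ι} (hi : i₀ ≠ i₁) (u v : ι ⊕ ι → A)
    (hu : stdForm A ι u u ∈ Λ) (hv : stdForm A ι v v ∈ Λ)
    (huv : (stdForm A ι).herm lam u v = 1) :
    ∃ g ∈ stdGrp ι lam V Λ,
      (g : Matrix (ι ⊕ ι) (ι ⊕ ι) A) *ᵥ u = Pi.single (.inl i₀) 1 ∧
      (g : Matrix (ι ⊕ ι) (ι ⊕ ι) A) *ᵥ v = Pi.single (.inr i₀) 1 := by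
  have hw : ∃ w : ι ⊕ ι → A, w ⬝ᵥ u = 1 := by
    refine ⟨fun q => star lam * (star (v q.swap) * mu lam q.swap), ?_⟩
    have : (stdForm A ι).herm lam v u = lam := by
      rw [h.herm_symm, huv, star_one, mul_one]
    have e : (stdForm A ι).herm lam v u = ∑ i, star (v (.inl i)) * u (.inr i) +
      lam * star (∑ i, star (u (.inl i)) * v (.inr i)) := rfl
    rw [this] at e
    simp only [dotProduct, Fintype.sum_sum_type, Sum.swap_inl, Sum.swap_inr, mu, mul_one]
    have e' := congrArg (star lam * ·) e
    simp only [h.star_mul_lam, mul_add, ← mul_assoc, one_mul] at e'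
    rw [e', star_sum, Finset.mul_sum, add_comm]
    congr 1
    · simp only [mul_assoc]
    · simp only [star_mul, star_star, mul_assoc]
      refine Finset.sum_congr rfl fun i _ => ?_
      rw [← mul_assoc (star (v (.inr i))), ← h.comm, mul_assoc, ← mul_assoc, h.star_mul_lam, one_mul]
  obtain ⟨x, ⟨g₁, hg₁, rfl⟩, hx⟩ := h.exists_reach_one hV hi u hw (Λ := Λ)
  have hu₁ := (mem_iff_of_sub_mem ((h.isometry_of_mem_elemGrp hV hg₁).2 u)).2 hu
  obtain ⟨g₂, hg₂, hg₂u, -⟩ := h.exists_clear hV _ _ hx hu₁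
  have hg := Subgroup.mul_mem _ hg₂ hg₁
  have iso := h.isometry_of_mem_elemGrp hV hg
  have hgu : ((g₂ * g₁ : (Matrix (ι ⊕ ι) (ι ⊕ ι) A)ˣ) : Matrix (ι ⊕ ι) (ι ⊕ ι) A) *ᵥ u =
      Pi.single (.inl i₀) 1 := by
    rw [Units.val_mul, ← Matrix.mulVec_mulVec, hg₂u]
  have hv₁ := (mem_iff_of_sub_mem (iso.2 v)).2 hv
  have hvp := iso.1 u v
  rw [huv, hgu, stdForm_herm_single _ _ _ h.comm, star_one, one_mul, mu, one_mul] at hvp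
  obtain ⟨g₃, hg₃, hg₃v, hg₃u⟩ := h.exists_clear hV (.inr i₀) _ hvp hv₁
  refine ⟨g₃ * (g₂ * g₁), Subgroup.mul_mem _ hg₃ hg, ?_, ?_⟩
  · rw [Units.val_mul, ← Matrix.mulVec_mulVec, hgu]; exact hg₃u
  · rw [Units.val_mul, ← Matrix.mulVec_mulVec, hg₃v]

end Transitive

/-! ### Lifting elementary elements along a localization -/

section Lift

variable {k : Type*} [CommRing k] {R A 𝓔 𝓜 : Type*} [Ring R] [StarRing R] [Algebra k R] [Ring A]
  [StarRing A] [Algebra k A] [Ring 𝓔] [Algebra k 𝓔] [Ring 𝓜] [Algebra k 𝓜] {ι : Type*}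
  [DecidableEq ι]

theorem exists_mem_forall_of_finset {κ : Type*} {S : Submonoid k} {P : κ → k → Prop}
    (hP : ∀ j, ∀ s ∈ S, ∀ t ∈ S, P j s → P j (t * s)) (T : Finset κ)
    (h : ∀ j ∈ T, ∃ s ∈ S, P j s) : ∃ s ∈ S, ∀ j ∈ T, P j s := by
  classical
  induction T using Finset.induction_on with
  | empty => exact ⟨1, one_mem _, by simp⟩
  | insert i T hi ih =>
    obtain ⟨s, hs, hsT⟩ := ih fun j hj => h j (Finset.mem_insert_of_mem hj)
    obtain ⟨t, ht, hti⟩ := h i (Finset.mem_insert_self _ _)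
    refine ⟨t * s, mul_mem ht hs, fun j hj => ?_⟩
    rcases Finset.mem_insert.1 hj with rfl | hj
    · rw [mul_comm]; exact hP _ _ ht _ hs hti
    · exact hP _ _ hs _ ht (hsT j hj)

theorem polySubgroup_map (g : R →+* A) (H : AddSubgroup R) :
    polySubgroup (H.map g.toAddMonoidHom) =
      (polySubgroup H).map (mapRingHom g).toAddMonoidHom := by
  apply le_antisymm
  · intro p hp
    refine polySubgroup_induction
      (p := fun p => p ∈ (polySubgroup H).map (mapRingHom g).toAddMonoidHom) (zero_mem _)
      (fun _ _ => add_mem) ?_ hp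
    rintro n _ ⟨a, ha, rfl⟩
    exact ⟨monomial n a, monomial_mem_polySubgroup ha n, by simp⟩
  · rintro _ ⟨p, hp, rfl⟩ n
    exact ⟨p.coeff n, hp n, by simp⟩

/-- The group generated by the elements `1 + α u q c` and `1 + β u c`, where `u` runs through the
two basis vectors of the hyperbolic plane with index `i₀`. -/
def liftGrp (i₀ : ι) (α : ι ⊕ ι → ι ⊕ ι → R →+ 𝓔) (β : ι ⊕ ι → R →+ 𝓔) (V Λ : AddSubgroup R) :
    Subgroup 𝓔ˣ :=
  Subgroup.closure {g | ∃ u : ι ⊕ ι, (u = .inl i₀ ∨ u = .inr i₀) ∧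
    ((∃ q c, q ≠ .inl i₀ ∧ q ≠ .inr i₀ ∧ c ∈ V ∧ (g : 𝓔) = 1 + α u q c) ∨
      ∃ c ∈ Λ, (g : 𝓔) = 1 + β u c)}

/-- The operators `α u q`, `β u` lift the root elements attached to the hyperbolic plane with index
`i₀` along the ring homomorphism `L`. -/
structure LiftData (i₀ : ι) (s₀ : k) (lam : A) (D : ι ⊕ ι → ι ⊕ ι → A →+ 𝓜) (l : R →+* A)
    (L : 𝓔 →+* 𝓜) (α : ι ⊕ ι → ι ⊕ ι → R →+ 𝓔) (β : ι ⊕ ι → R →+ 𝓔) : Prop where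
  map_α : ∀ {u q : ι ⊕ ι}, (u = .inl i₀ ∨ u = .inr i₀) → q ≠ .inl i₀ → q ≠ .inr i₀ → ∀ c,
    L (α u q c) = xi lam D u q (s₀ • l c)
  map_β : ∀ {u : ι ⊕ ι}, (u = .inl i₀ ∨ u = .inr i₀) → ∀ c, L (β u c) = zeta lam D u (l c)
  α_mul : ∀ {u q : ι ⊕ ι}, (u = .inl i₀ ∨ u = .inr i₀) → q ≠ .inl i₀ → q ≠ .inr i₀ → ∀ c c',
    α u q c * α u q c' = 0
  β_mul : ∀ {u : ι ⊕ ι}, (u = .inl i₀ ∨ u = .inr i₀) → ∀ c c', β u c * β u c' = 0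

theorem coeff_xi_polyOp (lam : A) (D : ι ⊕ ι → ι ⊕ ι → A →+ 𝓜) (p q : ι ⊕ ι) (c : A[X]) (n : ℕ) :
    (xi (C lam) (polyOp D) p q c).coeff n = xi lam D p q (c.coeff n) := by
  simp [xi_apply, polyOp, coeff_polyMap, coeff_star_poly, star_C_poly]

theorem coeff_zeta_polyOp (lam : A) (D : ι ⊕ ι → ι ⊕ ι → A →+ 𝓜) (p : ι ⊕ ι) (c : A[X]) (n : ℕ) :
    (zeta (C lam) (polyOp D) p c).coeff n = zeta lam D p (c.coeff n) := by
  simp [zeta_apply, polyOp, coeff_polyMap, star_C_poly]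

theorem LiftData.poly {i₀ : ι} {s₀ : k} {lam : A} {D : ι ⊕ ι → ι ⊕ ι → A →+ 𝓜} {l : R →+* A}
    {L : 𝓔 →+* 𝓜} {α : ι ⊕ ι → ι ⊕ ι → R →+ 𝓔} {β : ι ⊕ ι → R →+ 𝓔}
    (h : LiftData i₀ s₀ lam D l L α β) :
    LiftData i₀ s₀ (C lam) (polyOp D) (mapRingHom l) (mapRingHom L)
      (fun u q => polyMap (α u q)) (fun u => polyMap (β u)) where
  map_α hu hq hq' c := by
    ext n; simp [coeff_xi_polyOp, coeff_polyMap, h.map_α hu hq hq']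
  map_β hu c := by
    ext n; simp [coeff_zeta_polyOp, coeff_polyMap, h.map_β hu]
  α_mul hu hq hq' := polyMap_mul_polyMap_eq_zero _ _ (h.α_mul hu hq hq')
  β_mul hu := polyMap_mul_polyMap_eq_zero _ _ (h.β_mul hu)

/-- The unit `1 + a` for an element with square `0`. -/
def unitOfSq (a : 𝓔) (ha : a * a = 0) : 𝓔ˣ where
  val := 1 + a
  inv := 1 - a
  val_inv := by rw [add_mul, mul_sub, mul_sub, ha]; simp
  inv_val := by rw [sub_mul, mul_add, mul_add, ha]; simp

theorem map_mem_liftGrp {R' 𝓔' : Type*} [Ring R'] [Ring 𝓔'] {i₀ : ι}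
    {α : ι ⊕ ι → ι ⊕ ι → R →+ 𝓔} {β : ι ⊕ ι → R →+ 𝓔} {α' : ι ⊕ ι → ι ⊕ ι → R' →+ 𝓔'}
    {β' : ι ⊕ ι → R' →+ 𝓔'} (F : 𝓔 →+* 𝓔') (g : R →+* R')
    (hα : ∀ u q c, F (α u q c) = α' u q (g c)) (hβ : ∀ u c, F (β u c) = β' u (g c))
    {V Λ : AddSubgroup R} {V' Λ' : AddSubgroup R'} (hV : ∀ c ∈ V, g c ∈ V')
    (hΛ : ∀ c ∈ Λ, g c ∈ Λ') {x : 𝓔ˣ} (hx : x ∈ liftGrp i₀ α β V Λ) :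
    Units.map (F : 𝓔 →* 𝓔') x ∈ liftGrp i₀ α' β' V' Λ' := by
  suffices liftGrp i₀ α β V Λ ≤ (liftGrp i₀ α' β' V' Λ').comap (Units.map (F : 𝓔 →* 𝓔')) from
    this hx
  refine (Subgroup.closure_le _).2 ?_
  rintro x ⟨u, hu, ⟨q, c, hq, hq', hc, e⟩ | ⟨c, hc, e⟩⟩
  · exact Subgroup.subset_closure ⟨u, hu, Or.inl ⟨q, g c, hq, hq', hV c hc, by simp [e, hα]⟩⟩
  · exact Subgroup.subset_closure ⟨u, hu, Or.inr ⟨g c, hΛ c hc, by simp [e, hβ]⟩⟩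

theorem LiftData.elemLevel_le {i₀ : ι} {s₀ : k} {lam : A} {D : ι ⊕ ι → ι ⊕ ι → A →+ 𝓜}
    {l : R →+* A} {L : 𝓔 →+* 𝓜} {α : ι ⊕ ι → ι ⊕ ι → R →+ 𝓔} {β : ι ⊕ ι → R →+ 𝓔}
    (ld : LiftData i₀ s₀ lam D l L α β) {V Λ : AddSubgroup R} {S : Submonoid k}
    (h : ScalarPair lam (V.map l.toAddMonoidHom) (Λ.map l.toAddMonoidHom) S) (hD : RankOne lam D)
    (hs₀ : s₀ ∈ S) :
    elemLevel lam D (V.map l.toAddMonoidHom) (Λ.map l.toAddMonoidHom) (s₀ ^ 2) ≤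
      (liftGrp i₀ α β V Λ).map (Units.map (L : 𝓔 →* 𝓜)) := by
  refine h.elemLevel_le hD i₀ hs₀ ?_ ?_
  · rintro u q hu hq hq' _ ⟨c, hc, rfl⟩
    refine ⟨_, ⟨unitOfSq (α u q c) (ld.α_mul hu hq hq' c c), Subgroup.subset_closure
      ⟨u, hu, Or.inl ⟨q, c, hq, hq', hc, rfl⟩⟩, rfl⟩, ?_⟩
    change L (1 + α u q c) = _
    rw [map_add, map_one, ld.map_α hu hq hq']; rfl
  · rintro u hu _ ⟨c, hc, rfl⟩
    refine ⟨_, ⟨unitOfSq (β u c) (ld.β_mul hu c c), Subgroup.subset_closure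
      ⟨u, hu, Or.inr ⟨c, hc, rfl⟩⟩, rfl⟩, ?_⟩
    change L (1 + β u c) = _
    rw [map_add, map_one, ld.map_β hu]; rfl

theorem shiftX_map (L : 𝓔 →+* 𝓜) (p : 𝓔[X]) :
    (shiftX 𝓔 p).map (mapRingHom L) = shiftX 𝓜 (p.map L) := by
  rw [map_eq_polyMap, map_eq_polyMap, ← polyMap_shiftX]
  exact DFunLike.congr_fun (congrArg polyMap (AddMonoidHom.ext fun q => map_eq_polyMap L q)) _

theorem shiftX_star (c : A[X]) : shiftX A (star c) = star (shiftX A c) := by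
  rw [star_eq_polyMap, star_eq_polyMap, ← polyMap_shiftX]
  exact DFunLike.congr_fun
    (congrArg polyMap (AddMonoidHom.ext fun q => (star_eq_polyMap q).symm)) _

theorem shiftX_smul (z : k) (c : 𝓔[X]) : shiftX 𝓔 (z • c) = z • shiftX 𝓔 c := by
  rw [Algebra.smul_def, map_mul, Algebra.smul_def]
  congr 1
  exact shiftX_C _

theorem scaleX_map (L : 𝓔 →+* 𝓜) (hL : ∀ (s : k) a, L (s • a) = s • L a) (s : k) (p : 𝓔[X]) :
    (scaleX 𝓔 s p).map L = scaleX 𝓜 s (p.map L) := by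
  ext n; simp [coeff_scaleX, hL]

theorem specX_scaleX_C (s y z : k) (p : 𝓔[X]) :
    specX 𝓔 y z (scaleX 𝓔[X] s (C p)) = scaleX 𝓔 y p := by
  rw [scaleX_C, specX_C]

/-- Near the denominators `S`, the increments of `Σ` are products of liftable elements. -/
theorem LiftData.exists_scaleX_mem {i₀ : ι} {s₀ : k} {lam : A} {D : ι ⊕ ι → ι ⊕ ι → A →+ 𝓜}
    {l : R →+* A} {L : 𝓔 →+* 𝓜} {α : ι ⊕ ι → ι ⊕ ι → R →+ 𝓔} {β : ι ⊕ ι → R →+ 𝓔}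
    (ld : LiftData i₀ s₀ lam D l L α β) {V Λ : AddSubgroup R} {S : Submonoid k} {B : Set k}
    (h : ScalarPair lam (V.map l.toAddMonoidHom) (Λ.map l.toAddMonoidHom) S) (hD : RankOne lam D)
    (hι : ∀ p q : ι ⊕ ι, ∃ w, w ≠ p ∧ w ≠ p.swap ∧ w ≠ q ∧ w ≠ q.swap)
    (hDk : ∀ p q (s : k) a, D p q (s • a) = s • D p q a)
    (hLk : ∀ (s : k) a, L (s • a) = s • L a)
    (hαk : ∀ u q, ∀ s ∈ B, ∀ a, α u q (s • a) = s • α u q a)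
    (hβk : ∀ u, ∀ s ∈ B, ∀ a, β u (s • a) = s • β u a)
    (hker : ∀ a, L a = 0 → ∃ s ∈ S, s • a = 0)
    (hBV : ∀ y ∈ B, ∀ a ∈ V, y • a ∈ V) (hBΛ : ∀ y ∈ B, ∀ a ∈ Λ, y • a ∈ Λ)
    (hSB : ∀ s ∈ S, s ^ 2 ∈ B) (hs₀ : s₀ ∈ S) {G : 𝓔[X]ˣ}
    (hG : Units.map (mapRingHom L : 𝓔[X] →* 𝓜[X]) G ∈ elemGrp (C lam) (polyOp D)
      (fracSet (polySubgroup (V.map l.toAddMonoidHom)) S)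
      (fracForm (C lam) (polySubgroup (Λ.map l.toAddMonoidHom)) S)) :
    ∃ t ∈ S, ∀ y ∈ B, ∀ z ∈ B, Units.map (scaleX 𝓔 (y + t ^ 2 * z) : 𝓔[X] →* 𝓔[X]) G *
      (Units.map (scaleX 𝓔 y : 𝓔[X] →* 𝓔[X]) G)⁻¹ ∈ liftGrp i₀ (fun u q => polyMap (α u q))
        (fun u => polyMap (β u)) (polySubgroup V) (polySubgroup Λ) := by
  set V' := V.map l.toAddMonoidHom with hV'
  set Λ' := Λ.map l.toAddMonoidHom with hΛ'
  set N := Units.map (mapRingHom L : 𝓔[X] →* 𝓜[X]) G with hN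
  have hDk' : ∀ p q (s : k) a, polyOp D p q (s • a) = s • polyOp D p q a := fun p q s a =>
    polyMap_smul (D p q) (hDk p q s) a
  -- the increment of `N`
  set Θ : 𝓔[X][X]ˣ := Units.map (shiftX 𝓔 : 𝓔[X] →* 𝓔[X][X]) G *
    (Units.map (C : 𝓔[X] →+* 𝓔[X][X]).toMonoidHom G)⁻¹ with hΘ
  set LL : 𝓔[X][X] →+* 𝓜[X][X] := mapRingHom (mapRingHom L) with hLL
  have hLLk : ∀ (s : k) p, LL (scaleX 𝓔[X] s p) = scaleX 𝓜[X] s (LL p) := fun s p =>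
    scaleX_map (mapRingHom L) (fun s a => by ext n; simp [hLk]) s p
  have hmem : Units.map (LL : 𝓔[X][X] →* 𝓜[X][X]) Θ ∈ elemGrp (C (C lam)) (polyOp (polyOp D))
      (fracSet (polySubgroup (polySubgroup V')) S)
      (fracForm (C (C lam)) (polySubgroup (polySubgroup Λ')) S) := by
    rw [hΘ, map_mul, map_inv]
    refine mul_mem ?_ (inv_mem ?_)
    · have e : Units.map (LL : 𝓔[X][X] →* 𝓜[X][X]) (Units.map (shiftX 𝓔 : 𝓔[X] →* 𝓔[X][X]) G) =
          Units.map (shiftX 𝓜 : 𝓜[X] →* 𝓜[X][X]) N := Units.ext (shiftX_map L (G : 𝓔[X]))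
      rw [e]
      refine map_mem_elemGrp (shiftX 𝓜) (shiftX A) (fun p q c => ?_) (fun c => ?_) (shiftX_C lam)
        ?_ ?_ hG
      · exact (polyMap_shiftX (D p q) c).symm
      · exact shiftX_star c
      · rintro c ⟨z, hz, hc⟩
        exact ⟨z, hz, by rw [← shiftX_smul]; exact shiftX_mem_polySubgroup hc⟩
      · rintro c ⟨hc', z, hz, hc⟩
        refine ⟨?_, z, hz, by rw [← shiftX_smul]; exact shiftX_mem_polySubgroup hc⟩
        rw [← shiftX_star, ← shiftX_C, ← map_mul, ← map_neg, ← hc']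
    · have e : Units.map (LL : 𝓔[X][X] →* 𝓜[X][X])
          (Units.map (C : 𝓔[X] →+* 𝓔[X][X]).toMonoidHom G) =
          Units.map (C : 𝓜[X] →+* 𝓜[X][X]).toMonoidHom N := Units.ext (map_C _)
      rw [e]
      refine map_mem_elemGrp C C (fun p q c => (polyMap_C (polyOp D p q) c).symm)
        (fun c => (star_C_poly c).symm) rfl ?_ ?_ hG
      · rintro c ⟨z, hz, hc⟩
        exact ⟨z, hz, by rw [smul_C]; exact C_mem_polySubgroup hc⟩
      · rintro c ⟨hc', z, hz, hc⟩
        refine ⟨?_, z, hz, by rw [smul_C]; exact C_mem_polySubgroup hc⟩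
        rw [star_C_poly, ← C_mul, ← C_neg, ← hc']
  have hconstΘ : Units.map (constX 𝓔[X] : 𝓔[X][X] →* 𝓔[X][X]) Θ = 1 := by
    rw [hΘ, map_mul, map_inv, mul_inv_eq_one]
    refine Units.ext ?_
    change constX 𝓔[X] (shiftX 𝓔 (G : 𝓔[X])) = constX 𝓔[X] (C (G : 𝓔[X]))
    rw [constX_apply, constX_apply, coeff_zero_shiftX, coeff_C_zero]
  have hcomm : ∀ x : 𝓔[X][X]ˣ, Units.map (constX 𝓜[X] : 𝓜[X][X] →* 𝓜[X][X])
      (Units.map (LL : 𝓔[X][X] →* 𝓜[X][X]) x) = Units.map (LL : 𝓔[X][X] →* 𝓜[X][X])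
      (Units.map (constX 𝓔[X] : 𝓔[X][X] →* 𝓔[X][X]) x) := fun x => Units.ext (by
    simp [constX_apply, LL])
  obtain ⟨t₀, ht₀, ht⟩ := h.poly.exists_scaleX_mem_level hD.poly hι hDk' hmem (pow_mem hs₀ 2)
  have h1 := ht 1 (one_mem _)
  rw [hcomm, hconstΘ, map_one, inv_one, mul_one, mul_one] at h1
  have e1 : Units.map (scaleX 𝓜[X] (t₀ ^ 2) : 𝓜[X][X] →* 𝓜[X][X])
      (Units.map (LL : 𝓔[X][X] →* 𝓜[X][X]) Θ) = Units.map (LL : 𝓔[X][X] →* 𝓜[X][X])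
      (Units.map (scaleX 𝓔[X] (t₀ ^ 2) : 𝓔[X][X] →* 𝓔[X][X]) Θ) :=
    Units.ext (hLLk _ _).symm
  rw [e1] at h1
  have hVV : polySubgroup (polySubgroup V') =
      (polySubgroup (polySubgroup V)).map (mapRingHom (mapRingHom l)).toAddMonoidHom := by
    rw [hV', polySubgroup_map, polySubgroup_map]
  have hΛΛ : polySubgroup (polySubgroup Λ') =
      (polySubgroup (polySubgroup Λ)).map (mapRingHom (mapRingHom l)).toAddMonoidHom := by
    rw [hΛ', polySubgroup_map, polySubgroup_map]
  have hpp := h.poly.poly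
  rw [hVV, hΛΛ] at h1 hpp
  obtain ⟨τ, hτ, hτe⟩ := ld.poly.poly.elemLevel_le hpp hD.poly.poly hs₀ h1
  -- make the constant term of `τ` trivial
  set τ' := τ * (Units.map (constX 𝓔[X] : 𝓔[X][X] →* 𝓔[X][X]) τ)⁻¹ with hτ'
  have hτ'mem : τ' ∈ liftGrp i₀ (fun u q => polyMap (polyMap (α u q)))
      (fun u => polyMap (polyMap (β u))) (polySubgroup (polySubgroup V))
      (polySubgroup (polySubgroup Λ)) := by
    refine mul_mem hτ (inv_mem (map_mem_liftGrp (constX 𝓔[X]) (constX R[X]) (fun u q c => ?_)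
      (fun u c => ?_) (fun c hc => ?_) (fun c hc => ?_) hτ))
    · rw [constX_apply, constX_apply, coeff_polyMap, polyMap_C]
    · rw [constX_apply, constX_apply, coeff_polyMap, polyMap_C]
    · exact C_mem_polySubgroup (hc 0)
    · exact C_mem_polySubgroup (hc 0)
  have hτc : Units.map (LL : 𝓔[X][X] →* 𝓜[X][X])
      (Units.map (constX 𝓔[X] : 𝓔[X][X] →* 𝓔[X][X]) τ) = 1 := by
    rw [← hcomm, hτe, hcomm]
    have : Units.map (constX 𝓔[X] : 𝓔[X][X] →* 𝓔[X][X])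
        (Units.map (scaleX 𝓔[X] (t₀ ^ 2) : 𝓔[X][X] →* 𝓔[X][X]) Θ) = 1 := by
      rw [← hconstΘ]
      refine Units.ext ?_
      simp [constX_apply, coeff_scaleX]
    rw [this, map_one]
  have hτ'L : Units.map (LL : 𝓔[X][X] →* 𝓜[X][X]) τ' = Units.map (LL : 𝓔[X][X] →* 𝓜[X][X])
      (Units.map (scaleX 𝓔[X] (t₀ ^ 2) : 𝓔[X][X] →* 𝓔[X][X]) Θ) := by
    rw [hτ', map_mul, map_inv, hτc, inv_one, mul_one, hτe]
  have hτ'c : Units.map (constX 𝓔[X] : 𝓔[X][X] →* 𝓔[X][X]) τ' = 1 := by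
    rw [hτ', map_mul, map_inv, mul_inv_eq_one]
    refine Units.ext ?_
    simp [constX_apply]
  set ε := (Units.map (scaleX 𝓔[X] (t₀ ^ 2) : 𝓔[X][X] →* 𝓔[X][X]) Θ : 𝓔[X][X]ˣ) with hε
  -- some scaling identifies `τ'` and `ε`
  have hdiff : ∀ n m, ∃ s ∈ S, n ≠ 0 → s • ((((τ' : 𝓔[X][X]) - ε).coeff n).coeff m) = 0 := by
    intro n m
    have : L ((((τ' : 𝓔[X][X]) - ε).coeff n).coeff m) = 0 := by
      have e := congrArg (fun p : 𝓜[X][X]ˣ => ((p : 𝓜[X][X]).coeff n).coeff m) hτ'L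
      simp only [Units.coe_map, MonoidHom.coe_coe, hLL, coe_mapRingHom, coeff_map] at e
      rw [coeff_sub, coeff_sub, map_sub, sub_eq_zero]
      exact e
    obtain ⟨s, hs, e⟩ := hker _ this
    exact ⟨s, hs, fun _ => e⟩
  obtain ⟨t, htS, htz⟩ : ∃ t ∈ S, ∀ n, n ≠ 0 → t • ((τ' : 𝓔[X][X]) - ε).coeff n = 0 := by
    obtain ⟨t, htS, h⟩ := exists_mem_forall_of_finset (S := S)
      (P := fun (n : ℕ) s => n ≠ 0 → s • ((τ' : 𝓔[X][X]) - ε).coeff n = 0)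
      (fun n s _ t _ hs hn => by rw [mul_smul, hs hn, smul_zero])
      ((τ' : 𝓔[X][X]) - ε).support (fun n _ => by
        obtain ⟨t, htS, h⟩ := exists_mem_forall_of_finset (S := S)
          (P := fun (m : ℕ) s => n ≠ 0 → s • ((((τ' : 𝓔[X][X]) - ε).coeff n).coeff m) = 0)
          (fun m s _ t _ hs hn => by rw [mul_smul, hs hn, smul_zero])
          (((τ' : 𝓔[X][X]) - ε).coeff n).support (fun m _ => hdiff n m)
        refine ⟨t, htS, fun hn => ?_⟩
        ext m
        rw [coeff_smul, coeff_zero]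
        by_cases hm : m ∈ (((τ' : 𝓔[X][X]) - ε).coeff n).support
        · exact h m hm hn
        · rw [notMem_support_iff.1 hm, smul_zero])
    refine ⟨t, htS, fun n hn => ?_⟩
    by_cases hm : n ∈ ((τ' : 𝓔[X][X]) - ε).support
    · exact h n hm hn
    · rw [notMem_support_iff.1 hm, smul_zero]
  have hc0 : ((τ' : 𝓔[X][X]) - ε).coeff 0 = 0 := by
    have e2 : Units.map (constX 𝓔[X] : 𝓔[X][X] →* 𝓔[X][X]) ε = 1 := by
      rw [← hconstΘ]
      refine Units.ext ?_
      simp [constX_apply, coeff_scaleX, hε]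
    have e3 := congrArg (fun p : 𝓔[X][X]ˣ => (p : 𝓔[X][X]).coeff 0) (hτ'c.trans e2.symm)
    simp only [Units.coe_map, MonoidHom.coe_coe, constX_apply, coeff_C_zero] at e3
    rw [coeff_sub, sub_eq_zero]
    exact e3
  have hfin : Units.map (scaleX 𝓔[X] (t ^ 2) : 𝓔[X][X] →* 𝓔[X][X]) τ' =
      Units.map (scaleX 𝓔[X] (t ^ 2) : 𝓔[X][X] →* 𝓔[X][X]) ε := by
    refine Units.ext ?_
    change scaleX 𝓔[X] (t ^ 2) (τ' : 𝓔[X][X]) = scaleX 𝓔[X] (t ^ 2) (ε : 𝓔[X][X])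
    rw [← sub_eq_zero, ← map_sub]
    ext1 n
    rw [coeff_scaleX, coeff_zero]
    rcases Nat.eq_zero_or_pos n with rfl | hn
    · rw [hc0, smul_zero]
    · obtain ⟨n, rfl⟩ := Nat.exists_eq_add_of_le' hn
      rw [← pow_mul, show 2 * (n + 1) = (2 * n + 1) + 1 by ring, pow_succ, mul_smul,
        htz _ (by omega), smul_zero]
  refine ⟨t * t₀, mul_mem htS ht₀, fun y hy z hz => ?_⟩
  have e4 : Units.map (scaleX 𝓔 (y + (t * t₀) ^ 2 * z) : 𝓔[X] →* 𝓔[X]) G *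
      (Units.map (scaleX 𝓔 y : 𝓔[X] →* 𝓔[X]) G)⁻¹ =
      Units.map (specX 𝓔 y z : 𝓔[X][X] →* 𝓔[X])
        (Units.map (scaleX 𝓔[X] (t ^ 2) : 𝓔[X][X] →* 𝓔[X][X]) τ') := by
    rw [hfin, hε, hΘ, map_mul, map_mul, map_mul, map_inv, map_inv, map_inv]
    congr 1
    · refine Units.ext ?_
      change _ = specX 𝓔 y z (scaleX 𝓔[X] (t ^ 2) (scaleX 𝓔[X] (t₀ ^ 2) (shiftX 𝓔 (G : 𝓔[X]))))
      rw [scaleX_scaleX, specX_scaleX_shiftX, mul_pow]; rfl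
    · refine congrArg _ (Units.ext ?_)
      change _ = specX 𝓔 y z (scaleX 𝓔[X] (t ^ 2) (scaleX 𝓔[X] (t₀ ^ 2) (C (G : 𝓔[X]))))
      rw [scaleX_scaleX, specX_scaleX_C]; rfl
  have hscaled : Units.map (scaleX 𝓔[X] (t ^ 2) : 𝓔[X][X] →* 𝓔[X][X]) τ' ∈
      liftGrp i₀ (fun u q => polyMap (polyMap (α u q)))
        (fun u => polyMap (polyMap (β u))) (polySubgroup (polySubgroup V))
        (polySubgroup (polySubgroup Λ)) := by
    refine map_mem_liftGrp (scaleX 𝓔[X] (t ^ 2)) (scaleX R[X] (t ^ 2))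
      (fun u q c => ?_) (fun u c => ?_) (fun c hc => ?_) (fun c hc => ?_) hτ'mem
    · exact (polyMap_scaleX (polyMap (α u q)) (polyMap_smul _ (hαk u q _ (hSB t htS))) c).symm
    · exact (polyMap_scaleX (polyMap (β u)) (polyMap_smul _ (hβk u _ (hSB t htS))) c).symm
    · exact scaleX_mem_polySubgroup _ (fun a ha n => by
        rw [coeff_smul]; exact hBV _ (hSB t htS) _ (ha n)) hc
    · exact scaleX_mem_polySubgroup _ (fun a ha n => by
        rw [coeff_smul]; exact hBΛ _ (hSB t htS) _ (ha n)) hc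
  rw [e4]
  refine map_mem_liftGrp (specX 𝓔 y z) (specX R y z) (fun u q c => ?_) (fun u c => ?_)
    (fun c hc => ?_) (fun c hc => ?_) hscaled
  · exact (polyMap_specX (α u q) (hαk u q y hy) (hαk u q z hz) c).symm
  · exact (polyMap_specX (β u) (hβk u y hy) (hβk u z hz) c).symm
  · exact specX_mem_polySubgroup y z (hBV y hy) (hBV z hz) hc
  · exact specX_mem_polySubgroup y z (hBΛ y hy) (hBΛ z hz) hc

end Lift

/-! ### Pairs of congruent elements -/

section Pair

variable {A B : Type*} [Ring A] [Ring B]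

/-- The diagonal action of an additive map on pairs. -/
def pairMap (g : A →+ B) : A × A →+ B × B := g.prodMap g

theorem pairMap_apply (g : A →+ B) (c : A × A) : pairMap g c = (g c.1, g c.2) := rfl

variable [StarRing A] {ι : Type*} [DecidableEq ι] {lam : A} {D : ι ⊕ ι → ι ⊕ ι → A →+ B}

theorem mu_pair (q : ι ⊕ ι) : mu ((lam, lam) : A × A) q = (mu lam q, mu lam q) := by
  cases q <;> rfl

theorem RankOne.pair (hD : RankOne lam D) :
    RankOne ((lam, lam) : A × A) (fun p q => pairMap (D p q)) where
  mul_swap p q s c d := by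
    refine Prod.ext ?_ ?_
    · simpa [pairMap_apply, mu_pair] using hD.mul_swap p q s c.1 d.1
    · simpa [pairMap_apply, mu_pair] using hD.mul_swap p q s c.2 d.2
  mul_ne p q r s c d h := by
    refine Prod.ext ?_ ?_
    · simpa [pairMap_apply] using hD.mul_ne p q r s c.1 d.1 h
    · simpa [pairMap_apply] using hD.mul_ne p q r s c.2 d.2 h

theorem xi_pair (p q : ι ⊕ ι) (c : A × A) :
    xi ((lam, lam) : A × A) (fun p q => pairMap (D p q)) p q c =
      (xi lam D p q c.1, xi lam D p q c.2) := rfl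

theorem zeta_pair (p : ι ⊕ ι) (c : A × A) :
    zeta ((lam, lam) : A × A) (fun p q => pairMap (D p q)) p c =
      (zeta lam D p c.1, zeta lam D p c.2) := rfl

/-- The pairs that are congruent modulo `J`. -/
def pairSubring (J : Ideal A) : AddSubgroup (A × A) where
  carrier := {c | c.2 - c.1 ∈ J}
  zero_mem' := by simp
  add_mem' := fun {a b} ha hb => by
    have := J.add_mem ha hb
    change a.2 + b.2 - (a.1 + b.1) ∈ J
    convert this using 1; abel
  neg_mem' := fun {a} ha => by
    have := J.neg_mem ha
    change -a.2 - -a.1 ∈ J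
    convert this using 1; abel

/-- The pairs of elements of `Λ` that are congruent modulo `J`. -/
def pairForm (Λ : AddSubgroup A) (J : Ideal A) : AddSubgroup (A × A) :=
  Λ.prod Λ ⊓ pairSubring J

theorem mem_pairSubring {J : Ideal A} {c : A × A} : c ∈ pairSubring J ↔ c.2 - c.1 ∈ J := Iff.rfl

theorem FormPair.pair {Λ : AddSubgroup A} (h : FormPair lam ⊤ Λ) (J : Ideal A) [J.IsTwoSided]
    (hJ : ∀ a ∈ J, star a ∈ J) :
    FormPair ((lam, lam) : A × A) (pairSubring J) (pairForm Λ J) where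
  comm a := Prod.ext (h.comm _) (h.comm _)
  mul_star := Prod.ext h.mul_star h.mul_star
  one_mem := by simp [mem_pairSubring]
  mul_mem := fun {a b} ha hb => by
    have := J.add_mem (J.mul_mem_right b.2 ha) (J.mul_mem_left a.1 hb)
    change a.2 * b.2 - a.1 * b.1 ∈ J
    convert this using 1; noncomm_ring
  star_mem := fun {a} ha => by
    have := hJ _ ha
    rw [star_sub] at this
    exact this
  lam_mem := by simp [mem_pairSubring]
  le := inf_le_right
  min_mem := fun {a} ha => by
    refine ⟨⟨h.min_mem trivial, h.min_mem trivial⟩, ?_⟩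
    have := J.sub_mem ha (J.mul_mem_left lam (hJ _ ha))
    change a.2 - lam * star a.2 - (a.1 - lam * star a.1) ∈ J
    convert this using 1
    rw [star_sub, mul_sub]; abel
  eq_neg ha := Prod.ext (h.eq_neg ha.1.1) (h.eq_neg ha.1.2)
  conj_mem := fun {x a} hx ha => by
    refine ⟨⟨h.conj_mem trivial ha.1.1, h.conj_mem trivial ha.1.2⟩, ?_⟩
    have h1 := J.mul_mem_right (a.2 * x.2) (hJ _ hx)
    have h2 := J.mul_mem_right x.2 (J.mul_mem_left (star x.1) ha.2)
    have h3 := J.mul_mem_left (star x.1 * a.1) hx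
    change star x.2 * a.2 * x.2 - star x.1 * a.1 * x.1 ∈ J
    convert J.add_mem (J.add_mem h1 h2) h3 using 1
    rw [star_sub]
    noncomm_ring

theorem FormPair.map [StarRing B] {V Λ : AddSubgroup A} (h : FormPair lam V Λ) (g : A →+* B)
    (hg : ∀ a, g (star a) = star (g a)) (hlam : ∀ b, g lam * b = b * g lam) :
    FormPair (g lam) (V.map g.toAddMonoidHom) (Λ.map g.toAddMonoidHom) where
  comm := hlam
  mul_star := by rw [← hg, ← map_mul, h.mul_star, map_one]
  one_mem := ⟨1, h.one_mem, map_one g⟩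
  mul_mem := by
    rintro _ _ ⟨a, ha, rfl⟩ ⟨b, hb, rfl⟩
    exact ⟨a * b, h.mul_mem ha hb, map_mul g a b⟩
  star_mem := by
    rintro _ ⟨a, ha, rfl⟩
    exact ⟨star a, h.star_mem ha, hg a⟩
  lam_mem := ⟨lam, h.lam_mem, rfl⟩
  le := AddSubgroup.map_mono h.le
  min_mem := by
    rintro _ ⟨a, ha, rfl⟩
    exact ⟨a - lam * star a, h.min_mem ha, by simp [hg]⟩
  eq_neg := by
    rintro _ ⟨a, ha, rfl⟩
    have := congrArg g (h.eq_neg ha)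
    simpa [hg] using this
  conj_mem := by
    rintro _ _ ⟨x, hx, rfl⟩ ⟨a, ha, rfl⟩
    exact ⟨star x * a * x, h.conj_mem hx ha, by simp [hg]⟩

theorem LiftData.pair {k : Type*} [CommRing k] {R 𝓔 𝓜 : Type*} [Ring R] [StarRing R] [Algebra k R]
    [Algebra k A] [Ring 𝓔] [Algebra k 𝓔] [Ring 𝓜] [Algebra k 𝓜]
    {i₀ : ι} {s₀ : k} {D : ι ⊕ ι → ι ⊕ ι → A →+ 𝓜} {l : R →+* A}
    {L : 𝓔 →+* 𝓜} {α : ι ⊕ ι → ι ⊕ ι → R →+ 𝓔} {β : ι ⊕ ι → R →+ 𝓔}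
    (h : LiftData i₀ s₀ lam D l L α β) :
    LiftData i₀ s₀ ((lam, lam) : A × A) (fun p q => pairMap (D p q)) (l.prodMap l) (L.prodMap L)
      (fun u q => pairMap (α u q)) (fun u => pairMap (β u)) where
  map_α hu hq hq' c := by
    rw [xi_pair]
    exact Prod.ext (h.map_α hu hq hq' _) (h.map_α hu hq hq' _)
  map_β hu c := by
    rw [zeta_pair]
    exact Prod.ext (h.map_β hu _) (h.map_β hu _)
  α_mul hu hq hq' c c' := Prod.ext (h.α_mul hu hq hq' _ _) (h.α_mul hu hq hq' _ _)
  β_mul hu c c' := Prod.ext (h.β_mul hu _ _) (h.β_mul hu _ _)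

end Pair

section PairPoly

variable {A : Type*} [Ring A]

/-- The polynomial over `A × A` with the given components. -/
noncomputable def pairPoly (p q : A[X]) : (A × A)[X] :=
  polyMap (AddMonoidHom.inl A A) p + polyMap (AddMonoidHom.inr A A) q

theorem coeff_pairPoly (p q : A[X]) (n : ℕ) : (pairPoly p q).coeff n = (p.coeff n, q.coeff n) := by
  simp [pairPoly, coeff_polyMap]

theorem map_fst_pairPoly (p q : A[X]) : (pairPoly p q).map (RingHom.fst A A) = p := by
  ext n; simp [coeff_pairPoly]

theorem map_snd_pairPoly (p q : A[X]) : (pairPoly p q).map (RingHom.snd A A) = q := by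
  ext n; simp [coeff_pairPoly]

theorem pair_ext {p q : (A × A)[X]} (h₁ : p.map (RingHom.fst A A) = q.map (RingHom.fst A A))
    (h₂ : p.map (RingHom.snd A A) = q.map (RingHom.snd A A)) : p = q := by
  ext1 n
  have e₁ := congrArg (fun r => r.coeff n) h₁
  have e₂ := congrArg (fun r => r.coeff n) h₂
  simp only [coeff_map] at e₁ e₂
  exact Prod.ext e₁ e₂

/-- The unit over `A × A` with the given components. -/
noncomputable def pairUnit (g g' : A[X]ˣ) : (A × A)[X]ˣ where
  val := pairPoly g g'
  inv := pairPoly ↑g⁻¹ ↑g'⁻¹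
  val_inv := by
    apply pair_ext <;>
      simp [Polynomial.map_mul, map_fst_pairPoly, map_snd_pairPoly]
  inv_val := by
    apply pair_ext <;>
      simp [Polynomial.map_mul, map_fst_pairPoly, map_snd_pairPoly]

theorem pairUnit_mul (g g' h h' : A[X]ˣ) :
    pairUnit (g * h) (g' * h') = pairUnit g g' * pairUnit h h' := by
  refine Units.ext (pair_ext ?_ ?_)
  · simp [pairUnit, Polynomial.map_mul, map_fst_pairPoly]
  · simp [pairUnit, Polynomial.map_mul, map_snd_pairPoly]

end PairPoly

/-! ### The localization of a form ring -/

section LocForm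

variable {R : Type*} [Ring R] [StarRing R] (m : MaximalSpectrum (Subring.center R))

/-- The self-adjoint denominators. -/
def symSet : Submonoid (Subring.center R) where
  carrier := {s | s ∈ locSet m ∧ centerBar s = s}
  one_mem' := ⟨one_mem _, Subtype.ext (star_one R)⟩
  mul_mem' := fun {a b} ha hb => ⟨mul_mem ha.1 hb.1, by
    rw [show centerBar (a * b) = centerBar a * centerBar b from map_mul (centerBarEquiv R) a b,
      ha.2, hb.2]⟩

theorem centerBar_mul (a b : Subring.center R) : centerBar (a * b) = centerBar a * centerBar b :=
  map_mul (centerBarEquiv R) a b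

theorem centerBar_add (a b : Subring.center R) : centerBar (a + b) = centerBar a + centerBar b :=
  map_add (centerBarEquiv R) a b

theorem centerBar_centerBar (a : Subring.center R) : centerBar (centerBar a) = a :=
  Subtype.ext (star_star _)

theorem center_smul_def (c : Subring.center R) (r : R) : c • r = (c : R) * r := rfl

theorem center_smul_comm (c : Subring.center R) (r : R) : c • r = r * (c : R) :=
  (Subring.mem_center_iff.1 c.2 r).symm

theorem star_center_smul (c : Subring.center R) (r : R) : star (c • r) = centerBar c • star r := by
  rw [center_smul_comm, star_mul]; rfl

variable {m}

theorem norm_mem_symSet {s : Subring.center R} (hs : s ∈ locSet m) : centerBar s * s ∈ symSet m := by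
  refine ⟨mul_mem (locBar m ⟨s, hs⟩).2 hs, ?_⟩
  rw [centerBar_mul, centerBar_centerBar, mul_comm]

variable (m)

theorem toLoc_star (r : R) : toLoc m (star r) = star (toLoc m r) := by
  change _ = locStar m (LocalizedModule.mk r 1)
  rw [locStar_mk, show locBar m 1 = 1 from Subtype.ext (Subtype.ext (star_one R))]
  rfl

theorem star_loc_smul (c : Subring.center R) (x : Loc m) : star (c • x) = centerBar c • star x := by
  rw [loc_smul_def, star_mul, ← toLoc_star, loc_smul_def]
  have := Algebra.commutes (centerBar c) (star x)
  exact this.symm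

theorem smul_loc_injective {s : Subring.center R} (hs : s ∈ locSet m) {x y : Loc m}
    (h : s • x = s • y) : x = y := by
  have h1 : ∀ x : Loc m, LocalizedModule.mk (1 : R) (⟨s, hs⟩ : locSet m) * (s • x) = x := by
    intro x
    have e : (LocalizedModule.mk (1 : R) (⟨s, hs⟩ : locSet m) : Loc m) * (s • 1) = 1 := by
      rw [mul_smul_comm, mul_one, LocalizedModule.smul'_mk]
      exact (LocalizedModule.mk_cancel (⟨s, hs⟩ : locSet m) (1 : R)).trans (map_one (toLoc m))
    have : s • x = (s • 1) * x := by rw [smul_mul_assoc, one_mul]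
    rw [this, ← mul_assoc, e, one_mul]
  rw [← h1 x, h, h1 y]

theorem exists_smul_eq {s : Subring.center R} (hs : s ∈ locSet m) (x : Loc m) :
    ∃ y : Loc m, s • y = x := by
  refine ⟨LocalizedModule.mk (1 : R) (⟨s, hs⟩ : locSet m) * x, ?_⟩
  rw [← smul_mul_assoc, LocalizedModule.smul'_mk]
  have := (LocalizedModule.mk_cancel (⟨s, hs⟩ : locSet m) (1 : R)).trans (map_one (toLoc m))
  exact (congrArg (· * x) this).trans (one_mul x)

theorem exists_smul_eq_zero_of_toLoc {r : R} (hr : toLoc m r = 0) : ∃ s ∈ symSet m, s • r = 0 := by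
  have : (LocalizedModule.mk r 1 : Loc m) = LocalizedModule.mk 0 1 :=
    hr.trans (LocalizedModule.zero_mk 1).symm
  obtain ⟨u, hu⟩ := LocalizedModule.mk_eq.1 this
  refine ⟨centerBar u.1 * u.1, norm_mem_symSet u.2, ?_⟩
  simp only [one_smul, smul_zero] at hu
  rw [mul_smul]
  exact (congrArg (centerBar u.1 • ·) hu).trans (smul_zero _)

theorem exists_sym_smul_eq_toLoc (x : Loc m) : ∃ s ∈ symSet m, ∃ r : R, s • x = toLoc m r := by
  obtain ⟨s, hs, r, hr⟩ := exists_smul_eq_toLoc m x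
  refine ⟨centerBar s * s, norm_mem_symSet hs, centerBar s • r, ?_⟩
  rw [mul_smul, hr, toLoc_smul]

theorem exists_smul_mem_of_mem_locIdeal {J : Ideal R} {x : Loc m} (hx : x ∈ locIdeal m J) :
    ∃ s ∈ symSet m, ∃ r ∈ J, s • x = toLoc m r := by
  obtain ⟨a, ha, s, rfl⟩ := hx
  refine ⟨centerBar s.1 * s.1, norm_mem_symSet s.2, centerBar s.1 • a, J.mul_mem_left _ ha, ?_⟩
  rw [mul_smul, LocalizedModule.smul'_mk, toLoc_smul]
  exact congrArg (centerBar s.1 • ·) (LocalizedModule.mk_cancel s a)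

variable {lam : R} {Λ : AddSubgroup R} (hΛ : IsFormRing lam Λ)

include hΛ

theorem IsFormRing.norm_smul_mem (s : Subring.center R) {a : R} (ha : a ∈ Λ) :
    (centerBar s * s) • a ∈ Λ := by
  have := hΛ.conj_mem (s : R) a ha
  rw [mul_smul, center_smul_comm s]
  change star (s : R) * (a * (s : R)) ∈ Λ
  rwa [← mul_assoc]

theorem mem_locForm_iff {x : Loc m} : x ∈ locForm m hΛ ↔
    ∃ s ∈ locSet m, ∃ a ∈ Λ, (centerBar s * s) • x = toLoc m a := by
  constructor
  · rintro ⟨a, ha, s, rfl⟩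
    refine ⟨s.1, s.2, a, ha, ?_⟩
    rw [LocalizedModule.smul'_mk]
    exact LocalizedModule.mk_cancel (locBar m s * s) a
  · rintro ⟨s, hs, a, ha, e⟩
    refine ⟨a, ha, ⟨s, hs⟩, smul_loc_injective m (norm_mem_symSet hs).1 ?_⟩
    rw [e, LocalizedModule.smul'_mk]
    exact (LocalizedModule.mk_cancel (locBar m ⟨s, hs⟩ * ⟨s, hs⟩) a).symm

theorem toLoc_lam_comm (x : Loc m) : toLoc m lam * x = x * toLoc m lam :=
  Algebra.commutes (⟨lam, hΛ.lam_central⟩ : Subring.center R) x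

theorem isFormRing_loc : IsFormRing (toLoc m lam) (locForm m hΛ) where
  lam_central := Subring.mem_center_iff.2 fun x => (toLoc_lam_comm m hΛ x).symm
  lam_mul_star := by rw [← toLoc_star, ← map_mul, hΛ.lam_mul_star, map_one]
  min_le x := by
    obtain ⟨s, hs, r, hr⟩ := exists_smul_eq_toLoc m x
    rw [mem_locForm_iff]
    refine ⟨s, hs, centerBar s • r - lam * star (centerBar s • r), hΛ.min_le _, ?_⟩
    rw [map_sub, map_mul, toLoc_star, toLoc_smul, ← hr, smul_sub, star_loc_smul,
      star_loc_smul, centerBar_centerBar, mul_smul, mul_smul_comm, mul_smul_comm, smul_smul, smul_smul,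
      mul_comm s]
  le_max x hx := by
    obtain ⟨s, hs, a, ha, e⟩ := (mem_locForm_iff m hΛ).1 hx
    refine smul_loc_injective m (norm_mem_symSet hs).1 ?_
    have e' : (centerBar s * s) • star x = toLoc m (star a) := by
      rw [toLoc_star, ← e, star_loc_smul, (norm_mem_symSet hs).2]
    rw [e, smul_neg, ← mul_smul_comm, e', ← map_mul, ← map_neg, ← hΛ.le_max a ha]
  conj_mem x a ha := by
    obtain ⟨s, hs, l, hl, e⟩ := (mem_locForm_iff m hΛ).1 ha
    obtain ⟨t, ht, r, hr⟩ := exists_smul_eq_toLoc m x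
    rw [mem_locForm_iff]
    refine ⟨t * s, mul_mem ht hs, star r * l * r, hΛ.conj_mem r l hl, ?_⟩
    rw [map_mul, map_mul, toLoc_star, ← hr, ← e, star_loc_smul]
    simp only [smul_mul_assoc, mul_smul_comm, smul_smul]
    congr 1
    rw [centerBar_mul]; ring

/-- Elements of `Λ_𝔪` have square denominators. -/
theorem exists_sq_smul_mem_of_mem_locForm {x : Loc m} (hx : x ∈ locForm m hΛ) :
    ∃ s ∈ symSet m, ∃ a ∈ Λ, s ^ 2 • x = toLoc m a := by
  obtain ⟨s, hs, a, ha, e⟩ := (mem_locForm_iff m hΛ).1 hx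
  refine ⟨centerBar s * s, norm_mem_symSet hs, _, hΛ.norm_smul_mem s ha, ?_⟩
  rw [pow_two, mul_smul, e, toLoc_smul]

theorem exists_sq_smul_mem_of_mem_inf {J : Ideal R} {x : Loc m} (hx : x ∈ locForm m hΛ)
    (hxJ : x ∈ locIdeal m J) :
    ∃ s ∈ symSet m, ∃ a ∈ Λ, a ∈ J ∧ s ^ 2 • x = toLoc m a := by
  obtain ⟨s, hs, a, ha, e⟩ := exists_sq_smul_mem_of_mem_locForm m hΛ hx
  obtain ⟨t, ht, b, hb, e'⟩ := exists_smul_mem_of_mem_locIdeal m hxJ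
  obtain ⟨u, hu, hu0⟩ := exists_smul_eq_zero_of_toLoc m (r := t • a - s ^ 2 • b) (by
    rw [map_sub, toLoc_smul, toLoc_smul, ← e, ← e', smul_smul, smul_smul, mul_comm, sub_self])
  rw [smul_sub, sub_eq_zero, smul_smul, smul_smul] at hu0
  have hut := mul_mem hu ht
  refine ⟨s * (u * t), mul_mem hs hut, (centerBar (u * t) * (u * t)) • a,
    hΛ.norm_smul_mem _ ha, ?_, ?_⟩
  · rw [mul_smul, hu0]
    exact J.mul_mem_left _ (J.mul_mem_left _ hb)
  · rw [hut.2, toLoc_smul, ← e, smul_smul]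
    congr 1; ring

end LocForm

/-! ### The matrix of an endomorphism under a local isometry -/

section EndAlgebra

variable {R : Type*} [Ring R] {W : Type*} [AddCommGroup W] [Module Rᵐᵒᵖ W]

/-- Right multiplication by a central scalar. -/
def centerEnd (R W : Type*) [Ring R] [AddCommGroup W] [Module Rᵐᵒᵖ W] :
    Subring.center R →+* Module.End Rᵐᵒᵖ W where
  toFun s :=
    { toFun := fun x => op (s : R) • x
      map_add' := smul_add _
      map_smul' := fun r x => by
        simp only [RingHom.id_apply, smul_smul]
        congr 1
        refine unop_injective ?_
        simpa using Subring.mem_center_iff.1 s.2 (unop r) }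
  map_one' := LinearMap.ext fun x => by simp
  map_mul' s t := LinearMap.ext fun x => by
    simp only [LinearMap.coe_mk, AddHom.coe_mk, Module.End.mul_apply, smul_smul, ← op_mul]
    congr 2
    exact (Subring.mem_center_iff.1 s.2 (t : R)).symm
  map_zero' := LinearMap.ext fun x => by simp
  map_add' s t := LinearMap.ext fun x => by simp [add_smul]

/-- The endomorphism ring of a right module as an algebra over the center. -/
instance centerEndAlgebra : Algebra (Subring.center R) (Module.End Rᵐᵒᵖ W) :=
  (centerEnd R W).toAlgebra' fun s τ => LinearMap.ext fun x => by
    change op (s : R) • τ x = τ (op (s : R) • x)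
    rw [map_smul]

theorem center_smul_end (s : Subring.center R) (τ : Module.End Rᵐᵒᵖ W) (x : W) :
    (s • τ) x = op (s : R) • τ x := rfl

end EndAlgebra

section LocMatrix

open scoped Matrix

variable {R : Type*} [Ring R] [StarRing R] {m : MaximalSpectrum (Subring.center R)}
  {P : Type*} [AddCommGroup P] [Module Rᵐᵒᵖ P] {f : SesqForm R P} {lam : R} {Λ : AddSubgroup R}
  {hΛ : IsFormRing lam Λ} {ι : Type*} [Fintype ι] [DecidableEq ι] (φ : LocalIsometry f hΛ ι m)

theorem op_toLoc_smul (s : Subring.center R) (y : ι ⊕ ι → Loc m) :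
    op (toLoc m (s : R)) • y = s • y := by
  funext j
  change y j * toLoc m (s : R) = s • y j
  rw [loc_smul_def]
  exact (Algebra.commutes s (y j)).symm

theorem LocalIsometry.map_center_smul (s : Subring.center R) (x : P × R × R) :
    φ.toFun (op (s : R) • x) = s • φ.toFun x := by
  rw [φ.map_smul, op_toLoc_smul]

theorem LocalIsometry.exists_eq_smul (y : ι ⊕ ι → Loc m) :
    ∃ s ∈ symSet m, ∃ x, s • y = φ.toFun x := by
  obtain ⟨x, s, e⟩ := φ.surj y
  rw [op_toLoc_smul] at e
  refine ⟨centerBar s.1 * s.1, norm_mem_symSet s.2, op ((centerBar s.1 : Subring.center R) : R) • x, ?_⟩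
  rw [mul_smul, e, φ.map_center_smul]

theorem smul_vec_injective {s : Subring.center R} (hs : s ∈ locSet m) {x y : ι ⊕ ι → Loc m}
    (h : s • x = s • y) : x = y :=
  funext fun j => smul_loc_injective m hs (congrFun h j)

theorem exists_common_denominator {κ : Type*} [Finite κ] (y : κ → Loc m) :
    ∃ s ∈ symSet m, ∃ r : κ → R, ∀ j, s • y j = toLoc m (r j) := by
  have := Fintype.ofFinite κ
  obtain ⟨s, hs, h⟩ := exists_mem_forall_of_finset (S := symSet m)
    (P := fun (j : κ) s => ∃ r : R, s • y j = toLoc m r)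
    (by rintro j s _ t _ ⟨r, hr⟩; exact ⟨t • r, by rw [mul_smul, hr, toLoc_smul]⟩)
    Finset.univ (fun j _ => exists_sym_smul_eq_toLoc m (y j))
  choose r hr using fun j => h j (Finset.mem_univ j)
  exact ⟨s, hs, r, hr⟩

theorem LocalIsometry.exists_matrix (τ : Module.End Rᵐᵒᵖ (P × R × R)) :
    ∃ M : Matrix (ι ⊕ ι) (ι ⊕ ι) (Loc m), ∀ x, M *ᵥ φ.toFun x = φ.toFun (τ x) := by
  choose s hs x hx using fun j : ι ⊕ ι => φ.exists_eq_smul (Pi.single j 1)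
  have hcol : ∀ j, ∃ c : ι ⊕ ι → Loc m, s j • c = φ.toFun (τ (x j)) := fun j => by
    choose c hc using fun i => exists_smul_eq m (hs j).1 (φ.toFun (τ (x j)) i)
    exact ⟨c, funext hc⟩
  choose c hc using hcol
  refine ⟨Matrix.of fun i j => c j i, fun z => ?_⟩
  set y := φ.toFun z with hy
  choose b hb using fun j => exists_smul_eq m (hs j).1 (y j)
  obtain ⟨w, hw, r, hr⟩ := exists_common_denominator b
  have hwy : ∀ j, w • y j = s j • toLoc m (r j) := fun j => by
    rw [← hb j, ← hr j, smul_smul, smul_smul, mul_comm]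
  have h1 : φ.toFun (op (w : R) • z - ∑ j, op (r j) • x j) = 0 := by
    rw [map_sub, map_sum, φ.map_center_smul, sub_eq_zero]
    funext i
    simp only [Pi.smul_apply, Finset.sum_apply, φ.map_smul, ← hx]
    rw [Finset.sum_eq_single i]
    · rw [← hy, hwy]; simp
    · intro j _ hji; simp [Pi.single_eq_of_ne hji.symm]
    · simp
  obtain ⟨v, hv⟩ := φ.exists_of_eq_zero _ h1
  have h2 : φ.toFun (τ (op (v.1 : R) • (op (w : R) • z - ∑ j, op (r j) • x j))) = 0 := by
    rw [hv, map_zero, map_zero]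
  rw [τ.map_smul, φ.map_center_smul, map_sub, τ.map_smul, map_sum, map_sub, φ.map_center_smul,
    map_sum] at h2
  have h3 := smul_vec_injective v.2 (h2.trans (smul_zero v.1).symm)
  rw [sub_eq_zero] at h3
  refine smul_vec_injective hw.1 ?_
  rw [h3]
  funext i
  simp only [τ.map_smul, φ.map_smul, Finset.sum_apply, Pi.smul_apply, Matrix.mulVec, dotProduct,
    Matrix.of_apply, Finset.smul_sum, ← hc, MulOpposite.smul_eq_mul_unop, unop_op]
  refine Finset.sum_congr rfl fun j _ => ?_
  rw [← mul_smul_comm, hwy, smul_mul_assoc, mul_smul_comm]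

theorem LocalIsometry.matrix_ext {M N : Matrix (ι ⊕ ι) (ι ⊕ ι) (Loc m)}
    (h : ∀ x, M *ᵥ φ.toFun x = N *ᵥ φ.toFun x) : M = N := by
  ext i j
  obtain ⟨s, hs, x, hx⟩ := φ.exists_eq_smul (Pi.single j 1)
  have h1 := h x
  rw [← hx, Matrix.mulVec_smul, Matrix.mulVec_smul] at h1
  have h2 := congrFun (smul_vec_injective hs.1 h1) i
  simpa using h2

/-- The matrix of the localization of an endomorphism. -/
noncomputable def LocalIsometry.matrix : Module.End Rᵐᵒᵖ (P × R × R) →+*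
    Matrix (ι ⊕ ι) (ι ⊕ ι) (Loc m) where
  toFun τ := (φ.exists_matrix τ).choose
  map_one' := φ.matrix_ext fun x => by
    rw [(φ.exists_matrix 1).choose_spec, Matrix.one_mulVec]; rfl
  map_mul' σ τ := φ.matrix_ext fun x => by
    rw [(φ.exists_matrix (σ * τ)).choose_spec, ← Matrix.mulVec_mulVec,
      (φ.exists_matrix τ).choose_spec, (φ.exists_matrix σ).choose_spec]; rfl
  map_zero' := φ.matrix_ext fun x => by
    rw [(φ.exists_matrix 0).choose_spec, Matrix.zero_mulVec]; simp
  map_add' σ τ := φ.matrix_ext fun x => by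
    rw [(φ.exists_matrix (σ + τ)).choose_spec, Matrix.add_mulVec,
      (φ.exists_matrix τ).choose_spec, (φ.exists_matrix σ).choose_spec, LinearMap.add_apply, map_add]

theorem LocalIsometry.matrix_mulVec (τ : Module.End Rᵐᵒᵖ (P × R × R)) (x : P × R × R) :
    φ.matrix τ *ᵥ φ.toFun x = φ.toFun (τ x) := (φ.exists_matrix τ).choose_spec x

theorem LocalIsometry.matrix_eq {τ : Module.End Rᵐᵒᵖ (P × R × R)}
    {M : Matrix (ι ⊕ ι) (ι ⊕ ι) (Loc m)} (h : ∀ x, M *ᵥ φ.toFun x = φ.toFun (τ x)) :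
    φ.matrix τ = M :=
  φ.matrix_ext fun x => by rw [φ.matrix_mulVec, h]

theorem LocalIsometry.matrix_smul (s : Subring.center R) (τ : Module.End Rᵐᵒᵖ (P × R × R)) :
    φ.matrix (s • τ) = s • φ.matrix τ :=
  φ.matrix_eq fun x => by
    rw [Matrix.smul_mulVec, φ.matrix_mulVec, center_smul_end, φ.map_center_smul]

theorem finite_hyp {R P : Type*} [Ring R] [AddCommGroup P] [Module Rᵐᵒᵖ P]
    [Module.Finite Rᵐᵒᵖ P] : Module.Finite Rᵐᵒᵖ (P × R × R) := by
  have : Module.Finite Rᵐᵒᵖ R := by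
    refine ⟨⟨{1}, ?_⟩⟩
    rw [eq_top_iff]
    intro r _
    rw [Finset.coe_singleton, Submodule.mem_span_singleton]
    exact ⟨op r, by simp⟩
  infer_instance

theorem LocalIsometry.exists_smul_eq_zero [Module.Finite Rᵐᵒᵖ P]
    {τ : Module.End Rᵐᵒᵖ (P × R × R)} (h : φ.matrix τ = 0) : ∃ s ∈ symSet m, s • τ = 0 := by
  have := finite_hyp (R := R) (P := P)
  obtain ⟨T, hT⟩ := Module.Finite.fg_top (R := Rᵐᵒᵖ) (M := P × R × R)
  obtain ⟨s, hs, hsT⟩ := exists_mem_forall_of_finset (S := symSet m)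
    (P := fun (x : P × R × R) s => (s • τ) x = 0)
    (fun x s _ t _ h => by rw [mul_smul, center_smul_end, h, smul_zero]) T (fun x _ => by
      have hx : φ.toFun (τ x) = 0 := by rw [← φ.matrix_mulVec, h, Matrix.zero_mulVec]
      obtain ⟨s, hs⟩ := φ.exists_of_eq_zero _ hx
      refine ⟨centerBar s.1 * s.1, norm_mem_symSet s.2, ?_⟩
      rw [mul_smul, center_smul_end, center_smul_end, hs, smul_zero])
  refine ⟨s, hs, LinearMap.ext_on (s := T) ?_ fun x hx => hsT x hx⟩
  rw [hT]

end LocMatrix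

/-! ### Rank-one endomorphisms -/

section RankEnd

variable {R : Type*} [Ring R] [StarRing R] {W : Type*} [AddCommGroup W] [Module Rᵐᵒᵖ W]
  (F : SesqForm R W) (lam : R)

/-- The endomorphism `x ↦ u h(v, x)`. -/
def rankEnd (u v : W) : Module.End Rᵐᵒᵖ W where
  toFun x := op (F.herm lam v x) • u
  map_add' x y := by rw [F.herm_add_right, op_add, add_smul]
  map_smul' r x := by
    have := F.herm_smul_right (lam := lam) (unop r) v x
    rw [op_unop] at this
    rw [this, op_mul, op_unop, mul_smul]; rfl

variable {lam}

theorem rankEnd_apply (u v x : W) : rankEnd F lam u v x = op (F.herm lam v x) • u := rfl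

theorem rankEnd_mul_of_eq_zero {u v u' v' : W} (h : F.herm lam v u' = 0) :
    rankEnd F lam u v * rankEnd F lam u' v' = 0 := LinearMap.ext fun x => by
  rw [Module.End.mul_apply, rankEnd_apply, rankEnd_apply, F.herm_smul_right, h, zero_mul]; simp

variable {V Λ : AddSubgroup R} (h : FormPair lam V Λ)

/-- The operator `x ↦ u h(v c, x) - v c lam̄ h(u, x)` as an additive function of `c`. -/
def alphaEnd (u v : W) : R →+ Module.End Rᵐᵒᵖ W where
  toFun c := rankEnd F lam u (op c • v) - rankEnd F lam (op (c * star lam) • v) u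
  map_zero' := LinearMap.ext fun x => by
    have : F.herm lam 0 x = 0 := by simpa using F.herm_sub_left (lam := lam) 0 0 x
    simp [rankEnd_apply, this]
  map_add' c d := LinearMap.ext fun x => by
    simp only [LinearMap.add_apply, LinearMap.sub_apply, rankEnd_apply, op_add, add_smul,
      F.herm_add_left, add_mul, smul_add]
    abel

theorem alphaEnd_apply (u v : W) (c : R) (x : W) : alphaEnd F (lam := lam) u v c x =
    op (F.herm lam (op c • v) x) • u - op (F.herm lam u x) • op (c * star lam) • v := rfl

/-- The operator `x ↦ - u lam̄ c h(u, x)` as an additive function of `c`. -/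
def betaEnd (u : W) : R →+ Module.End Rᵐᵒᵖ W where
  toFun c := -rankEnd F lam (op (star lam * c) • u) u
  map_zero' := LinearMap.ext fun x => by simp [rankEnd_apply]
  map_add' c d := LinearMap.ext fun x => by
    simp only [LinearMap.add_apply, LinearMap.neg_apply, rankEnd_apply, mul_add, op_add, add_smul,
      smul_add]
    abel

theorem betaEnd_apply (u : W) (c : R) (x : W) : betaEnd F (lam := lam) u c x =
    -(op (F.herm lam u x) • op (star lam * c) • u) := rfl

include h

theorem FormPair.alphaEnd_mul {u v : W} (hu : F.herm lam u u = 0) (hv : F.herm lam v v = 0)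
    (huv : F.herm lam u v = 0) (c d : R) :
    alphaEnd F (lam := lam) u v c * alphaEnd F (lam := lam) u v d = 0 := by
  have hvu : F.herm lam v u = 0 := by rw [h.herm_symm, huv]; simp
  change (rankEnd F lam u (op c • v) - rankEnd F lam (op (c * star lam) • v) u) *
    (rankEnd F lam u (op d • v) - rankEnd F lam (op (d * star lam) • v) u) = 0
  rw [sub_mul, mul_sub, mul_sub, rankEnd_mul_of_eq_zero, rankEnd_mul_of_eq_zero,
    rankEnd_mul_of_eq_zero, rankEnd_mul_of_eq_zero]
  · simp
  · rw [F.herm_smul_right, huv, zero_mul]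
  · exact hu
  · rw [F.herm_smul_right, h.herm_smul_left, hv]; simp
  · rw [h.herm_smul_left, hvu, mul_zero]

theorem FormPair.betaEnd_mul {u : W} (hu : F.herm lam u u = 0) (c d : R) :
    betaEnd F (lam := lam) u c * betaEnd F (lam := lam) u d = 0 := by
  change (-rankEnd F lam (op (star lam * c) • u) u) * (-rankEnd F lam (op (star lam * d) • u) u) = 0
  rw [neg_mul_neg, rankEnd_mul_of_eq_zero]
  rw [F.herm_smul_right, hu, zero_mul]

theorem FormPair.alphaEnd_smul (u v : W) {s : Subring.center R} (hs : centerBar s = s) (c : R) :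
    alphaEnd F (lam := lam) u v (s • c) = s • alphaEnd F (lam := lam) u v c :=
  LinearMap.ext fun x => by
    have hs' : star (s : R) = s := congrArg Subtype.val hs
    rw [center_smul_end, alphaEnd_apply, alphaEnd_apply, smul_sub, h.herm_smul_left,
      h.herm_smul_left, star_center_smul, hs, center_smul_def, center_smul_def]
    congr 1
    · rw [smul_smul, ← op_mul]
      congr 2
      rw [Subring.mem_center_iff.1 s.2, mul_assoc]
    · rw [smul_smul, smul_smul, smul_smul, ← op_mul, ← op_mul, ← op_mul]
      congr 2
      have := Subring.mem_center_iff.1 s.2 (c * star lam * F.herm lam u x)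
      simp only [mul_assoc] at this ⊢
      exact this.symm

omit h in
theorem betaEnd_smul (u : W) (s : Subring.center R) (c : R) :
    betaEnd F (lam := lam) u (s • c) = s • betaEnd F (lam := lam) u c :=
  LinearMap.ext fun x => by
    have e := Subring.mem_center_iff.1 s.2
    rw [center_smul_end, betaEnd_apply, betaEnd_apply, smul_neg, center_smul_comm]
    simp only [smul_smul, ← op_mul]
    congr 3
    rw [← mul_assoc, mul_assoc _ (s : R), ← e]
    simp only [mul_assoc]

end RankEnd

/-! ### Normalized local isometries and the lifts of root elements -/

section Normalize

open scoped Matrix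

variable {R : Type*} [Ring R] [StarRing R] {m : MaximalSpectrum (Subring.center R)}
  {P : Type*} [AddCommGroup P] [Module Rᵐᵒᵖ P] {f : SesqForm R P} {lam : R} {Λ : AddSubgroup R}
  {hΛ : IsFormRing lam Λ} {ι : Type*} [Fintype ι] [DecidableEq ι] (φ : LocalIsometry f hΛ ι m)

/-- The composition of a local isometry with an elementary matrix. -/
def LocalIsometry.conj {g : (Matrix (ι ⊕ ι) (ι ⊕ ι) (Loc m))ˣ}
    (hg : g ∈ stdGrp ι (toLoc m lam) ⊤ (locForm m hΛ)) : LocalIsometry f hΛ ι m where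
  toFun :=
    { toFun := fun x => (g : Matrix (ι ⊕ ι) (ι ⊕ ι) (Loc m)) *ᵥ φ.toFun x
      map_zero' := by rw [map_zero, Matrix.mulVec_zero]
      map_add' := fun x y => by rw [map_add, Matrix.mulVec_add] }
  map_smul x r := by
    change (g : Matrix (ι ⊕ ι) (ι ⊕ ι) (Loc m)) *ᵥ φ.toFun (op r • x) = _
    rw [φ.map_smul, Matrix.mulVec_smul]; rfl
  surj y := by
    obtain ⟨x, s, e⟩ := φ.surj
      (((g⁻¹ : (Matrix (ι ⊕ ι) (ι ⊕ ι) (Loc m))ˣ) : Matrix (ι ⊕ ι) (ι ⊕ ι) (Loc m)) *ᵥ y)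
    refine ⟨x, s, ?_⟩
    change _ = (g : Matrix (ι ⊕ ι) (ι ⊕ ι) (Loc m)) *ᵥ φ.toFun x
    rw [← e, Matrix.mulVec_smul, Matrix.mulVec_mulVec, Units.mul_inv, Matrix.one_mulVec]
  exists_of_eq_zero x hx := by
    refine φ.exists_of_eq_zero x ?_
    have hx' : (g : Matrix (ι ⊕ ι) (ι ⊕ ι) (Loc m)) *ᵥ φ.toFun x = 0 := hx
    have := congrArg (fun y => ((g⁻¹ : (Matrix (ι ⊕ ι) (ι ⊕ ι) (Loc m))ˣ) :
      Matrix (ι ⊕ ι) (ι ⊕ ι) (Loc m)) *ᵥ y) hx'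
    simpa [Matrix.mulVec_mulVec, -Matrix.coe_units_inv] using this
  map_herm x y := by
    rw [← φ.map_herm]
    exact ((FormPair.of_isFormRing (isFormRing_loc m hΛ)).isometry_of_mem_elemGrp rfl hg).1 _ _
  map_quad x := by
    have h1 := ((FormPair.of_isFormRing (isFormRing_loc m hΛ)).isometry_of_mem_elemGrp rfl hg).2
      (φ.toFun x)
    simpa using add_mem h1 (φ.map_quad x)

/-- The basis vectors `(0, 1, 0)` and `(0, 0, 1)` of the hyperbolic plane. -/
def planeVec (R P : Type*) [Ring R] [AddCommGroup P] : ι ⊕ ι → P × R × R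
  | .inl _ => (0, 1, 0)
  | .inr _ => (0, 0, 1)

theorem SesqForm.hyp_apply (x y : P × R × R) : f.hyp x y = f x.1 y.1 + star x.2.1 * y.2.2 := rfl

theorem hyp_planeVec_self (u : ι ⊕ ι) : f.hyp (planeVec R P u) (planeVec R P u) = 0 := by
  cases u <;> simp [SesqForm.hyp_apply, planeVec, f.zero_left]

theorem herm_planeVec (u : ι ⊕ ι) (x : P × R × R) : f.hyp.herm lam (planeVec R P u) x =
    match u with
    | .inl _ => x.2.2
    | .inr _ => lam * x.2.1 := by
  cases u <;> simp [SesqForm.herm, SesqForm.hyp_apply, planeVec, f.zero_left, f.zero_right]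

theorem LocalIsometry.exists_normalized [Module.Finite (Subring.center R) R] {i₀ i₁ : ι}
    (hi : i₀ ≠ i₁) : ∃ g ∈ stdGrp ι (toLoc m lam) ⊤ (locForm m hΛ), ∃ φ' : LocalIsometry f hΛ ι m,
      (∀ x, φ'.toFun x = (g : Matrix (ι ⊕ ι) (ι ⊕ ι) (Loc m)) *ᵥ φ.toFun x) ∧
      ∀ u : ι ⊕ ι, (u = .inl i₀ ∨ u = .inr i₀) → φ'.toFun (planeVec R P u) = Pi.single u 1 := by
  have := isSemisimpleRing_loc_quotient m
  have h := FormPair.of_isFormRing (isFormRing_loc m hΛ)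
  have hq : ∀ u : ι ⊕ ι, stdForm (Loc m) ι (φ.toFun (planeVec R P u)) (φ.toFun (planeVec R P u)) ∈
      locForm m hΛ := fun u => by
    have := φ.map_quad (planeVec R P u)
    rwa [hyp_planeVec_self, map_zero, sub_zero] at this
  obtain ⟨g, hg, h1, h2⟩ := h.exists_hyperbolic_pair rfl hi _ _ (hq (.inl i₀)) (hq (.inr i₀)) (by
    rw [φ.map_herm, herm_planeVec]; simp [planeVec])
  refine ⟨g, hg, φ.conj hg, fun x => rfl, ?_⟩
  rintro u (rfl | rfl)
  · exact h1
  · exact h2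

variable {i₀ : ι} (hφ : ∀ u : ι ⊕ ι, (u = .inl i₀ ∨ u = .inr i₀) →
  φ.toFun (planeVec R P u) = Pi.single u 1)

include hφ

/-- Multiples of the basis vectors outside the hyperbolic plane come from `P`. -/
theorem LocalIsometry.exists_basis_lift : ∃ s ∈ symSet m, ∃ b : ι ⊕ ι → P,
    ∀ q : ι ⊕ ι, q ≠ .inl i₀ → q ≠ .inr i₀ →
      φ.toFun (b q, 0, 0) = s • Pi.single q 1 ∧ f (b q) (b q) ∈ Λ := by
  have hlocal : ∀ q : ι ⊕ ι, ∃ s ∈ symSet m, q ≠ .inl i₀ → q ≠ .inr i₀ → ∃ p : P,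
      φ.toFun (p, 0, 0) = s • Pi.single q 1 ∧ f p p ∈ Λ := by
    intro q
    by_cases hq : q ≠ .inl i₀ ∧ q ≠ .inr i₀
    · obtain ⟨s, hs, x, hx⟩ := φ.exists_eq_smul (Pi.single q 1)
      have hcoord : ∀ u : ι ⊕ ι, (u = .inl i₀ ∨ u = .inr i₀) →
          ∃ t ∈ symSet m, t • f.hyp.herm lam (planeVec R P u) x = 0 := fun u hu => by
        refine exists_smul_eq_zero_of_toLoc m ?_
        have hne : u.swap ≠ q := by
          rcases hu with rfl | rfl
          · exact hq.2.symm
          · exact hq.1.symm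
        rw [← φ.map_herm, hφ u hu, stdForm_herm_single _ _ _ (toLoc_lam_comm m hΛ), ← hx]
        simp [Pi.single_eq_of_ne hne]
      obtain ⟨t₁, ht₁, e₁⟩ := hcoord (.inl i₀) (Or.inl rfl)
      obtain ⟨t₂, ht₂, e₂⟩ := hcoord (.inr i₀) (Or.inr rfl)
      rw [herm_planeVec] at e₁ e₂
      simp only at e₁ e₂
      have e₂' : t₂ • x.2.1 = 0 := by
        have := congrArg (star lam * ·) e₂
        simp only [mul_zero, mul_smul_comm] at this
        rwa [← mul_assoc, (FormPair.of_isFormRing hΛ).star_mul_lam, one_mul] at this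
      set t := t₁ * t₂ with ht
      have hx' : op (t : R) • x = (op (t : R) • x.1, 0, 0) := by
        refine Prod.ext rfl (Prod.ext ?_ ?_)
        · change x.2.1 * (t : R) = 0
          rw [← center_smul_comm, ht, mul_smul, e₂', smul_zero]
        · change x.2.2 * (t : R) = 0
          rw [← center_smul_comm, ht, mul_comm, mul_smul, e₁, smul_zero]
      set p := op (t : R) • x.1 with hp
      have hpφ : φ.toFun (p, 0, 0) = (t * s) • Pi.single q 1 := by
        rw [← hx', φ.map_center_smul, ← hx, ← mul_smul]
      have hpΛ : toLoc m (f p p) ∈ locForm m hΛ := by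
        have := φ.map_quad (p, 0, 0)
        rw [hpφ, ← op_toLoc_smul, op_smul_single, stdForm_single_single, zero_sub] at this
        have := neg_mem this
        rw [neg_neg] at this
        simpa [SesqForm.hyp_apply] using this
      obtain ⟨v, hv, a, ha, e⟩ := exists_sq_smul_mem_of_mem_locForm m hΛ hpΛ
      obtain ⟨w, hw, e'⟩ := exists_smul_eq_zero_of_toLoc m (r := v ^ 2 • f p p - a) (by
        rw [map_sub, toLoc_smul, e, sub_self])
      rw [smul_sub, sub_eq_zero] at e'
      have hwv := mul_mem hw hv
      refine ⟨w * v * (t * s), mul_mem hwv (mul_mem (mul_mem ht₁ ht₂) hs), fun _ _ =>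
        ⟨op ((w * v : Subring.center R) : R) • p, ?_, ?_⟩⟩
      · rw [mul_smul, ← hpφ, ← φ.map_center_smul]
        congr 1
        exact Prod.ext rfl (Prod.ext (zero_mul _).symm (zero_mul _).symm)
      · rw [f.smul_smul, show star ((w * v : Subring.center R) : R) = ((w * v : Subring.center R) : R)
          from congrArg Subtype.val hwv.2, ← center_smul_def, ← center_smul_comm, smul_smul]
        have e'' : (w * v * (w * v)) • f p p = (centerBar w * w) • a := by
          rw [hw.2, mul_smul w w, ← e', smul_smul, smul_smul]
          congr 1; ring
        rw [e'']
        exact hΛ.norm_smul_mem w ha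
    · exact ⟨1, one_mem _, fun h1 h2 => absurd ⟨h1, h2⟩ hq⟩
  obtain ⟨s, hs, h⟩ := exists_mem_forall_of_finset (S := symSet m)
    (P := fun (q : ι ⊕ ι) s => q ≠ .inl i₀ → q ≠ .inr i₀ → ∃ p : P,
      φ.toFun (p, 0, 0) = s • Pi.single q 1 ∧ f p p ∈ Λ) (by
    intro q s hs t ht h h1 h2
    obtain ⟨p, hp, hpΛ⟩ := h h1 h2
    refine ⟨op (t : R) • p, ?_, ?_⟩
    · rw [mul_smul, ← hp, ← φ.map_center_smul]
      congr 1
      exact Prod.ext rfl (Prod.ext (zero_mul _).symm (zero_mul _).symm)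
    · rw [f.smul_smul]
      exact hΛ.conj_mem _ _ hpΛ) Finset.univ (fun q _ => hlocal q)
  refine ⟨s, hs, fun q => if hq : q ≠ .inl i₀ ∧ q ≠ .inr i₀ then
    (h q (Finset.mem_univ q) hq.1 hq.2).choose else 0, fun q h1 h2 => ?_⟩
  dsimp only
  rw [dif_pos (show q ≠ .inl i₀ ∧ q ≠ .inr i₀ from ⟨h1, h2⟩)]
  exact (h q (Finset.mem_univ q) h1 h2).choose_spec

theorem LocalIsometry.liftData {s : Subring.center R} (hs : s ∈ symSet m) {b : ι ⊕ ι → P}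
    (hb : ∀ q : ι ⊕ ι, q ≠ .inl i₀ → q ≠ .inr i₀ →
      φ.toFun (b q, 0, 0) = s • Pi.single q 1 ∧ f (b q) (b q) ∈ Λ) :
    LiftData i₀ s (toLoc m lam) (stdOp (toLoc m lam)) (toLoc m) φ.matrix
      (fun u q => alphaEnd f.hyp (lam := lam) (planeVec R P u) (b q, 0, 0))
      (fun u => betaEnd f.hyp (lam := lam) (planeVec R P u)) := by
  have h := FormPair.of_isFormRing hΛ
  have hl := FormPair.of_isFormRing (isFormRing_loc m hΛ)
  have huu : ∀ u : ι ⊕ ι, f.hyp.herm lam (planeVec R P u) (planeVec R P u) = 0 := fun u => by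
    rw [SesqForm.herm, hyp_planeVec_self]; simp
  have hherm : ∀ u : ι ⊕ ι, (u = .inl i₀ ∨ u = .inr i₀) → ∀ x,
      toLoc m (f.hyp.herm lam (planeVec R P u) x) = mu (toLoc m lam) u * φ.toFun x u.swap :=
    fun u hu x => by
      rw [← φ.map_herm, hφ u hu, stdForm_herm_single _ _ _ hl.comm, star_one, one_mul]
  refine ⟨fun {u q} hu hq hq' c => φ.matrix_eq fun x => ?_, fun {u} hu c => φ.matrix_eq fun x => ?_,
    fun {u q} hu hq hq' c c' => ?_, fun {u} hu c c' => h.betaEnd_mul _ (huu u) c c'⟩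
  · have hq1 : toLoc m (f.hyp.herm lam (op c • (b q, 0, 0)) x) =
        star (toLoc m c) * (s • (mu (toLoc m lam) q * φ.toFun x q.swap)) := by
      rw [h.herm_smul_left, map_mul, toLoc_star, ← φ.map_herm, (hb q hq hq').1,
        ← op_toLoc_smul, hl.herm_smul_left, stdForm_herm_single _ _ _ hl.comm, star_one, one_mul,
        ← toLoc_star m (s : R), show star (s : R) = s from congrArg Subtype.val hs.2, ← loc_smul_def]
    rw [alphaEnd_apply, map_sub, φ.map_smul, φ.map_smul, φ.map_smul, hφ u hu, (hb q hq hq').1, hq1,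
      hherm u hu, xi_apply, Matrix.sub_mulVec, stdOp_mulVec, stdOp_mulVec, star_loc_smul, hs.2,
      op_smul_single, ← Pi.single_smul, op_smul_single, op_smul_single, map_mul, toLoc_star]
    congr 2
    · simp [mul_smul_comm, smul_mul_assoc]
    · simp [mul_smul_comm, smul_mul_assoc, mul_assoc]
  · rw [betaEnd_apply, map_neg, φ.map_smul, φ.map_smul, hφ u hu, hherm u hu, zeta_apply,
      Matrix.neg_mulVec, stdOp_mulVec, op_smul_single, op_smul_single, map_mul, toLoc_star]
    simp [mul_assoc]
  · refine h.alphaEnd_mul _ (huu u) ?_ ?_ c c'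
    · have := h.eq_neg (hb q hq hq').2
      rw [SesqForm.herm]
      simp only [SesqForm.hyp_apply, mul_zero, add_zero]
      nth_rewrite 1 [this]
      simp
    · rw [herm_planeVec]; cases u <;> simp

end Normalize

/-! ### Endomorphisms of `Q[X]` as polynomials with coefficients in the endomorphisms of `Q` -/

section PolyEnd

variable {R : Type*} [Ring R] {P : Type*} [AddCommGroup P]

theorem PolyMod.coeff_mono (i j : ℕ) (p : P) :
    PolyMod.coeff i (PolyMod.mono j p) = if j = i then p else 0 := by
  rw [PolyMod.coeff, PolyMod.coeffs_mono, Finsupp.single_apply]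

theorem PolyMod.coeff_add (i : ℕ) (x y : PolyMod P) :
    PolyMod.coeff i (x + y) = PolyMod.coeff i x + PolyMod.coeff i y := by
  rw [PolyMod.coeff, map_add]; rfl

/-- The element `x Xⁿ` of `Q[X]`. -/
noncomputable def PolyQ.mono (n : ℕ) : P × R × R →+ PolyQ R P where
  toFun x := (PolyMod.mono n x.1, monomial n x.2.1, monomial n x.2.2)
  map_zero' := by simp
  map_add' x y := by simp

theorem PolyQ.mono_apply (n : ℕ) (x : P × R × R) :
    PolyQ.mono n x = (PolyMod.mono n x.1, monomial n x.2.1, monomial n x.2.2) := rfl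

theorem PolyQ.mono_zero (x : P × R × R) : PolyQ.mono 0 x = PolyQ.const x := rfl

/-- The coefficient of `Xⁱ` as an additive map. -/
noncomputable def PolyQ.coeffHom (i : ℕ) : PolyQ R P →+ P × R × R where
  toFun := PolyQ.coeff i
  map_zero' := rfl
  map_add' x y := by
    simp [PolyQ.coeff, PolyMod.coeff_add]

theorem PolyQ.coeffHom_apply (i : ℕ) (z : PolyQ R P) : PolyQ.coeffHom i z = PolyQ.coeff i z := rfl

theorem PolyQ.coeff_mono (i j : ℕ) (x : P × R × R) :
    PolyQ.coeff i (PolyQ.mono j x) = if j = i then x else 0 := by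
  simp only [PolyQ.coeff, PolyQ.mono_apply, PolyMod.coeff_mono, coeff_monomial]
  split_ifs <;> rfl

theorem PolyQ.ext {z w : PolyQ R P} (h : ∀ i, PolyQ.coeff i z = PolyQ.coeff i w) : z = w := by
  refine Prod.ext ?_ (Prod.ext ?_ ?_)
  · exact Finsupp.ext fun i => congrArg Prod.fst (h i)
  · exact Polynomial.ext fun i => congrArg (fun x => x.2.1) (h i)
  · exact Polynomial.ext fun i => congrArg (fun x => x.2.2) (h i)

theorem PolyQ.induction {M : PolyQ R P → Prop} (z : PolyQ R P)
    (hadd : ∀ x y, M x → M y → M (x + y)) (hmono : ∀ i x, M (PolyQ.mono i x)) : M z := by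
  have h0 : M 0 := by simpa using hmono 0 0
  have h1 : M (z.1, 0, 0) := by
    obtain ⟨x, p, q⟩ := z
    induction x using PolyMod.induction with
    | h0 => exact h0
    | hadd x y hx hy => simpa using hadd _ _ hx hy
    | hmono i x => simpa [PolyQ.mono_apply] using hmono i (x, 0, 0)
  have h2 : M (0, z.2.1, 0) := by
    obtain ⟨x, p, q⟩ := z
    induction p using Polynomial.induction_on' with
    | add p q hp hq => simpa using hadd _ _ (hp (by exact h1)) (hq (by exact h1))
    | monomial i a => simpa [PolyQ.mono_apply] using hmono i (0, a, 0)
  have h3 : M (0, 0, z.2.2) := by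
    obtain ⟨x, p, q⟩ := z
    clear h2
    induction q using Polynomial.induction_on' with
    | add p q hp hq => simpa using hadd _ _ (hp (by exact h1)) (hq (by exact h1))
    | monomial i a => simpa [PolyQ.mono_apply] using hmono i (0, 0, a)
  simpa using hadd _ _ (hadd _ _ h1 h2) h3

theorem PolyQ.exists_bound (z : PolyQ R P) : ∃ N, ∀ i, N ≤ i → PolyQ.coeff i z = 0 := by
  induction z using PolyQ.induction with
  | hadd x y hx hy =>
    obtain ⟨N, hN⟩ := hx
    obtain ⟨N', hN'⟩ := hy
    refine ⟨max N N', fun i hi => ?_⟩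
    rw [← PolyQ.coeffHom_apply, map_add, PolyQ.coeffHom_apply, PolyQ.coeffHom_apply,
      hN i (le_trans (le_max_left _ _) hi), hN' i (le_trans (le_max_right _ _) hi), add_zero]
  | hmono j x => exact ⟨j + 1, fun i hi => by rw [PolyQ.coeff_mono, if_neg (by omega)]⟩

/-- Additive maps out of `Q[X]`. -/
noncomputable def PolyQ.lift {M : Type*} [AddCommGroup M] (g : ℕ → P × R × R →+ M) :
    PolyQ R P →+ M :=
  ((Finsupp.liftAddHom fun n => (g n).comp (AddMonoidHom.inl P (R × R))).comp
    (PolyMod.coeffs (P := P)).toAddMonoidHom).coprod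
  ((AddMonoidHom.coprod
    { toFun := fun p => p.sum fun n a => g n (0, a, 0)
      map_zero' := by simp
      map_add' := fun p q => Polynomial.sum_add_index _ _ _ (fun i => by
        rw [show ((0, 0, 0) : P × R × R) = 0 from rfl, map_zero]) (fun i a b => by
        rw [← map_add]; simp) }
    { toFun := fun p => p.sum fun n a => g n (0, 0, a)
      map_zero' := by simp
      map_add' := fun p q => Polynomial.sum_add_index _ _ _ (fun i => by
        rw [show ((0, 0, 0) : P × R × R) = 0 from rfl, map_zero]) (fun i a b => by
        rw [← map_add]; simp) }))

theorem PolyQ.lift_mono {M : Type*} [AddCommGroup M] (g : ℕ → P × R × R →+ M) (n : ℕ)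
    (x : P × R × R) : PolyQ.lift g (PolyQ.mono n x) = g n x := by
  have h0 : ∀ n, g n ((0, 0, 0) : P × R × R) = 0 := fun n => map_zero (g n)
  change Finsupp.liftAddHom (fun n => (g n).comp (AddMonoidHom.inl P (R × R)))
    (Finsupp.single n x.1) + ((monomial n x.2.1).sum (fun n a => g n (0, a, 0)) +
      (monomial n x.2.2).sum (fun n a => g n (0, 0, a))) = _
  rw [Finsupp.liftAddHom_apply_single, sum_monomial_index _ _ (h0 n), sum_monomial_index _ _ (h0 n),
    AddMonoidHom.comp_apply, ← map_add, ← map_add]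
  simp

variable [Module Rᵐᵒᵖ P]

theorem PolyQ.smul_mono (i j : ℕ) (x : P × R × R) (a : R) :
    op (monomial j a) • PolyQ.mono i x = PolyQ.mono (i + j) (op a • x) := by
  refine Prod.ext ?_ (Prod.ext ?_ ?_)
  · exact PolyMod.smul_mono i j x.1 a
  · exact monomial_mul_monomial i j x.2.1 a
  · exact monomial_mul_monomial i j x.2.2 a

/-- The endomorphism `x Xⁱ ↦ e(x) Xⁱ⁺ᵈ` of `Q[X]`. -/
noncomputable def monoEnd (d : ℕ) (e : Module.End Rᵐᵒᵖ (P × R × R)) :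
    Module.End R[X]ᵐᵒᵖ (PolyQ R P) where
  toFun := PolyQ.lift fun n => (PolyQ.mono (n + d)).comp e.toAddMonoidHom
  map_add' := map_add _
  map_smul' r z := by
    obtain ⟨r, rfl⟩ := op_surjective r
    simp only [RingHom.id_apply]
    induction z using PolyQ.induction with
    | hadd x y hx hy => simp only [smul_add, map_add, hx, hy]
    | hmono i x =>
      induction r using Polynomial.induction_on' with
      | add p q hp hq => simp only [op_add, add_smul, map_add, hp, hq]
      | monomial j a =>
        rw [PolyQ.smul_mono, PolyQ.lift_mono, PolyQ.lift_mono]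
        change PolyQ.mono _ (e _) = op (monomial j a) • PolyQ.mono _ (e _)
        rw [PolyQ.smul_mono, map_smul, add_right_comm]

theorem monoEnd_mono (d : ℕ) (e : Module.End Rᵐᵒᵖ (P × R × R)) (i : ℕ) (x : P × R × R) :
    monoEnd d e (PolyQ.mono i x) = PolyQ.mono (i + d) (e x) :=
  PolyQ.lift_mono _ i x

theorem polyEnd_ext {S T : Module.End R[X]ᵐᵒᵖ (PolyQ R P)}
    (h : ∀ i x, S (PolyQ.mono i x) = T (PolyQ.mono i x)) : S = T :=
  LinearMap.ext fun z => by
    induction z using PolyQ.induction with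
    | hadd x y hx hy => rw [map_add, map_add, hx, hy]
    | hmono i x => exact h i x

/-- The endomorphism of `Q[X]` given by a polynomial of endomorphisms of `Q`, as an additive map. -/
noncomputable def polyEndAdd :
    (Module.End Rᵐᵒᵖ (P × R × R))[X] →+ Module.End R[X]ᵐᵒᵖ (PolyQ R P) where
  toFun p := p.sum monoEnd
  map_zero' := by simp
  map_add' p q := Polynomial.sum_add_index _ _ _
    (fun i => polyEnd_ext fun j x => by simp [monoEnd_mono])
    (fun i a b => polyEnd_ext fun j x => by simp [monoEnd_mono])

theorem polyEndAdd_monomial (d : ℕ) (e : Module.End Rᵐᵒᵖ (P × R × R)) :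
    polyEndAdd (monomial d e) = monoEnd d e :=
  sum_monomial_index _ _ (polyEnd_ext fun j x => by simp [monoEnd_mono])

/-- The endomorphism of `Q[X]` given by a polynomial of endomorphisms of `Q`. -/
noncomputable def polyEnd :
    (Module.End Rᵐᵒᵖ (P × R × R))[X] →+* Module.End R[X]ᵐᵒᵖ (PolyQ R P) where
  __ := polyEndAdd
  map_one' := by
    change polyEndAdd (1 : (Module.End Rᵐᵒᵖ (P × R × R))[X]) = 1
    rw [← monomial_zero_one, polyEndAdd_monomial]
    exact polyEnd_ext fun j x => by simp [monoEnd_mono]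
  map_mul' p q := by
    change polyEndAdd (p * q) = polyEndAdd p * polyEndAdd q
    induction p using Polynomial.induction_on' with
    | add p p' hp hp' => rw [add_mul, map_add, hp, hp', map_add, add_mul]
    | monomial n a =>
      induction q using Polynomial.induction_on' with
      | add q q' hq hq' => rw [mul_add, map_add, hq, hq', map_add, mul_add]
      | monomial k b =>
        rw [monomial_mul_monomial, polyEndAdd_monomial, polyEndAdd_monomial, polyEndAdd_monomial]
        refine polyEnd_ext fun j x => ?_
        rw [Module.End.mul_apply, monoEnd_mono, monoEnd_mono, monoEnd_mono, Module.End.mul_apply,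
          add_assoc, add_comm n k]

theorem polyEnd_monomial (d : ℕ) (e : Module.End Rᵐᵒᵖ (P × R × R)) :
    polyEnd (monomial d e) = monoEnd d e := polyEndAdd_monomial d e

theorem coeff_polyEnd (p : (Module.End Rᵐᵒᵖ (P × R × R))[X]) (i : ℕ) (x : P × R × R) :
    PolyQ.coeff i (polyEnd p (PolyQ.const x)) = p.coeff i x := by
  induction p using Polynomial.induction_on' with
  | add p q hp hq =>
    rw [map_add, LinearMap.add_apply, ← PolyQ.coeffHom_apply, map_add, PolyQ.coeffHom_apply,
      PolyQ.coeffHom_apply, hp, hq, coeff_add, LinearMap.add_apply]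
  | monomial n a =>
    rw [polyEnd_monomial, ← PolyQ.mono_zero, monoEnd_mono, PolyQ.coeff_mono, coeff_monomial, zero_add]
    split_ifs <;> rfl

theorem PolyQ.mono_eq_smul_const (i : ℕ) (x : P × R × R) :
    PolyQ.mono i x = op (monomial i (1 : R)) • PolyQ.const x := by
  rw [← PolyQ.mono_zero, PolyQ.smul_mono, zero_add, op_one, one_smul]

theorem polyEnd_ext_const {S T : Module.End R[X]ᵐᵒᵖ (PolyQ R P)}
    (h : ∀ x i, PolyQ.coeff i (S (PolyQ.const x)) = PolyQ.coeff i (T (PolyQ.const x))) : S = T :=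
  polyEnd_ext fun i x => by
    rw [PolyQ.mono_eq_smul_const, map_smul, map_smul, PolyQ.ext (h x)]

theorem polyEnd_injective : Function.Injective (polyEnd (R := R) (P := P)) := fun p q h => by
  refine Polynomial.ext fun i => LinearMap.ext fun x => ?_
  rw [← coeff_polyEnd, h, coeff_polyEnd]

/-- The `i`-th coefficient of an endomorphism of `Q[X]`. -/
noncomputable def coeffEnd (T : Module.End R[X]ᵐᵒᵖ (PolyQ R P)) (i : ℕ) :
    Module.End Rᵐᵒᵖ (P × R × R) where
  toFun x := PolyQ.coeff i (T (PolyQ.const x))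
  map_add' x y := by
    rw [← PolyQ.mono_zero, map_add, map_add, ← PolyQ.coeffHom_apply, map_add]; rfl
  map_smul' r x := by
    obtain ⟨r, rfl⟩ := op_surjective r
    have h1 : PolyQ.const (op r • x) = op (C r) • (PolyQ.const x : PolyQ R P) := by
      rw [← PolyQ.mono_zero, ← monomial_zero_left, ← PolyQ.mono_zero, PolyQ.smul_mono]
    have h2 : ∀ z : PolyQ R P, PolyQ.coeff i (op (C r) • z) = op r • PolyQ.coeff i z := fun z => by
      induction z using PolyQ.induction with
      | hadd x y hx hy =>
        rw [smul_add, ← PolyQ.coeffHom_apply, map_add, PolyQ.coeffHom_apply, PolyQ.coeffHom_apply,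
          hx, hy, ← smul_add]
        rfl
      | hmono j y =>
        rw [← monomial_zero_left, PolyQ.smul_mono, PolyQ.coeff_mono, PolyQ.coeff_mono, add_zero]
        split_ifs <;> simp
    rw [h1, map_smul, h2]; rfl

theorem polyEnd_surjective [Module.Finite Rᵐᵒᵖ P] :
    Function.Surjective (polyEnd (R := R) (P := P)) := fun T => by
  have := finite_hyp (R := R) (P := P)
  obtain ⟨F, hF⟩ := Module.Finite.fg_top (R := Rᵐᵒᵖ) (M := P × R × R)
  choose N hN using fun x => PolyQ.exists_bound (T (PolyQ.const x))
  have hz : ∀ i, F.sup N ≤ i → coeffEnd T i = 0 := fun i hi => by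
    refine LinearMap.ext_on (s := F) (by rw [hF]) fun x hx => ?_
    exact hN x i (le_trans (Finset.le_sup (f := N) hx) hi)
  refine ⟨∑ i ∈ Finset.range (F.sup N), monomial i (coeffEnd T i), polyEnd_ext_const fun x i => ?_⟩
  rw [coeff_polyEnd, finsetSum_coeff]
  simp only [coeff_monomial]
  rw [Finset.sum_ite_eq' (Finset.range (F.sup N)) i]
  split_ifs with h
  · rfl
  · rw [Finset.mem_range, not_lt] at h
    have := congrArg (fun e => e x) (hz i h)
    exact this.symm

end PolyEnd

/-! ### Transvections of `Q[X]` -/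

section PolyTransvection

variable {R : Type*} [Ring R] [StarRing R] {P : Type*} [AddCommGroup P] [Module Rᵐᵒᵖ P]
  {f : SesqForm R P} {lam : R}

theorem hyp_poly_mono (f : SesqForm R P) (i j : ℕ) (x y : P × R × R) :
    f.poly.hyp (PolyQ.mono i x) (PolyQ.mono j y) = monomial (i + j) (f.hyp x y) := by
  rw [SesqForm.hyp_apply, SesqForm.hyp_apply, map_add]
  refine congrArg₂ (· + ·) (polyFormFun_mono f i j x.1 y.1) ?_
  change star (monomial i x.2.1) * monomial j y.2.2 = _
  rw [star_monomial, monomial_mul_monomial]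

theorem herm_poly_mono (f : SesqForm R P) (lam : R) (i j : ℕ) (x y : P × R × R) :
    f.poly.hyp.herm (C lam) (PolyQ.mono i x) (PolyQ.mono j y) =
      monomial (i + j) (f.hyp.herm lam x y) := by
  rw [SesqForm.herm, SesqForm.herm, hyp_poly_mono, hyp_poly_mono, star_monomial, C_mul_monomial,
    map_add, add_comm j i]

theorem polyEnd_alphaEnd (f : SesqForm R P) (lam : R) (u v : P × R × R) (c : R[X]) :
    polyEnd (polyMap (alphaEnd f.hyp (lam := lam) u v) c) =
      alphaEnd f.poly.hyp (lam := C lam) (PolyQ.const u) (PolyQ.const v) c := by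
  induction c using Polynomial.induction_on' with
  | add p q hp hq => simp only [map_add, hp, hq]
  | monomial j a =>
    rw [polyMap_monomial, polyEnd_monomial, ← PolyQ.mono_zero, ← PolyQ.mono_zero]
    refine polyEnd_ext fun i x => ?_
    rw [monoEnd_mono, alphaEnd_apply, alphaEnd_apply, star_C_poly, monomial_mul_C, PolyQ.smul_mono,
      herm_poly_mono, PolyQ.smul_mono, PolyQ.smul_mono, herm_poly_mono, PolyQ.smul_mono, map_sub]
    refine congrArg₂ (· - ·) (congrArg (fun n => PolyQ.mono n _) ?_)
      (congrArg (fun n => PolyQ.mono n _) ?_) <;> omega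

theorem polyEnd_betaEnd (f : SesqForm R P) (lam : R) (u : P × R × R) (c : R[X]) :
    polyEnd (polyMap (betaEnd f.hyp (lam := lam) u) c) =
      betaEnd f.poly.hyp (lam := C lam) (PolyQ.const u) c := by
  induction c using Polynomial.induction_on' with
  | add p q hp hq => simp only [map_add, hp, hq]
  | monomial j a =>
    rw [polyMap_monomial, polyEnd_monomial, ← PolyQ.mono_zero]
    refine polyEnd_ext fun i x => ?_
    rw [monoEnd_mono, betaEnd_apply, betaEnd_apply, star_C_poly, C_mul_monomial, PolyQ.smul_mono,
      herm_poly_mono, PolyQ.smul_mono, map_neg]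
    congr 3
    omega

end PolyTransvection

section Transvection

variable {A : Type*} [Ring A] [StarRing A] {W : Type*} [AddCommGroup W] [Module Aᵐᵒᵖ W]
  (F : SesqForm A W) (lam : A)

theorem one_add_alphaEnd_apply (u v x : W) (c : A) :
    (1 + alphaEnd F (lam := lam) u v c) x = transvection F lam u (op c • v) 0 x := by
  rw [LinearMap.add_apply, alphaEnd_apply, transvection, Module.End.one_apply, smul_smul,
    smul_smul, ← op_mul, ← op_mul, mul_assoc]
  simp [sub_eq_add_neg, add_assoc]

theorem one_add_betaEnd_apply (u x : W) (c : A) :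
    (1 + betaEnd F (lam := lam) u c) x = transvection F lam u 0 c x := by
  have h0 : F.herm lam 0 x = 0 := by simpa using F.herm_sub_left (lam := lam) 0 0 x
  rw [LinearMap.add_apply, betaEnd_apply, transvection, Module.End.one_apply, smul_smul,
    ← op_mul, h0]
  simp [sub_eq_add_neg]

end Transvection

/-- The automorphisms of `Q[X]` as units of the polynomial ring over the endomorphisms of `Q`. -/
noncomputable def polyAut {R P : Type*} [Ring R] [AddCommGroup P] [Module Rᵐᵒᵖ P] :
    (Module.End Rᵐᵒᵖ (P × R × R))[X]ˣ →* (PolyQ R P ≃ₗ[R[X]ᵐᵒᵖ] PolyQ R P) :=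
  (LinearMap.GeneralLinearGroup.generalLinearEquiv R[X]ᵐᵒᵖ (PolyQ R P)).toMonoidHom.comp
    (Units.map (polyEnd : _ →+* _).toMonoidHom)

section PolyAut

variable {R : Type*} [Ring R] {P : Type*} [AddCommGroup P] [Module Rᵐᵒᵖ P]

theorem polyAut_apply (U : (Module.End Rᵐᵒᵖ (P × R × R))[X]ˣ) (z : PolyQ R P) :
    polyAut U z = polyEnd (U : (Module.End Rᵐᵒᵖ (P × R × R))[X]) z := rfl

theorem polyAut_surjective [Module.Finite Rᵐᵒᵖ P] :
    Function.Surjective (polyAut (R := R) (P := P)) := fun σ => by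
  obtain ⟨p, hp⟩ := polyEnd_surjective (R := R) (P := P) σ.toLinearMap
  obtain ⟨q, hq⟩ := polyEnd_surjective (R := R) (P := P) σ.symm.toLinearMap
  refine ⟨⟨p, q, polyEnd_injective ?_, polyEnd_injective ?_⟩, LinearEquiv.ext fun z => ?_⟩
  · rw [map_mul, hp, hq, map_one]
    exact LinearMap.ext fun z => σ.apply_symm_apply z
  · rw [map_mul, hp, hq, map_one]
    exact LinearMap.ext fun z => σ.symm_apply_apply z
  · rw [polyAut_apply]
    exact congrArg (fun e => e z) hp

end PolyAut

section RelET

variable {R : Type*} [Ring R] [StarRing R] {P : Type*} [AddCommGroup P] [Module Rᵐᵒᵖ P]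
  {f : SesqForm R P} {lam : R} {Λ : AddSubgroup R}

theorem conj_by_one {G : Type*} [Group G] (g : G) : g = 1 * g * 1⁻¹ := by simp

theorem conj_mem_relET {J : AddSubgroup R} {g τ : (P × R × R) ≃ₗ[Rᵐᵒᵖ] (P × R × R)}
    (hg : g ∈ ET f lam Λ) (hτ : τ ∈ relET f lam Λ J) : g * τ * g⁻¹ ∈ relET f lam Λ J := by
  suffices relET f lam Λ J ≤ (relET f lam Λ J).comap (MulAut.conj g).toMonoidHom from this hτ
  refine (Subgroup.closure_le _).2 ?_
  rintro _ ⟨g', hg', t, ht, rfl⟩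
  refine Subgroup.subset_closure ⟨g * g', mul_mem hg hg', t, ht, ?_⟩
  change g * (g' * t * g'⁻¹) * g⁻¹ = _
  group

variable {ι : Type*} {i₀ : ι} {b : ι ⊕ ι → P}

theorem const_planeVec (u : ι ⊕ ι) : (PolyQ.const (planeVec R P u) : PolyQ R P) = (0, 1, 0) ∨
    (PolyQ.const (planeVec R P u) : PolyQ R P) = (0, 0, 1) := by
  cases u
  · left; simp [PolyQ.const, planeVec]
  · right; simp [PolyQ.const, planeVec]

theorem isElemTransvection_alpha (hΛ : IsFormRing lam Λ) {J : AddSubgroup R} {u : ι ⊕ ι} {p : P}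
    (hp : f p p ∈ Λ) {c : R[X]} (hc : c ∈ polySubgroup J) {U : (Module.End Rᵐᵒᵖ (P × R × R))[X]ˣ}
    (hU : (U : (Module.End Rᵐᵒᵖ (P × R × R))[X]) =
      1 + polyMap (alphaEnd f.hyp (lam := lam) (planeVec R P u) (p, 0, 0)) c) :
    IsElemTransvection f.poly (C lam) (polySubgroup Λ) (polySubgroup J) (polyAut U) := by
  have h := (FormPair.of_isFormRing hΛ).poly
  refine ⟨_, const_planeVec u, op c • PolyMod.mono 0 p, Submodule.subset_span ⟨c, hc, _, rfl⟩, 0,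
    zero_mem _, ?_, fun x => ?_⟩
  · rw [f.poly.smul_smul, sub_zero]
    refine h.conj_mem (fun n => trivial) ?_
    change polyFormFun f _ _ ∈ _
    rw [polyFormFun_mono]
    exact monomial_mem_polySubgroup hp _
  · rw [polyAut_apply, hU, map_add, map_one, polyEnd_alphaEnd, one_add_alphaEnd_apply]
    congr 1
    simp [PolyQ.const]

theorem isElemTransvection_beta {J : AddSubgroup R} {u : ι ⊕ ι} {c : R[X]}
    (hc : c ∈ polySubgroup J) (hc' : c ∈ polySubgroup Λ)
    {U : (Module.End Rᵐᵒᵖ (P × R × R))[X]ˣ} (hU : (U : (Module.End Rᵐᵒᵖ (P × R × R))[X]) =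
      1 + polyMap (betaEnd f.hyp (lam := lam) (planeVec R P u)) c) :
    IsElemTransvection f.poly (C lam) (polySubgroup Λ) (polySubgroup J) (polyAut U) := by
  refine ⟨_, const_planeVec u, 0, zero_mem _, c, hc, ?_, fun x => ?_⟩
  · rw [f.poly.zero_left, zero_sub]
    exact neg_mem hc'
  · rw [polyAut_apply, hU, map_add, map_one, polyEnd_betaEnd, one_add_betaEnd_apply]
    rfl

theorem map_one_add_polyMap_pair {A 𝓔 : Type*} [Ring A] [Ring 𝓔] {γ : A →+ 𝓔} {c : (A × A)[X]}
    {U : (𝓔 × 𝓔)[X]ˣ} (hγ : ∀ c d, γ c * γ d = 0)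
    (e : (U : (𝓔 × 𝓔)[X]) = 1 + polyMap (pairMap γ) c) :
    ((Units.map (mapRingHom (RingHom.fst 𝓔 𝓔)).toMonoidHom U : 𝓔[X]ˣ) : 𝓔[X]) =
        1 + polyMap γ (c.map (RingHom.fst A A)) ∧
      ((Units.map (mapRingHom (RingHom.snd 𝓔 𝓔)).toMonoidHom U *
        (Units.map (mapRingHom (RingHom.fst 𝓔 𝓔)).toMonoidHom U)⁻¹ : 𝓔[X]ˣ) : 𝓔[X]) =
        1 + polyMap γ (c.map (RingHom.snd A A) - c.map (RingHom.fst A A)) := by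
  have e1 : ((Units.map (mapRingHom (RingHom.fst 𝓔 𝓔)).toMonoidHom U : 𝓔[X]ˣ) : 𝓔[X]) =
      1 + polyMap γ (c.map (RingHom.fst A A)) := by
    change (U : (𝓔 × 𝓔)[X]).map (RingHom.fst 𝓔 𝓔) = _
    rw [e, Polynomial.map_add, Polynomial.map_one]
    congr 1; ext1 n
    simp [coeff_polyMap, pairMap_apply]
  have e2 : ((Units.map (mapRingHom (RingHom.snd 𝓔 𝓔)).toMonoidHom U : 𝓔[X]ˣ) : 𝓔[X]) =
      1 + polyMap γ (c.map (RingHom.snd A A)) := by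
    change (U : (𝓔 × 𝓔)[X]).map (RingHom.snd 𝓔 𝓔) = _
    rw [e, Polynomial.map_add, Polynomial.map_one]
    congr 1; ext1 n
    simp [coeff_polyMap, pairMap_apply]
  refine ⟨e1, ?_⟩
  rw [Units.val_mul, ← Units.eq_mul_inv_iff_mul_eq, inv_inv, e1, e2, add_mul, mul_add, mul_add,
    polyMap_mul_polyMap_eq_zero _ _ hγ, map_sub]
  simp

theorem mem_relET_of_mem_liftGrp (hΛ : IsFormRing lam Λ) (J : Ideal R)
    (hb : ∀ q : ι ⊕ ι, q ≠ .inl i₀ → q ≠ .inr i₀ → f (b q) (b q) ∈ Λ)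
    {U : (Module.End Rᵐᵒᵖ (P × R × R) × Module.End Rᵐᵒᵖ (P × R × R))[X]ˣ}
    (hα : ∀ u q : ι ⊕ ι, (u = .inl i₀ ∨ u = .inr i₀) → q ≠ .inl i₀ → q ≠ .inr i₀ → ∀ c d,
      alphaEnd f.hyp (lam := lam) (planeVec R P u) (b q, 0, 0) c *
        alphaEnd f.hyp (lam := lam) (planeVec R P u) (b q, 0, 0) d = 0)
    (hβ : ∀ u : ι ⊕ ι, (u = .inl i₀ ∨ u = .inr i₀) → ∀ c d,
      betaEnd f.hyp (lam := lam) (planeVec R P u) c *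
        betaEnd f.hyp (lam := lam) (planeVec R P u) d = 0)
    (hU : U ∈ liftGrp i₀
      (fun u q => polyMap (pairMap (alphaEnd f.hyp (lam := lam) (planeVec R P u) (b q, 0, 0))))
      (fun u => polyMap (pairMap (betaEnd f.hyp (lam := lam) (planeVec R P u))))
      (polySubgroup (pairSubring J)) (polySubgroup (pairForm Λ J))) :
    polyAut (Units.map (mapRingHom (RingHom.fst _ _)).toMonoidHom U) ∈
        ET f.poly (C lam) (polySubgroup Λ) ∧
      polyAut (Units.map (mapRingHom (RingHom.snd _ _)).toMonoidHom U) *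
        (polyAut (Units.map (mapRingHom (RingHom.fst _ _)).toMonoidHom U))⁻¹ ∈
          relET f.poly (C lam) (polySubgroup Λ) (polySubgroup J.toAddSubgroup) := by
  induction hU using Subgroup.closure_induction with
  | mem U hU =>
    obtain ⟨u, hu, ⟨q, c, hq, hq', hc, e⟩ | ⟨c, hc, e⟩⟩ := hU
    · obtain ⟨e1, e2⟩ := map_one_add_polyMap_pair (hα u q hu hq hq') e
      refine ⟨Subgroup.subset_closure ?_, Subgroup.subset_closure ⟨1, one_mem _, _, ?_,
        conj_by_one _⟩⟩
      · have := isElemTransvection_alpha hΛ (J := ⊤) (hb q hq hq') (fun n => trivial) e1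
        rwa [show polySubgroup (⊤ : AddSubgroup R) = ⊤ from eq_top_iff.2 fun _ _ _ => trivial] at this
      · rw [← map_inv, ← map_mul]
        exact isElemTransvection_alpha hΛ (hb q hq hq') (fun n => by simpa [mem_pairSubring] using hc n) e2
    · obtain ⟨e1, e2⟩ := map_one_add_polyMap_pair (hβ u hu) e
      refine ⟨Subgroup.subset_closure ?_, Subgroup.subset_closure ⟨1, one_mem _, _, ?_,
        conj_by_one _⟩⟩
      · have := isElemTransvection_beta (J := ⊤) (fun n => trivial)
          (fun n => by simpa using (hc n).1.1) e1
        rwa [show polySubgroup (⊤ : AddSubgroup R) = ⊤ from eq_top_iff.2 fun _ _ _ => trivial] at this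
      · rw [← map_inv, ← map_mul]
        exact isElemTransvection_beta (fun n => by simpa [mem_pairSubring] using (hc n).2)
          (fun n => by simpa using Λ.sub_mem (hc n).1.2 (hc n).1.1) e2
  | one => simp [one_mem]
  | mul x y _ _ hx hy =>
    refine ⟨by rw [map_mul, map_mul]; exact mul_mem hx.1 hy.1, ?_⟩
    have := mul_mem hx.2 (conj_mem_relET hx.1 hy.2)
    simp only [map_mul, mul_inv_rev] at this ⊢
    convert this using 1
    group
  | inv x _ hx =>
    refine ⟨by rw [map_inv, map_inv]; exact inv_mem hx.1, ?_⟩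
    have := inv_mem (conj_mem_relET (inv_mem hx.1) hx.2)
    simp only [map_inv, mul_inv_rev, inv_inv] at this ⊢
    convert this using 1
    group

end RelET

/-! ### Elementary matrices over a polynomial ring -/

section PolyMatrix

variable {A : Type*} [Ring A] {κ : Type*} [Fintype κ] [DecidableEq κ]

/-- The matrix of polynomials that corresponds to a polynomial of matrices. -/
noncomputable def polyMatrix (A κ : Type*) [Ring A] [Fintype κ] [DecidableEq κ] :
    (Matrix κ κ A)[X] →+* Matrix κ κ A[X] :=
  eval₂RingHom' (C : A →+* A[X]).mapMatrix (Matrix.scalar κ X) fun M => by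
    refine (Matrix.scalar_commute _ (fun p => ?_) _).symm
    exact commute_X p

theorem coeff_polyMatrix (p : (Matrix κ κ A)[X]) (i j : κ) (n : ℕ) :
    (polyMatrix A κ p i j).coeff n = p.coeff n i j := by
  induction p using Polynomial.induction_on' with
  | add p q hp hq => rw [map_add, Matrix.add_apply, coeff_add, hp, hq, coeff_add, Matrix.add_apply]
  | monomial d M =>
    have : polyMatrix A κ (monomial d M) i j = C (M i j) * X ^ d := by
      change (eval₂ (C : A →+* A[X]).mapMatrix (Matrix.scalar κ X) (monomial d M)) i j = _
      rw [eval₂_monomial, ← map_pow, ← Matrix.scalar_commute, Matrix.scalar_apply,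
        Matrix.diagonal_mul]
      · simp [X_pow_mul]
      · exact fun p => commute_X_pow p d
    rw [this, coeff_C_mul_X_pow, coeff_monomial]
    by_cases h : n = d
    · simp [h]
    · simp [h, Ne.symm h]

end PolyMatrix

section ElemMatrix

variable {A : Type*} [Ring A] [StarRing A] {ι : Type*} [Fintype ι] [DecidableEq ι] {lam : A}
  {V Λ : AddSubgroup A}

theorem FormPair.elemMatrix_eq (h : FormPair lam V Λ) {J : AddSubgroup A}
    (hJ : ∀ a ∈ J, star a ∈ J) (hJ' : ∀ a ∈ J, lam * a ∈ J) (r : ElemIndex ι) {a : A}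
    (hr : r.Admissible Λ a) (ha : a ∈ J) :
    (∃ p q c, q ≠ p ∧ q ≠ p.swap ∧ c ∈ J ∧ elemMatrix lam r a = 1 + xi lam (stdOp lam) p q c) ∨
      ∃ p c, c ∈ J ∧ c ∈ Λ ∧ elemMatrix lam r a = 1 + zeta lam (stdOp lam) p c := by
  have h1 : ∀ b, b * star lam * lam = b := fun b => by rw [mul_assoc, h.star_mul_lam, mul_one]
  have h2 : ∀ b, lam * b * star lam = b := fun b => by
    rw [h.comm, mul_assoc, h.mul_star, mul_one]
  cases r with
  | qε i j hij =>
    refine Or.inl ⟨.inl i, .inr j, lam * star a, by simp, by simpa using hij.symm,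
      hJ' _ (hJ _ ha), ?_⟩
    simp only [elemMatrix, xi_apply, stdOp_apply, star_mul, star_star, mu, Sum.swap_inl,
      Sum.swap_inr, h1, h2, mul_one, add_sub_assoc]
  | qr i j =>
    by_cases hij : i = j
    · subst hij
      refine Or.inr ⟨.inl i, star a, hJ _ ha, hr rfl, ?_⟩
      have := h.star_mul_eq_neg (h.eq_neg (hr rfl))
      rw [star_star] at this
      simp [elemMatrix, zeta_apply, stdOp_apply, mu, this, ← Matrix.single_neg]
    · refine Or.inl ⟨.inl i, .inl j, star a, by simpa using Ne.symm hij, by simp, hJ _ ha, ?_⟩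
      simp only [elemMatrix, if_neg hij, xi_apply, stdOp_apply, star_star, mu, Sum.swap_inl,
        mul_one, add_sub_assoc, h.star_comm]
  | ql i j =>
    by_cases hij : i = j
    · subst hij
      refine Or.inr ⟨.inr i, -a, neg_mem ha, neg_mem (hr rfl), ?_⟩
      simp [elemMatrix, zeta_apply, stdOp_apply, mu, h.star_comm, h1, ← Matrix.single_neg]
    · refine Or.inl ⟨.inr i, .inr j, lam * star a, by simpa using Ne.symm hij, by simp,
        hJ' _ (hJ _ ha), ?_⟩
      simp only [elemMatrix, if_neg hij, xi_apply, stdOp_apply, star_mul, star_star, mu,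
        Sum.swap_inr, h1, h2, add_sub_assoc]
      rw [h.comm]

theorem polyMatrix_polyOp (lam : A) (p q : ι ⊕ ι) (c : A[X]) :
    polyMatrix A (ι ⊕ ι) (polyOp (stdOp lam) p q c) = stdOp (C lam) p q c := by
  have hmu : mu (C lam) q = C (mu lam q) := by cases q <;> simp [mu]
  ext i j n
  rw [coeff_polyMatrix, polyOp, coeff_polyMap, stdOp_apply, stdOp_apply, Matrix.single_apply,
    Matrix.single_apply, hmu]
  split_ifs <;> simp

end ElemMatrix

/-! ### Pairs of polynomials -/

section PairElem

variable {A B : Type*} [Ring A] [StarRing A] [Ring B] {ι : Type*} [DecidableEq ι] {lam : A}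
  {D : ι ⊕ ι → ι ⊕ ι → A →+ B}

theorem pairPoly_one_add_xi (p q : ι ⊕ ι) (c d : A[X]) :
    pairPoly (1 + xi (C lam) (polyOp D) p q c) (1 + xi (C lam) (polyOp D) p q d) =
      1 + xi (C ((lam, lam) : A × A)) (polyOp fun p q => pairMap (D p q)) p q (pairPoly c d) := by
  ext1 n
  rw [coeff_pairPoly, coeff_add, coeff_add, coeff_add, coeff_xi_polyOp, coeff_xi_polyOp,
    coeff_xi_polyOp, coeff_pairPoly, xi_pair, coeff_one, coeff_one]
  split_ifs <;> rfl

theorem pairPoly_one_add_zeta (p : ι ⊕ ι) (c d : A[X]) :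
    pairPoly (1 + zeta (C lam) (polyOp D) p c) (1 + zeta (C lam) (polyOp D) p d) =
      1 + zeta (C ((lam, lam) : A × A)) (polyOp fun p q => pairMap (D p q)) p (pairPoly c d) := by
  ext1 n
  rw [coeff_pairPoly, coeff_add, coeff_add, coeff_add, coeff_zeta_polyOp, coeff_zeta_polyOp,
    coeff_zeta_polyOp, coeff_pairPoly, zeta_pair, coeff_one, coeff_one]
  split_ifs <;> rfl

theorem pairUnit_one_one : pairUnit (1 : B[X]ˣ) 1 = 1 :=
  Units.ext (pair_ext (by simp [pairUnit, map_fst_pairPoly]) (by simp [pairUnit, map_snd_pairPoly]))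

theorem pairUnit_inv (g g' : B[X]ˣ) : pairUnit g⁻¹ g'⁻¹ = (pairUnit g g')⁻¹ :=
  eq_inv_of_mul_eq_one_left (by rw [← pairUnit_mul]; simp [pairUnit_one_one])

theorem exists_smul_mem_polySubgroup {k : Type*} [CommRing k] [Algebra k A] {H : AddSubgroup A}
    {S : Submonoid k} (e : ℕ) (hH : ∀ s ∈ S, ∀ a ∈ H, s ^ e • a ∈ H) {c : A[X]}
    (hc : ∀ n, ∃ s ∈ S, s ^ e • c.coeff n ∈ H) : ∃ s ∈ S, s ^ e • c ∈ polySubgroup H := by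
  obtain ⟨s, hs, h⟩ := exists_mem_forall_of_finset (S := S)
    (P := fun n s => s ^ e • c.coeff n ∈ H)
    (fun n s _ t ht h => by rw [mul_pow, mul_smul]; exact hH t ht _ h) c.support (fun n _ => hc n)
  refine ⟨s, hs, fun n => ?_⟩
  rw [coeff_smul]
  by_cases hn : n ∈ c.support
  · exact h n hn
  · rw [notMem_support_iff.1 hn, smul_zero]
    exact zero_mem _

end PairElem

/-! ### Localization of the relative elementary group -/

section LocalElem

variable {R : Type*} [Ring R] [StarRing R] (m : MaximalSpectrum (Subring.center R)) {lam : R}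
  {Λ : AddSubgroup R} (hΛ : IsFormRing lam Λ) (J : Ideal R)

/-- The pairs of elements of `R_𝔪` that come from congruent pairs of elements of `R`. -/
noncomputable def locPair : AddSubgroup (Loc m × Loc m) :=
  (pairSubring J).map ((toLoc m).prodMap (toLoc m)).toAddMonoidHom

/-- The pairs of elements of `R_𝔪` that come from congruent pairs of elements of `Λ`. -/
noncomputable def locPairForm (Λ : AddSubgroup R) : AddSubgroup (Loc m × Loc m) :=
  (pairForm Λ J).map ((toLoc m).prodMap (toLoc m)).toAddMonoidHom

include hΛ in
theorem sq_smul_mem_pairForm {s : Subring.center R} (hs : centerBar s = s) {a : R × R}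
    (ha : a ∈ pairForm Λ J) : s ^ 2 • a ∈ pairForm Λ J := by
  have h : ∀ x ∈ Λ, s ^ 2 • x ∈ Λ := fun x hx => by
    have := hΛ.norm_smul_mem s hx
    rwa [hs, ← pow_two] at this
  refine ⟨⟨h _ ha.1.1, h _ ha.1.2⟩, ?_⟩
  have : s ^ 2 • (a.2 - a.1) ∈ J := J.mul_mem_left _ ha.2
  rw [smul_sub] at this
  exact this

theorem smul_mem_pairSubring (s : Subring.center R) {a : R × R} (ha : a ∈ pairSubring J) :
    s • a ∈ pairSubring J := by
  have : s • (a.2 - a.1) ∈ J := J.mul_mem_left _ ha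
  rw [smul_sub] at this
  exact this

theorem smul_mem_locPair (s : Subring.center R) {a : Loc m × Loc m} (ha : a ∈ locPair m J) :
    s • a ∈ locPair m J := by
  obtain ⟨a, ha, rfl⟩ := ha
  exact ⟨s • a, smul_mem_pairSubring J s ha, Prod.ext (toLoc_smul m s _) (toLoc_smul m s _)⟩

include hΛ in
theorem sq_smul_mem_locPairForm {s : Subring.center R} (hs : centerBar s = s) {a : Loc m × Loc m}
    (ha : a ∈ locPairForm m J Λ) : s ^ 2 • a ∈ locPairForm m J Λ := by
  obtain ⟨a, ha, rfl⟩ := ha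
  exact ⟨s ^ 2 • a, sq_smul_mem_pairForm hΛ J hs ha,
    Prod.ext (toLoc_smul m _ _) (toLoc_smul m _ _)⟩

include hΛ in
theorem scalarPair_loc [J.IsTwoSided] (hJ : ∀ a ∈ J, star a ∈ J) :
    ScalarPair ((toLoc m lam, toLoc m lam) : Loc m × Loc m) (locPair m J) (locPairForm m J Λ)
      (symSet m) where
  toFormPair := ((FormPair.of_isFormRing hΛ).pair J hJ).map ((toLoc m).prodMap (toLoc m))
    (fun a => Prod.ext (toLoc_star m _) (toLoc_star m _))
    (fun b => Prod.ext (toLoc_lam_comm m hΛ _) (toLoc_lam_comm m hΛ _))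
  star_smul := fun {s} hs a => Prod.ext
    (by have := star_loc_smul m s a.1; rwa [hs.2] at this)
    (by have := star_loc_smul m s a.2; rwa [hs.2] at this)
  smul_mem := fun {s} _ {a} ha => smul_mem_locPair m J s ha

theorem pairPoly_diag_mem_fracSet (c : (Loc m)[X]) :
    pairPoly c c ∈ fracSet (polySubgroup (locPair m J)) (symSet m) := by
  obtain ⟨s, hs, h⟩ := exists_smul_mem_polySubgroup (S := symSet m) (H := locPair m J)
    (c := pairPoly c c) 1 (fun s _ a ha => smul_mem_locPair m J _ ha) (fun n => by
    obtain ⟨s, hs, r, e⟩ := exists_sym_smul_eq_toLoc m (c.coeff n)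
    rw [coeff_pairPoly]
    refine ⟨s, hs, (r, r), by simp [mem_pairSubring], ?_⟩
    rw [pow_one]
    exact Prod.ext e.symm e.symm)
  exact ⟨s, hs, by rwa [pow_one] at h⟩

theorem pairPoly_zero_mem_fracSet {c : (Loc m)[X]} (hc : c ∈ polySubgroup (locIdeal m J)) :
    pairPoly 0 c ∈ fracSet (polySubgroup (locPair m J)) (symSet m) := by
  obtain ⟨s, hs, h⟩ := exists_smul_mem_polySubgroup (S := symSet m) (H := locPair m J)
    (c := pairPoly 0 c) 1 (fun s _ a ha => smul_mem_locPair m J _ ha) (fun n => by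
    obtain ⟨s, hs, r, hr, e⟩ := exists_smul_mem_of_mem_locIdeal m (hc n)
    rw [coeff_pairPoly]
    refine ⟨s, hs, (0, r), by simpa [mem_pairSubring] using hr, ?_⟩
    rw [pow_one]
    exact Prod.ext (by simp) e.symm)
  exact ⟨s, hs, by rwa [pow_one] at h⟩

theorem pairPoly_eq_neg {lam : Loc m} {c d : (Loc m)[X]} (hc : c = -(C lam * star c))
    (hd : d = -(C lam * star d)) :
    pairPoly c d = -(C ((lam, lam) : Loc m × Loc m) * star (pairPoly c d)) := by
  ext1 n
  have h1 := congrArg (fun p => p.coeff n) hc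
  have h2 := congrArg (fun p => p.coeff n) hd
  simp only [coeff_neg, coeff_C_mul, coeff_star_poly] at h1 h2
  rw [coeff_neg, coeff_C_mul, coeff_star_poly, coeff_pairPoly]
  exact Prod.ext h1 h2

theorem pairPoly_diag_mem_fracForm {c : (Loc m)[X]} (hc : c ∈ polySubgroup (locForm m hΛ)) :
    pairPoly c c ∈ fracForm (C ((toLoc m lam, toLoc m lam) : Loc m × Loc m))
      (polySubgroup (locPairForm m J Λ)) (symSet m) := by
  have hc' := (FormPair.of_isFormRing (isFormRing_loc m hΛ)).poly.eq_neg hc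
  refine ⟨pairPoly_eq_neg m hc' hc', exists_smul_mem_polySubgroup (S := symSet m) 2
    (fun s hs a ha => sq_smul_mem_locPairForm m hΛ J hs.2 ha) fun n => ?_⟩
  obtain ⟨s, hs, a, ha, e⟩ := exists_sq_smul_mem_of_mem_locForm m hΛ (hc n)
  rw [coeff_pairPoly]
  exact ⟨s, hs, (a, a), ⟨⟨ha, ha⟩, by simp [mem_pairSubring]⟩, Prod.ext e.symm e.symm⟩

theorem pairPoly_zero_mem_fracForm {c : (Loc m)[X]} (hc : c ∈ polySubgroup (locForm m hΛ))
    (hcJ : c ∈ polySubgroup (locIdeal m J)) :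
    pairPoly 0 c ∈ fracForm (C ((toLoc m lam, toLoc m lam) : Loc m × Loc m))
      (polySubgroup (locPairForm m J Λ)) (symSet m) := by
  have hc' := (FormPair.of_isFormRing (isFormRing_loc m hΛ)).poly.eq_neg hc
  refine ⟨pairPoly_eq_neg m (by simp) hc', exists_smul_mem_polySubgroup (S := symSet m) 2
    (fun s hs a ha => sq_smul_mem_locPairForm m hΛ J hs.2 ha) fun n => ?_⟩
  obtain ⟨s, hs, a, ha, haJ, e⟩ := exists_sq_smul_mem_of_mem_inf m hΛ (hc n) (hcJ n)
  rw [coeff_pairPoly]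
  exact ⟨s, hs, (0, a), ⟨⟨zero_mem _, ha⟩, by simpa [mem_pairSubring] using haJ⟩,
    Prod.ext (by simp) e.symm⟩

variable {ι : Type*} [Fintype ι] [DecidableEq ι]

/-- The elementary group over `R_𝔪[X] × R_𝔪[X]` whose parameters are fractions of congruent
pairs. -/
noncomputable abbrev locPairGrp (ι : Type*) [Fintype ι] [DecidableEq ι] (lam : R)
    (Λ : AddSubgroup R) : Subgroup (Matrix (ι ⊕ ι) (ι ⊕ ι) (Loc m) ×
      Matrix (ι ⊕ ι) (ι ⊕ ι) (Loc m))[X]ˣ :=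
  elemGrp (C ((toLoc m lam, toLoc m lam) : Loc m × Loc m))
    (polyOp fun p q => pairMap (stdOp (toLoc m lam) p q))
    (fracSet (polySubgroup (locPair m J)) (symSet m))
    (fracForm (C ((toLoc m lam, toLoc m lam) : Loc m × Loc m))
      (polySubgroup (locPairForm m J Λ)) (symSet m))

theorem star_mem_polySubgroup {A : Type*} [Ring A] [StarRing A] {H : AddSubgroup A}
    (hH : ∀ a ∈ H, star a ∈ H) {c : A[X]} (hc : c ∈ polySubgroup H) : star c ∈ polySubgroup H :=
  fun n => by rw [coeff_star_poly]; exact hH _ (hc n)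

theorem exists_polyMatrix_eq_elemMatrix (r : ElemIndex ι) {a : (Loc m)[X]}
    (hr : r.Admissible (polySubgroup (locForm m hΛ)) a) :
    ∃ Y : (Matrix (ι ⊕ ι) (ι ⊕ ι) (Loc m))[X]ˣ,
      polyMatrix (Loc m) (ι ⊕ ι) Y = elemMatrix (C (toLoc m lam)) r a ∧
        pairUnit Y Y ∈ locPairGrp m J ι lam Λ := by
  have h := (FormPair.of_isFormRing (isFormRing_loc m hΛ)).poly
  rcases h.elemMatrix_eq (J := ⊤) (fun _ _ => trivial) (fun _ _ => trivial) r hr trivial with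
    ⟨p, q, c, h₁, h₂, -, e⟩ | ⟨p, c, -, hc, e⟩
  · refine ⟨rankOne_stdOp.poly.xiUnit h₁ h₂ c, ?_, Subgroup.subset_closure (Or.inl
      ⟨p, q, pairPoly c c, h₁, h₂, pairPoly_diag_mem_fracSet m J c, pairPoly_one_add_xi p q c c⟩)⟩
    rw [e]
    change polyMatrix _ _ (1 + _) = _
    rw [map_add, map_one, xi_apply, xi_apply, map_sub, polyMatrix_polyOp, polyMatrix_polyOp]
  · refine ⟨rankOne_stdOp.poly.zetaUnit p c, ?_, Subgroup.subset_closure (Or.inr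
      ⟨p, pairPoly c c, pairPoly_diag_mem_fracForm m hΛ J hc, pairPoly_one_add_zeta p c c⟩)⟩
    rw [e]
    change polyMatrix _ _ (1 + _) = _
    rw [map_add, map_one, zeta_apply, zeta_apply, map_neg, polyMatrix_polyOp]

theorem star_mem_locIdeal (hJ : ∀ a ∈ J, star a ∈ J) {x : Loc m} (hx : x ∈ locIdeal m J) :
    star x ∈ locIdeal m J := by
  obtain ⟨a, ha, s, rfl⟩ := hx
  exact ⟨star a, hJ a ha, locBar m s, locStar_mk m a s⟩

theorem mul_mem_locIdeal (y : Loc m) {x : Loc m} (hx : x ∈ locIdeal m J) :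
    y * x ∈ locIdeal m J := by
  obtain ⟨a, ha, s, rfl⟩ := hx
  induction y using LocalizedModule.induction_on with
  | h r t => exact ⟨r * a, J.mul_mem_left r ha, t * s, LocalizedModule.mk_mul_mk⟩

theorem exists_polyMatrix_eq_elemMatrix_rel (hJ : ∀ a ∈ J, star a ∈ J) (r : ElemIndex ι)
    {a : (Loc m)[X]} (hr : r.Admissible (polySubgroup (locForm m hΛ)) a)
    (ha : a ∈ polySubgroup (locIdeal m J)) :
    ∃ Y : (Matrix (ι ⊕ ι) (ι ⊕ ι) (Loc m))[X]ˣ,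
      polyMatrix (Loc m) (ι ⊕ ι) Y = elemMatrix (C (toLoc m lam)) r a ∧
        pairUnit 1 Y ∈ locPairGrp m J ι lam Λ := by
  have h := (FormPair.of_isFormRing (isFormRing_loc m hΛ)).poly
  rcases h.elemMatrix_eq (J := polySubgroup (locIdeal m J))
    (fun _ => star_mem_polySubgroup fun _ => star_mem_locIdeal m J hJ)
    (fun c hc n => by rw [coeff_C_mul]; exact mul_mem_locIdeal m J _ (hc n)) r hr ha with
    ⟨p, q, c, h₁, h₂, hc, e⟩ | ⟨p, c, hcJ, hc, e⟩
  · have e' : pairPoly 1 (1 + xi (C (toLoc m lam)) (polyOp (stdOp (toLoc m lam))) p q c) =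
        1 + xi (C ((toLoc m lam, toLoc m lam) : Loc m × Loc m))
          (polyOp fun p q => pairMap (stdOp (toLoc m lam) p q)) p q (pairPoly 0 c) := by
      rw [← pairPoly_one_add_xi, map_zero, add_zero]
    refine ⟨rankOne_stdOp.poly.xiUnit h₁ h₂ c, ?_, Subgroup.subset_closure (Or.inl
      ⟨p, q, pairPoly 0 c, h₁, h₂, pairPoly_zero_mem_fracSet m J hc, e'⟩)⟩
    rw [e]
    change polyMatrix _ _ (1 + _) = _
    rw [map_add, map_one, xi_apply, xi_apply, map_sub, polyMatrix_polyOp, polyMatrix_polyOp]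
  · have e' : pairPoly 1 (1 + zeta (C (toLoc m lam)) (polyOp (stdOp (toLoc m lam))) p c) =
        1 + zeta (C ((toLoc m lam, toLoc m lam) : Loc m × Loc m))
          (polyOp fun p q => pairMap (stdOp (toLoc m lam) p q)) p (pairPoly 0 c) := by
      rw [← pairPoly_one_add_zeta, map_zero, add_zero]
    refine ⟨rankOne_stdOp.poly.zetaUnit p c, ?_, Subgroup.subset_closure (Or.inr
      ⟨p, pairPoly 0 c, pairPoly_zero_mem_fracForm m hΛ J hc hcJ, e'⟩)⟩
    rw [e]
    change polyMatrix _ _ (1 + _) = _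
    rw [map_add, map_one, zeta_apply, zeta_apply, map_neg, polyMatrix_polyOp]

theorem exists_polyMatrix_eq_of_mem_relEQ (hJ : ∀ a ∈ J, star a ∈ J)
    {M : (Matrix (ι ⊕ ι) (ι ⊕ ι) (Loc m)[X])ˣ}
    (hM : M ∈ relEQ ι (C (toLoc m lam)) (polySubgroup (locForm m hΛ))
      (polySubgroup (locIdeal m J))) :
    ∃ N : (Matrix (ι ⊕ ι) (ι ⊕ ι) (Loc m))[X]ˣ,
      Units.map (polyMatrix (Loc m) (ι ⊕ ι)).toMonoidHom N = M ∧
        pairUnit 1 N ∈ locPairGrp m J ι lam Λ := by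
  induction hM using Subgroup.closure_induction with
  | mem g hg =>
    obtain ⟨r, x, a, hx, ha, haJ, y, z, hy, hz, rfl⟩ := hg
    obtain ⟨Y, eY, hY⟩ := exists_polyMatrix_eq_elemMatrix m hΛ J r hx
    obtain ⟨Z, eZ, hZ⟩ := exists_polyMatrix_eq_elemMatrix_rel m hΛ J hJ r.opp ha haJ
    refine ⟨Y * Z * Y⁻¹, ?_, ?_⟩
    · rw [map_mul, map_mul, map_inv]
      rw [show Units.map (polyMatrix (Loc m) (ι ⊕ ι)).toMonoidHom Y = y from
        Units.ext (eY.trans hy.symm), show Units.map (polyMatrix (Loc m) (ι ⊕ ι)).toMonoidHom Z = z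
        from Units.ext (eZ.trans hz.symm)]
    · have := mul_mem (mul_mem hY hZ) (inv_mem hY)
      rwa [← pairUnit_inv, ← pairUnit_mul, ← pairUnit_mul, mul_one, mul_inv_cancel] at this
  | one => exact ⟨1, map_one _, by rw [pairUnit_one_one]; exact one_mem _⟩
  | mul x y _ _ hx hy =>
    obtain ⟨N, e, hN⟩ := hx
    obtain ⟨N', e', hN'⟩ := hy
    refine ⟨N * N', by rw [map_mul, e, e'], ?_⟩
    have := mul_mem hN hN'
    rwa [← pairUnit_mul, mul_one] at this
  | inv x _ hx =>
    obtain ⟨N, e, hN⟩ := hx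
    refine ⟨N⁻¹, by rw [map_inv, e], ?_⟩
    have := inv_mem hN
    rwa [← pairUnit_inv, inv_one] at this

end LocalElem

/-! ### Patching -/

section Patching

variable {R : Type*} [Ring R] [StarRing R]

/-- The self-adjoint central elements that preserve `Λ`. -/
def formScalars (Λ : AddSubgroup R) : Subring (Subring.center R) where
  carrier := {y | centerBar y = y ∧ ∀ a ∈ Λ, y • a ∈ Λ}
  one_mem' := ⟨Subtype.ext (star_one R), fun a ha => by rwa [one_smul]⟩
  zero_mem' := ⟨Subtype.ext (star_zero R), fun a ha => by rw [zero_smul]; exact zero_mem _⟩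
  mul_mem' := fun {y z} hy hz => ⟨by rw [centerBar_mul, hy.1, hz.1], fun a ha => by
    rw [mul_smul]; exact hy.2 _ (hz.2 _ ha)⟩
  add_mem' := fun {y z} hy hz => ⟨by rw [centerBar_add, hy.1, hz.1], fun a ha => by
    rw [add_smul]; exact add_mem (hy.2 _ ha) (hz.2 _ ha)⟩
  neg_mem' := fun {y} hy => ⟨by
    rw [show centerBar (-y) = -centerBar y from Subtype.ext (star_neg (y : R)), hy.1], fun a ha => by
    rw [neg_smul]; exact neg_mem (hy.2 _ ha)⟩

variable {lam : R} {Λ : AddSubgroup R} (hΛ : IsFormRing lam Λ)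

include hΛ

theorem norm_mem_formScalars (x : Subring.center R) : centerBar x * x ∈ formScalars Λ :=
  ⟨by rw [centerBar_mul, centerBar_centerBar, mul_comm], fun _ ha => hΛ.norm_smul_mem x ha⟩

theorem trace_mem_formScalars (x : Subring.center R) : x + centerBar x ∈ formScalars Λ := by
  refine ⟨by rw [centerBar_add, centerBar_centerBar, add_comm], fun a ha => ?_⟩
  have h1 := hΛ.min_le (x • a)
  have h2 : lam * star a = -a := by
    rw [eq_neg_iff_add_eq_zero, add_comm, ← eq_neg_iff_add_eq_zero]; exact hΛ.le_max a ha
  rw [star_center_smul, mul_smul_comm, h2, smul_neg, sub_neg_eq_add] at h1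
  rwa [add_smul]

theorem sq_mem_formScalars {s : Subring.center R} (hs : centerBar s = s) :
    s ^ 2 ∈ formScalars Λ := by
  have := norm_mem_formScalars hΛ s
  rwa [hs, ← pow_two] at this

/-- If the increments of `θ` with steps in a neighbourhood of zero for every maximal ideal lie in
`K`, then so does the increment from `0` to `1`. -/
theorem increment_mem_of_local {G : Type*} [Group G] (K : Subgroup G) (θ : Subring.center R → G)
    (h : ∀ m : MaximalSpectrum (Subring.center R), ∃ t ∈ symSet m, ∀ y ∈ formScalars Λ,
      ∀ z ∈ formScalars Λ, θ (y + t ^ 2 * z) * (θ y)⁻¹ ∈ K) : θ 1 * (θ 0)⁻¹ ∈ K := by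
  choose t ht hK using h
  set H : Set (Subring.center R) :=
    {z | z ∈ formScalars Λ ∧ ∀ y ∈ formScalars Λ, θ (y + z) * (θ y)⁻¹ ∈ K} with hH
  have h0 : 0 ∈ H := ⟨zero_mem _, fun y _ => by simp [one_mem]⟩
  have hadd : ∀ {z z'}, z ∈ H → z' ∈ H → z + z' ∈ H := fun {z z'} hz hz' =>
    ⟨add_mem hz.1 hz'.1, fun y hy => by
      have := mul_mem (hz'.2 (y + z) (add_mem hy hz.1)) (hz.2 y hy)
      rwa [← mul_assoc, inv_mul_cancel_right, add_assoc] at this⟩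
  have hgen : ∀ m, ∀ z ∈ formScalars Λ, t m ^ 2 * z ∈ H := fun m z hz =>
    ⟨mul_mem (sq_mem_formScalars hΛ (ht m).2) hz, fun y hy => hK m y hy z hz⟩
  have hspan : Ideal.span (Set.range fun m => t m ^ 2) = ⊤ := by
    by_contra hne
    obtain ⟨M, hM, hle⟩ := Ideal.exists_le_maximal _ hne
    have h1 : t ⟨M, hM⟩ ^ 2 ∈ M := hle (Ideal.subset_span ⟨⟨M, hM⟩, rfl⟩)
    exact (ht ⟨M, hM⟩).1.1 (hM.isPrime.mem_of_pow_mem _ h1)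
  have key : ∀ x ∈ Ideal.span (Set.range fun m => t m ^ 2),
      (∀ w, centerBar (x * w) * (x * w) ∈ H) ∧ ∀ w, x * w + centerBar (x * w) ∈ H := by
    intro x hx
    induction hx using Submodule.span_induction with
    | mem x hx =>
      obtain ⟨m, rfl⟩ := hx
      have hb : centerBar (t m ^ 2) = t m ^ 2 := (sq_mem_formScalars hΛ (ht m).2).1
      refine ⟨fun w => ?_, fun w => ?_⟩
      · have := hgen m _ (mul_mem (sq_mem_formScalars hΛ (ht m).2) (norm_mem_formScalars hΛ w))
        simp only [centerBar_mul, hb]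
        convert this using 1; ring
      · have := hgen m _ (trace_mem_formScalars hΛ w)
        simp only [centerBar_mul, hb]
        convert this using 1; ring
    | zero =>
      have hb : centerBar (0 : Subring.center R) = 0 := Subtype.ext (star_zero R)
      simp [hb, h0]
    | add x y _ _ hx hy =>
      refine ⟨fun w => ?_, fun w => ?_⟩
      · have := hadd (hadd (hx.1 w) (hy.1 w)) (hy.2 (w * centerBar (x * w)))
        convert this using 1
        simp only [add_mul, centerBar_add, centerBar_mul, centerBar_centerBar]; ring
      · have := hadd (hx.2 w) (hy.2 w)
        convert this using 1
        simp only [add_mul, centerBar_add]; ring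
    | smul r x _ hx =>
      refine ⟨fun w => ?_, fun w => ?_⟩
      · have := hx.1 (r * w)
        rwa [← mul_assoc x r, mul_comm x r] at this
      · have := hx.2 (r * w)
        rwa [← mul_assoc x r, mul_comm x r] at this
  have h1 := (key 1 (by rw [hspan]; trivial)).1 1
  have hb : centerBar (1 : Subring.center R) = 1 := Subtype.ext (star_one R)
  rw [mul_one, hb, mul_one] at h1
  simpa using h1.2 0 (zero_mem _)

end Patching

/-! ### The local increments -/

section ScalePair

variable {k : Type*} [CommRing k] {𝓔 : Type*} [Ring 𝓔] [Algebra k 𝓔]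

theorem map_fst_scaleX_pairUnit (w : k) (T : 𝓔[X]ˣ) :
    Units.map (mapRingHom (RingHom.fst 𝓔 𝓔)).toMonoidHom
      (Units.map (scaleX (𝓔 × 𝓔) w).toMonoidHom (pairUnit 1 T)) = 1 := by
  refine Units.ext (Polynomial.ext fun n => ?_)
  change ((scaleX _ w (pairPoly 1 (T : 𝓔[X]))).map (RingHom.fst 𝓔 𝓔)).coeff n = (1 : 𝓔[X]).coeff n
  rw [coeff_map, coeff_scaleX, coeff_pairPoly]
  change w ^ n • (1 : 𝓔[X]).coeff n = _
  rw [coeff_one]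
  split_ifs with h0 <;> simp [h0]

theorem map_snd_scaleX_pairUnit (w : k) (T : 𝓔[X]ˣ) :
    Units.map (mapRingHom (RingHom.snd 𝓔 𝓔)).toMonoidHom
      (Units.map (scaleX (𝓔 × 𝓔) w).toMonoidHom (pairUnit 1 T)) =
        Units.map (scaleX 𝓔 w).toMonoidHom T := by
  refine Units.ext (Polynomial.ext fun n => ?_)
  change ((scaleX _ w (pairPoly 1 (T : 𝓔[X]))).map (RingHom.snd 𝓔 𝓔)).coeff n =
    (scaleX 𝓔 w (T : 𝓔[X])).coeff n
  rw [coeff_map, coeff_scaleX, coeff_scaleX, coeff_pairPoly]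
  rfl

end ScalePair

section LocalIncrement

open scoped Matrix

variable {R : Type*} [Ring R] [StarRing R] {m : MaximalSpectrum (Subring.center R)}
  {P : Type*} [AddCommGroup P] [Module Rᵐᵒᵖ P] {f : SesqForm R P} {lam : R} {Λ : AddSubgroup R}
  {hΛ : IsFormRing lam Λ} {ι : Type*} [Fintype ι] [DecidableEq ι] (φ : LocalIsometry f hΛ ι m)

theorem LocalIsometry.map_matrix_eq {T : (Module.End Rᵐᵒᵖ (P × R × R))[X]ˣ}
    {N : (Matrix (ι ⊕ ι) (ι ⊕ ι) (Loc m))[X]ˣ}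
    (h : IsLocalMatrix φ (polyAut T) (polyMatrix (Loc m) (ι ⊕ ι) N)) :
    Units.map (mapRingHom φ.matrix).toMonoidHom T = N := by
  refine Units.ext (Polynomial.ext fun n => ?_)
  change ((T : (Module.End Rᵐᵒᵖ (P × R × R))[X]).map φ.matrix).coeff n = _
  rw [coeff_map]
  refine φ.matrix_eq fun x => funext fun k => ?_
  have := h x n k
  rw [polyAut_apply, coeff_polyEnd] at this
  rw [← this, Matrix.mulVec, Matrix.mulVec, dotProduct, dotProduct, finsetSum_coeff]
  refine Finset.sum_congr rfl fun j _ => ?_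
  rw [coeff_mul_C, coeff_polyMatrix]

theorem LocalIsometry.map_matrix_conj {φ' : LocalIsometry f hΛ ι m}
    {g : (Matrix (ι ⊕ ι) (ι ⊕ ι) (Loc m))ˣ}
    (h : ∀ x, φ'.toFun x = (g : Matrix (ι ⊕ ι) (ι ⊕ ι) (Loc m)) *ᵥ φ.toFun x)
    (T : (Module.End Rᵐᵒᵖ (P × R × R))[X]ˣ) :
    Units.map (mapRingHom φ'.matrix).toMonoidHom T =
      Units.map (C : _ →+* (Matrix (ι ⊕ ι) (ι ⊕ ι) (Loc m))[X]).toMonoidHom g *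
        Units.map (mapRingHom φ.matrix).toMonoidHom T *
        (Units.map (C : _ →+* (Matrix (ι ⊕ ι) (ι ⊕ ι) (Loc m))[X]).toMonoidHom g)⁻¹ := by
  rw [eq_mul_inv_iff_mul_eq]
  refine Units.ext (Polynomial.ext fun n => ?_)
  change ((T : (Module.End Rᵐᵒᵖ (P × R × R))[X]).map φ'.matrix * C g.1).coeff n =
    (C g.1 * (T : (Module.End Rᵐᵒᵖ (P × R × R))[X]).map φ.matrix).coeff n
  rw [coeff_mul_C, coeff_C_mul, coeff_map, coeff_map]
  refine φ.matrix_ext fun x => ?_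
  rw [← Matrix.mulVec_mulVec, ← Matrix.mulVec_mulVec, ← h, φ'.matrix_mulVec, φ.matrix_mulVec, h]

theorem pairPoly_C {A : Type*} [Ring A] (a : A) : pairPoly (C a) (C a) = C (a, a) := by
  ext1 n
  rw [coeff_pairPoly, coeff_C, coeff_C]
  split_ifs <;> rfl

theorem pairUnit_C_mem_locPairGrp (J : Ideal R) {g : (Matrix (ι ⊕ ι) (ι ⊕ ι) (Loc m))ˣ}
    (hg : g ∈ stdGrp ι (toLoc m lam) ⊤ (locForm m hΛ)) :
    pairUnit (Units.map (C : _ →+* (Matrix (ι ⊕ ι) (ι ⊕ ι) (Loc m))[X]).toMonoidHom g)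
      (Units.map (C : _ →+* (Matrix (ι ⊕ ι) (ι ⊕ ι) (Loc m))[X]).toMonoidHom g) ∈
        locPairGrp m J ι lam Λ := by
  have := map_mem_elemGrp (V' := fracSet (polySubgroup (locPair m J)) (symSet m))
    (Λ' := fracForm (C ((toLoc m lam, toLoc m lam) : Loc m × Loc m))
      (polySubgroup (locPairForm m J Λ)) (symSet m))
    (D' := polyOp fun p q => pairMap (stdOp (toLoc m lam) p q))
    (lam' := C ((toLoc m lam, toLoc m lam) : Loc m × Loc m))
    ((C : _ →+* (Matrix (ι ⊕ ι) (ι ⊕ ι) (Loc m) × Matrix (ι ⊕ ι) (ι ⊕ ι) (Loc m))[X]).comp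
      ((RingHom.id _).prod (RingHom.id _)))
    ((C : _ →+* (Loc m × Loc m)[X]).comp ((RingHom.id _).prod (RingHom.id _)))
    (fun p q c => (polyMap_C (pairMap (stdOp (toLoc m lam) p q)) (c, c)).symm)
    (fun c => (star_C_poly ((c, c) : Loc m × Loc m)).symm) rfl
    (fun c _ => by
      have := pairPoly_diag_mem_fracSet m J (C c)
      rwa [pairPoly_C] at this)
    (fun c hc => by
      have := pairPoly_diag_mem_fracForm m hΛ J (C_mem_polySubgroup hc)
      rwa [pairPoly_C] at this) hg
  convert this using 1
  exact Units.ext (pairPoly_C _)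

theorem LocalIsometry.exists_increment_mem [Module.Finite (Subring.center R) R]
    [Module.Finite Rᵐᵒᵖ P] (J : Ideal R) [J.IsTwoSided] (hJ : ∀ a ∈ J, star a ∈ J)
    (hι : ∀ p q : ι ⊕ ι, ∃ w, w ≠ p ∧ w ≠ p.swap ∧ w ≠ q ∧ w ≠ q.swap) {i₀ i₁ : ι} (hi : i₀ ≠ i₁)
    {T : (Module.End Rᵐᵒᵖ (P × R × R))[X]ˣ} {M : (Matrix (ι ⊕ ι) (ι ⊕ ι) (Loc m)[X])ˣ}
    (hM : M ∈ relEQ ι (C (toLoc m lam)) (polySubgroup (locForm m hΛ))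
      (polySubgroup (locIdeal m J))) (hloc : IsLocalMatrix φ (polyAut T) M) :
    ∃ t ∈ symSet m, ∀ y ∈ formScalars Λ, ∀ z ∈ formScalars Λ,
      polyAut (Units.map (scaleX _ (y + t ^ 2 * z)).toMonoidHom T) *
        (polyAut (Units.map (scaleX _ y).toMonoidHom T))⁻¹ ∈
          relET f.poly (C lam) (polySubgroup Λ) (polySubgroup J.toAddSubgroup) := by
  obtain ⟨N, rfl, hN⟩ := exists_polyMatrix_eq_of_mem_relEQ m hΛ J hJ hM
  have eN := φ.map_matrix_eq hloc
  obtain ⟨g, hg, φ', hφ', hn⟩ := φ.exists_normalized hi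
  obtain ⟨s, hs, b, hb⟩ := φ'.exists_basis_lift hn
  have ld := φ'.liftData hn hs hb
  have h := FormPair.of_isFormRing hΛ
  have hG : Units.map (mapRingHom (φ'.matrix.prodMap φ'.matrix)).toMonoidHom (pairUnit 1 T) ∈
      locPairGrp m J ι lam Λ := by
    have hgp := pairUnit_C_mem_locPairGrp J hg
    have := mul_mem (mul_mem hgp hN) (inv_mem hgp)
    rw [← pairUnit_inv, ← pairUnit_mul, ← pairUnit_mul, mul_one, mul_inv_cancel, ← eN,
      ← φ.map_matrix_conj hφ'] at this
    convert this using 1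
    refine Units.ext (Polynomial.ext fun n => ?_)
    change ((pairPoly 1 (T : (Module.End Rᵐᵒᵖ (P × R × R))[X])).map _).coeff n =
      (pairPoly 1 ((T : (Module.End Rᵐᵒᵖ (P × R × R))[X]).map φ'.matrix)).coeff n
    rw [coeff_map, coeff_pairPoly, coeff_pairPoly, coeff_map, coeff_one, coeff_one]
    refine Prod.ext ?_ rfl
    change φ'.matrix (if n = 0 then 1 else 0) = if n = 0 then 1 else 0
    split_ifs <;> simp
  have hDk : ∀ p q (s : Subring.center R) (a : Loc m × Loc m),
      pairMap (stdOp (toLoc m lam) p q) (s • a) =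
        s • pairMap (stdOp (ι := ι) (toLoc m lam) p q) a := fun p q s a => by
    have hstd : ∀ x, stdOp (toLoc m lam) p q (s • x) = s • stdOp (toLoc m lam) p q x := fun x => by
      rw [stdOp_apply, stdOp_apply, smul_mul_assoc, Matrix.smul_single]
    exact Prod.ext (hstd _) (hstd _)
  have hker : ∀ a, φ'.matrix.prodMap φ'.matrix a = 0 → ∃ s ∈ symSet m, s • a = 0 := fun a ha => by
    obtain ⟨s₁, hs₁, e₁⟩ := φ'.exists_smul_eq_zero (τ := a.1) (congrArg Prod.fst ha)
    obtain ⟨s₂, hs₂, e₂⟩ := φ'.exists_smul_eq_zero (τ := a.2) (congrArg Prod.snd ha)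
    refine ⟨s₁ * s₂, mul_mem hs₁ hs₂, Prod.ext ?_ ?_⟩
    · change (s₁ * s₂) • a.1 = 0
      rw [mul_comm, mul_smul, e₁, smul_zero]
    · change (s₁ * s₂) • a.2 = 0
      rw [mul_smul, e₂, smul_zero]
  obtain ⟨t, ht, htG⟩ := ld.pair.exists_scaleX_mem (V := pairSubring J) (Λ := pairForm Λ J)
    (S := symSet m) (B := formScalars Λ) (scalarPair_loc m hΛ J hJ) rankOne_stdOp.pair hι hDk
    (fun s a => Prod.ext (φ'.matrix_smul _ _) (φ'.matrix_smul _ _))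
    (fun u q s hs a => Prod.ext (h.alphaEnd_smul _ _ _ hs.1 _) (h.alphaEnd_smul _ _ _ hs.1 _))
    (fun u s hs a => Prod.ext (betaEnd_smul _ _ _ _) (betaEnd_smul _ _ _ _))
    hker (fun y _ a ha => smul_mem_pairSubring J y ha)
    (fun y hy a ha => ⟨⟨hy.2 _ ha.1.1, hy.2 _ ha.1.2⟩, smul_mem_pairSubring J y ha.2⟩)
    (fun s hs => sq_mem_formScalars hΛ hs.2) hs hG
  refine ⟨t, ht, fun y hy z hz => ?_⟩
  have hrel := (mem_relET_of_mem_liftGrp hΛ J (i₀ := i₀) (b := b) (fun q h1 h2 => (hb q h1 h2).2)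
    (fun u q hu h1 h2 => ld.α_mul hu h1 h2) (fun u hu => ld.β_mul hu) (htG y hy z hz)).2
  simp only [map_mul, map_inv] at hrel
  erw [map_fst_scaleX_pairUnit, map_fst_scaleX_pairUnit, map_snd_scaleX_pairUnit,
    map_snd_scaleX_pairUnit] at hrel
  simpa using hrel

end LocalIncrement

theorem exists_ne_swap {n : ℕ} (hn : 3 ≤ n) (p q : Fin n ⊕ Fin n) :
    ∃ w, w ≠ p ∧ w ≠ p.swap ∧ w ≠ q ∧ w ≠ q.swap := by
  have key : ∀ i j : Fin n, ∃ l, l ≠ i ∧ l ≠ j := fun i j => by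
    have : ({i, j} : Finset (Fin n)).card < Fintype.card (Fin n) :=
      lt_of_le_of_lt (Finset.card_insert_le _ _) (by simp; omega)
    obtain ⟨l, hl⟩ := Finset.exists_mem_notMem_of_card_lt_card (s := {i, j}) (t := Finset.univ) this
    exact ⟨l, by simpa using hl.2⟩
  obtain ⟨l, hl⟩ := key (p.elim id id) (q.elim id id)
  refine ⟨.inl l, ?_⟩
  rcases p with p | p <;> rcases q with q | q <;> simpa using hl

end QuadLG

theorem mainTheorem2 {R : Type*} [Ring R] [StarRing R] [Module.Finite (Subring.center R) R]
    (lam : R) (Λ : AddSubgroup R) (hΛ : IsFormRing lam Λ)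
    (J : Ideal R) [J.IsTwoSided] (hJ : ∀ a ∈ J, star a ∈ J)
    {P : Type*} [AddCommGroup P] [Module Rᵐᵒᵖ P]
    [Module.Finite Rᵐᵒᵖ P] [Module.Projective Rᵐᵒᵖ P]
    (f : SesqForm R P) (hf : f.Nonsingular lam)
    (n : ℕ) (hn : 3 ≤ n)
    (φ : ∀ m : MaximalSpectrum (Subring.center R), LocalIsometry f hΛ (Fin (n + 1)) m)
    (σ : PolyQ R P ≃ₗ[R[X]ᵐᵒᵖ] PolyQ R P)
    (hσ : σ ∈ relGQ f.poly.hyp (C lam) (polySubgroup Λ) (polySubgroup J.toAddSubgroup))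
    (hσ0 : ∀ x : P × R × R, PolyQ.coeff 0 (σ (PolyQ.const x)) = x)
    (hloc : ∀ m : MaximalSpectrum (Subring.center R),
      ∃ M ∈ relEQ (Fin (n + 1)) (C (toLoc m lam)) (polySubgroup (locForm m hΛ))
          (polySubgroup (locIdeal m J)),
        IsLocalMatrix (φ m) σ M) :
    σ ∈ relET f.poly (C lam) (polySubgroup Λ) (polySubgroup J.toAddSubgroup) := by
  obtain ⟨T, rfl⟩ := polyAut_surjective σ
  have hinc := increment_mem_of_local hΛ
    (relET f.poly (C lam) (polySubgroup Λ) (polySubgroup J.toAddSubgroup))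
    (fun y => polyAut (Units.map (scaleX (Module.End Rᵐᵒᵖ (P × R × R)) y).toMonoidHom T))
    fun m => by
      obtain ⟨M, hM, hM'⟩ := hloc m
      exact (φ m).exists_increment_mem J hJ (exists_ne_swap (by omega))
        (i₀ := ⟨0, by omega⟩) (i₁ := ⟨1, by omega⟩) (by simp) hM hM'
  have h1 : Units.map (scaleX (Module.End Rᵐᵒᵖ (P × R × R))
      (1 : Subring.center R)).toMonoidHom T = T := Units.ext (scaleX_one _)
  have h0 : Units.map (scaleX (Module.End Rᵐᵒᵖ (P × R × R))
      (0 : Subring.center R)).toMonoidHom T = 1 := by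
    refine Units.ext (Polynomial.ext fun i => ?_)
    change (scaleX _ (0 : Subring.center R) (T : (Module.End Rᵐᵒᵖ (P × R × R))[X])).coeff i = _
    rw [coeff_scaleX, Units.val_one, coeff_one]
    rcases Nat.eq_zero_or_pos i with rfl | hi
    · refine LinearMap.ext fun x => ?_
      have := hσ0 x
      rw [polyAut_apply, coeff_polyEnd] at this
      simpa using this
    · rw [zero_pow hi.ne', zero_smul, if_neg hi.ne']
  rwa [h1, h0, map_one, inv_one, mul_one] at hinc
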